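/- Let $q_0>0$ and let $T,\alpha,\theta_\pm$ be real constants; put $q_\pm=q_0e^{i\theta_\pm}$ and $\Upsilon(x,t)=\alpha x+(2q_0^2+4T^2q_0^4-\alpha^2)t$. Let $q(x,t)$, $(x,t)\in\mathbb R^2$, be a classical solution ($C^2$ in $x$, differentiable in $t$) of the focusing Kundu--Eckhaus equation $$iq_t+q_{xx}+2|q|^2q+4T^2|q|^4q-4iT(|q|^2)_xq=0$$ such that for every $t$ one has $e^{-i\Upsilon}q\to q_\pm$ as $x\to\pm\infty$ and $(1+|x|)^2\,|q-q_\pm e^{i\Upsilon}|$ is integrable on $\mathbb R^\pm$. *Jost solutions.* For $\zeta\in\mathbb C\setminus\{0\}$ let $\lambda=\tfrac12(\zeta+q_0^2\zeta^{-1})$, let $z$ be defined by $z-Tq_0^2+\tfrac\alpha2=\tfrac12(\zeta-q_0^2\zeta^{-1})$, and let $\Theta(x,t,\zeta)=\lambda\,(x+2(z+Tq_0^2-\tfrac\alpha2)t)$. Let $D_1,D_2$ be the sets where $(|\zeta|^2-q_0^2)\operatorname{Im}\zeta$ is $>0$, respectively $<0$, and let $\Sigma=\big(\mathbb R\cup\{|\zeta|=q_0\}\big)\setminus\{0,\pm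 iq_0\}$. Consider the Lax pair $$\Psi_x=\big(U-i(z+\tfrac\alpha2)\sigma_3\big)\Psi,\qquad \Psi_t=\big(V-2i(z^2+\tfrac14(2q_0^2+4T^2q_0^4-\alpha^2))\sigma_3\big)\Psi,$$ $$U=\begin{pmatrix}iT|q|^2&qe^{-i\Upsilon}\\-\bar qe^{i\Upsilon}&-iT|q|^2\end{pmatrix},\qquad V=\begin{pmatrix}d&(iq_x+2zq+2T|q|^2q)e^{-i\Upsilon}\\(i\bar q_x-2z\bar q-2T|q|^2\bar q)e^{i\Upsilon}&-d\end{pmatrix},$$ $$d=i|q|^2+4iT^2|q|^4+T(q\bar q_x-q_x\bar q).$$ Let $\psi_\pm=(\psi_{\pm1},\psi_{\pm2})$ be its Jost solutions: simultaneous solutions of both equations for which, at every $t$, the columns of $\psi_\pm e^{i\Theta\sigma_3}$ tend to the corresponding columns of $\begin{pmatrix}1&-iq_\pm\zeta^{-1}\\-i\bar q_\pm\zeta^{-1}&1\end{pmatrix}$ as $x\to\pm\infty$; the columns $\psi_{-1},\psi_{+2}$ are taken for $\zeta\in\Sigma\cup D_1$ and $\psi_{+1},\psi_{-2}$ for $\zeta\in\Sigma\cup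 D_2$. Let $s=\psi_+^{-1}\psi_-$ on $\Sigma$, $b=s_{21}$, and $a=\det(\psi_{-1},\psi_{+2})/(1+q_0^2\zeta^{-2})$ on $\Sigma\cup D_1$ (these do not depend on $(x,t)$). *Reflectionless data with simple poles.* Suppose that $b\equiv0$ on $\Sigma$ and that the zeros of $a$ in $\{|\zeta|>q_0,\ \operatorname{Im}\zeta>0\}$ are exactly $N_1$ distinct points $\zeta_1,\dots,\zeta_{N_1}$, all simple. Let $b_j$ be the constants with $\psi_{-1}=b_j\psi_{+2}$ at $\zeta=\zeta_j$, let $c_j=b_j/a'(\zeta_j)$ and, for $j=1,\dots,N_1$, $$\tilde c_j=-\overline{c_j},\qquad c_{N_1+j}=\frac{q_0^2}{\bar\zeta_j^2}\frac{\bar q_+}{q_+}\tilde c_j,\qquad \tilde c_{N_1+j}=\frac{q_0^2}{\zeta_j^2}\frac{q_+}{\bar q_+}c_j,\qquad \eta_j=\zeta_j,\qquad \eta_{N_1+j}=-\frac{q_0^2}{\bar\zeta_j}.$$ For $j,l=1,\dots,2N_1$ define $$M_{j,l}=\delta_{j,l}-\sum_{k=1}^{2N_1}\frac{c_ke^{2i\Theta(\eta_k)}}{\bar\eta_j-\eta_k}\cdot\frac{\tilde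 c_le^{-2i\Theta(\bar\eta_l)}}{\eta_k-\bar\eta_l},\qquad g_j=\tilde c_je^{-2i\Theta(\bar\eta_j)},\qquad f_j=iq_+^{-1}+\sum_{k=1}^{2N_1}\frac{c_ke^{2i\Theta(\eta_k)}}{(\bar\eta_j-\eta_k)\eta_k},$$ $G=(g_1,\dots,g_{2N_1})^{\mathrm T}$, $F=(f_1,\dots,f_{2N_1})^{\mathrm T}$ and the $(2N_1+1)\times(2N_1+1)$ matrix $M^\Delta=\begin{pmatrix}G^{\mathrm T}&0\\M&F\end{pmatrix}$. Then for all $(x,t)\in\mathbb R^2$ the function $|q(\cdot,t)|^2-q_0^2$ is integrable on $(x,\infty)$, $|M|=\det M\neq0$, and, with $\omega_+(x,t)=T\int_x^{\infty}(|q(y,t)|^2-q_0^2)\,dy$, $$q(x,t)=e^{i(\Upsilon-2\omega_+)}\,q_+\left(1-\frac{|M^\Delta|}{|M|}\right).$$ -/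

import Mathlib

open Matrix Filter Topology MeasureTheory
open scoped ComplexConjugate

noncomputable section

namespace KunduEckhaus

/-- The real parameters of the boundary value problem: the amplitude `q₀ > 0`, the coefficient `T`
of the equation, the wave number `α` and the phases `θ₊`, `θ₋` of the background. -/
structure Params where
  q₀ : ℝ
  T : ℝ
  α : ℝ
  θp : ℝ
  θm : ℝ
  q₀_pos : 0 < q₀

variable (P : Params)

/-- `q₊ = q₀ e^{iθ₊}`. -/
def Params.qp : ℂ := P.q₀ * Complex.exp (Complex.I * P.θp)

/-- `q₋ = q₀ e^{iθ₋}`. -/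
def Params.qm : ℂ := P.q₀ * Complex.exp (Complex.I * P.θm)

/-- `2q₀² + 4T²q₀⁴ - α²`. -/
def freq : ℝ := 2 * P.q₀ ^ 2 + 4 * P.T ^ 2 * P.q₀ ^ 4 - P.α ^ 2

/-- The background phase `Υ(x,t) = αx + (2q₀² + 4T²q₀⁴ - α²)t`. -/
def Ups (x t : ℝ) : ℝ := P.α * x + freq P * t

/-! ### The equation and the nonzero boundary conditions -/

/-- `∂ₓ q (x,t)`. -/
def dx (q : ℝ → ℝ → ℂ) (x t : ℝ) : ℂ := deriv (fun y => q y t) x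

/-- `q` (a function of `x` and then `t`) is a classical solution of the focusing Kundu-Eckhaus
equation with nonzero boundary conditions, and it decays to the background at the rate
`L^{1,2}` on each half line, that is `∫ (1 + |x|)² |q(x,t) - q_± e^{iΥ}| dx < ∞`. -/
structure IsSolution (q : ℝ → ℝ → ℂ) : Prop where
  contDiff_x : ∀ t, ContDiff ℝ 2 (fun x => q x t)
  differentiable_t : ∀ x, Differentiable ℝ (fun t => q x t)
  equation : ∀ x t,
    Complex.I * deriv (fun s => q x s) t + deriv (fun y => dx q y t) x
      + 2 * (‖q x t‖ : ℂ) ^ 2 * q x t + 4 * (P.T : ℂ) ^ 2 * (‖q x t‖ : ℂ) ^ 4 * q x t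
      - 4 * Complex.I * P.T * (deriv (fun y => ‖q y t‖ ^ 2) x : ℝ) * q x t = 0
  tendsto_top : ∀ t, Tendsto (fun x => Complex.exp (-Complex.I * Ups P x t) * q x t) atTop (𝓝 P.qp)
  tendsto_bot : ∀ t, Tendsto (fun x => Complex.exp (-Complex.I * Ups P x t) * q x t) atBot (𝓝 P.qm)
  decay_top : ∀ t, IntegrableOn (fun x : ℝ =>
    (1 + |x|) ^ 2 * ‖q x t - P.qp * Complex.exp (Complex.I * Ups P x t)‖) (Set.Ici 0)
  decay_bot : ∀ t, IntegrableOn (fun x : ℝ =>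
    (1 + |x|) ^ 2 * ‖q x t - P.qm * Complex.exp (Complex.I * Ups P x t)‖) (Set.Iic 0)

/-! ### Uniformization -/

/-- `λ = (ζ + q₀²/ζ)/2`. -/
def lam (ζ : ℂ) : ℂ := (ζ + (P.q₀ : ℂ) ^ 2 / ζ) / 2

/-- The spectral parameter `z`, given by `z - Tq₀² + α/2 = (ζ - q₀²/ζ)/2`. -/
def specZ (ζ : ℂ) : ℂ := (ζ - (P.q₀ : ℂ) ^ 2 / ζ) / 2 + P.T * (P.q₀ : ℂ) ^ 2 - P.α / 2

/-- `Θ(x,t,ζ) = λ (x + 2(z + Tq₀² - α/2)t)`. -/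
def Theta (x t : ℝ) (ζ : ℂ) : ℂ :=
  lam P ζ * (x + 2 * (specZ P ζ + P.T * (P.q₀ : ℂ) ^ 2 - P.α / 2) * t)

/-- `D₁ = {ζ : (|ζ|² - q₀²) Im ζ > 0}`. -/
def D₁ : Set ℂ := {ζ | 0 < (‖ζ‖ ^ 2 - P.q₀ ^ 2) * ζ.im}

/-- `D₂ = {ζ : (|ζ|² - q₀²) Im ζ < 0}`. -/
def D₂ : Set ℂ := {ζ | (‖ζ‖ ^ 2 - P.q₀ ^ 2) * ζ.im < 0}

/-- The continuous spectrum: the real line (without the point `0`, where `λ` is not defined)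
together with the circle `|ζ| = q₀`, without the branch points `±iq₀`. -/
def Sig : Set ℂ :=
  {ζ | (ζ.im = 0 ∨ ‖ζ‖ = P.q₀) ∧ ζ ≠ 0 ∧ ζ ≠ Complex.I * P.q₀ ∧ ζ ≠ -(Complex.I * P.q₀)}

/-! ### Lax pair, Jost solutions and scattering data -/

/-- The matrix `U - i(z + α/2)σ₃` of the spatial Lax equation. -/
def laxX (q : ℝ → ℝ → ℂ) (x t : ℝ) (ζ : ℂ) : Matrix (Fin 2) (Fin 2) ℂ :=
  !![Complex.I * P.T * (‖q x t‖ : ℂ) ^ 2, q x t * Complex.exp (-Complex.I * Ups P x t);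
     -conj (q x t) * Complex.exp (Complex.I * Ups P x t), -Complex.I * P.T * (‖q x t‖ : ℂ) ^ 2]
  - (Complex.I * (specZ P ζ + P.α / 2)) • !![1, 0; 0, -1]

/-- The diagonal entry `i|q|² + 4iT²|q|⁴ + T(q q̄ₓ - qₓ q̄)` of `V`. -/
def laxTdiag (q : ℝ → ℝ → ℂ) (x t : ℝ) : ℂ :=
  Complex.I * (‖q x t‖ : ℂ) ^ 2 + 4 * Complex.I * (P.T : ℂ) ^ 2 * (‖q x t‖ : ℂ) ^ 4
    + P.T * (q x t * conj (dx q x t) - dx q x t * conj (q x t))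

/-- The matrix `V - 2i(z² + (2q₀² + 4T²q₀⁴ - α²)/4)σ₃` of the temporal Lax equation. -/
def laxT (q : ℝ → ℝ → ℂ) (x t : ℝ) (ζ : ℂ) : Matrix (Fin 2) (Fin 2) ℂ :=
  !![laxTdiag P q x t,
     (Complex.I * dx q x t + 2 * specZ P ζ * q x t + 2 * P.T * (‖q x t‖ : ℂ) ^ 2 * q x t)
       * Complex.exp (-Complex.I * Ups P x t);
     (Complex.I * conj (dx q x t) - 2 * specZ P ζ * conj (q x t)
         - 2 * P.T * (‖q x t‖ : ℂ) ^ 2 * conj (q x t)) * Complex.exp (Complex.I * Ups P x t),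
     -laxTdiag P q x t]
  - (2 * Complex.I * (specZ P ζ ^ 2 + (freq P : ℂ) / 4)) • !![1, 0; 0, -1]

/-- `v(x,t)` solves both Lax equations at the spectral point `ζ`. -/
def SolvesLax (q : ℝ → ℝ → ℂ) (ζ : ℂ) (v : ℝ → ℝ → Fin 2 → ℂ) : Prop :=
  (∀ x t, HasDerivAt (fun y => v y t) (laxX P q x t ζ *ᵥ v x t) x) ∧
  (∀ x t, HasDerivAt (fun s => v x s) (laxT P q x t ζ *ᵥ v x t) t)

/-- The matrix `E` of the background with boundary value `w` (`w = q₊` or `w = q₋`). -/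
def bgE (w ζ : ℂ) : Matrix (Fin 2) (Fin 2) ℂ :=
  !![1, -Complex.I * w / ζ; -Complex.I * conj w / ζ, 1]

/-- Column `k` of the matrix `A`, as a function of `(x,t)`, at the spectral point `ζ`. -/
def colFn (A : ℝ → ℝ → ℂ → Matrix (Fin 2) (Fin 2) ℂ) (k : Fin 2) (ζ : ℂ) : ℝ → ℝ → Fin 2 → ℂ :=
  fun x t i => A x t ζ i k

/-- `ψp`, `ψm` are the Jost solutions: simultaneous solutions of the Lax pair which behave like
`E_± e^{-iΘσ₃}` as `x → ±∞`. Both columns exist on the continuous spectrum; off it, the first column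
of `ψm` and the second one of `ψp` live on `D₁`, and the two others on `D₂`.
These conditions determine the columns; values elsewhere are irrelevant. -/
structure IsJost (q : ℝ → ℝ → ℂ) (ψp ψm : ℝ → ℝ → ℂ → Matrix (Fin 2) (Fin 2) ℂ) : Prop where
  lax_m₁ : ∀ ζ ∈ Sig P ∪ D₁ P, SolvesLax P q ζ (colFn ψm 0 ζ)
  lax_p₂ : ∀ ζ ∈ Sig P ∪ D₁ P, SolvesLax P q ζ (colFn ψp 1 ζ)
  lax_p₁ : ∀ ζ ∈ Sig P ∪ D₂ P, SolvesLax P q ζ (colFn ψp 0 ζ)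
  lax_m₂ : ∀ ζ ∈ Sig P ∪ D₂ P, SolvesLax P q ζ (colFn ψm 1 ζ)
  asymp_m₁ : ∀ ζ ∈ Sig P ∪ D₁ P, ∀ t, Tendsto
    (fun x => Complex.exp (Complex.I * Theta P x t ζ) • colFn ψm 0 ζ x t) atBot
    (𝓝 (fun i => bgE P.qm ζ i 0))
  asymp_p₂ : ∀ ζ ∈ Sig P ∪ D₁ P, ∀ t, Tendsto
    (fun x => Complex.exp (-Complex.I * Theta P x t ζ) • colFn ψp 1 ζ x t) atTop
    (𝓝 (fun i => bgE P.qp ζ i 1))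
  asymp_p₁ : ∀ ζ ∈ Sig P ∪ D₂ P, ∀ t, Tendsto
    (fun x => Complex.exp (Complex.I * Theta P x t ζ) • colFn ψp 0 ζ x t) atTop
    (𝓝 (fun i => bgE P.qp ζ i 0))
  asymp_m₂ : ∀ ζ ∈ Sig P ∪ D₂ P, ∀ t, Tendsto
    (fun x => Complex.exp (-Complex.I * Theta P x t ζ) • colFn ψm 1 ζ x t) atBot
    (𝓝 (fun i => bgE P.qm ζ i 1))

/-- The scattering matrix `s(ζ) = ψ₊⁻¹ ψ₋` on the continuous spectrum. It does not depend on
`(x,t)` because `ψ₊`, `ψ₋` solve the same linear equations, so it is taken at `(0,0)`. -/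
def scatS (ψp ψm : ℝ → ℝ → ℂ → Matrix (Fin 2) (Fin 2) ℂ) (ζ : ℂ) : Matrix (Fin 2) (Fin 2) ℂ :=
  (ψp 0 0 ζ)⁻¹ * ψm 0 0 ζ

/-- The coefficient `a(ζ) = det(ψ₋₁, ψ₊₂) / (1 + q₀²/ζ²)` on `D₁` and the continuous spectrum, where
`1 + q₀²/ζ² = det ψ₊` on the latter, so that there `a = s₁₁`. The determinant does not depend on
`(x,t)` because the Lax matrices have trace zero. -/
def scatA (ψp ψm : ℝ → ℝ → ℂ → Matrix (Fin 2) (Fin 2) ℂ) (ζ : ℂ) : ℂ :=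
  (ψm 0 0 ζ 0 0 * ψp 0 0 ζ 1 1 - ψm 0 0 ζ 1 0 * ψp 0 0 ζ 0 1) / (1 + (P.q₀ : ℂ) ^ 2 / ζ ^ 2)

/-- Reflectionless scattering data with simple poles: the coefficient `b = s₂₁` vanishes on the
continuous spectrum; in `{|ζ| > q₀, Im ζ > 0}` the zeros of `a` are exactly the `N` points `ζ j`, and
they are simple; `ψ₋₁ = b j • ψ₊₂` at `ζ j` (at `(0,0)`, hence everywhere). -/
structure IsReflectionlessSimple (ψp ψm : ℝ → ℝ → ℂ → Matrix (Fin 2) (Fin 2) ℂ) {N : ℕ}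
    (ζ b : Fin N → ℂ) : Prop where
  reflectionless : ∀ w ∈ Sig P, scatS ψp ψm w 1 0 = 0
  injective : Function.Injective ζ
  outside : ∀ j, P.q₀ < ‖ζ j‖
  upper : ∀ j, 0 < (ζ j).im
  zeros : ∀ w : ℂ, P.q₀ < ‖w‖ → 0 < w.im → (scatA P ψp ψm w = 0 ↔ ∃ j, ζ j = w)
  simple : ∀ j, deriv (scatA P ψp ψm) (ζ j) ≠ 0
  proportional : ∀ j, colFn ψm 0 (ζ j) 0 0 = b j • colFn ψp 1 (ζ j) 0 0

/-- The norming constants `c_j = b_j / a'(ζ_j)`. -/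
def norming (ψp ψm : ℝ → ℝ → ℂ → Matrix (Fin 2) (Fin 2) ℂ) {N : ℕ} (ζ b : Fin N → ℂ) :
    Fin N → ℂ :=
  fun j => b j / deriv (scatA P ψp ψm) (ζ j)

/-! ### The determinants -/

section Determinants

variable {N : ℕ} (ζ c : Fin N → ℂ)

/-- `η_j = ζ_j` and `η_{N+j} = -q₀² / ζ̄_j`. -/
def eta : Fin (N + N) → ℂ := Fin.append ζ (fun j => -(P.q₀ : ℂ) ^ 2 / conj (ζ j))

/-- `c_1, …, c_{2N}`, with `c_{N+j} = (q₀²/ζ̄_j²)(q̄₊/q₊) c̃_j` and `c̃_j = -c̄_j`. -/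
def cAll : Fin (N + N) → ℂ :=
  Fin.append c (fun j => (P.q₀ : ℂ) ^ 2 / conj (ζ j) ^ 2 * (conj P.qp / P.qp) * (-conj (c j)))

/-- `c̃_1, …, c̃_{2N}`, with `c̃_j = -c̄_j` and `c̃_{N+j} = (q₀²/ζ_j²)(q₊/q̄₊) c_j`. -/
def ctAll : Fin (N + N) → ℂ :=
  Fin.append (fun j => -conj (c j))
    (fun j => (P.q₀ : ℂ) ^ 2 / ζ j ^ 2 * (P.qp / conj P.qp) * c j)

/-- `c_k e^{2iΘ(x,t,η_k)}`. -/
def expC (x t : ℝ) (k : Fin (N + N)) : ℂ :=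
  cAll P ζ c k * Complex.exp (2 * Complex.I * Theta P x t (eta P ζ k))

/-- `g_k = c̃_k e^{-2iΘ(x,t,η̄_k)}`. -/
def vecG (x t : ℝ) (k : Fin (N + N)) : ℂ :=
  ctAll P ζ c k * Complex.exp (-2 * Complex.I * Theta P x t (conj (eta P ζ k)))

/-- The `2N × 2N` matrix `M`. -/
def matM (x t : ℝ) : Matrix (Fin (N + N)) (Fin (N + N)) ℂ :=
  Matrix.of fun j l => (if j = l then 1 else 0)
    - ∑ k, expC P ζ c x t k / (conj (eta P ζ j) - eta P ζ k)
        * (vecG P ζ c x t l / (eta P ζ k - conj (eta P ζ l)))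

/-- `f_j = i/q₊ + ∑_k c_k e^{2iΘ(η_k)} / ((η̄_j - η_k) η_k)`. -/
def vecF (x t : ℝ) (j : Fin (N + N)) : ℂ :=
  Complex.I / P.qp
    + ∑ k, expC P ζ c x t k / ((conj (eta P ζ j) - eta P ζ k) * eta P ζ k)

/-- The bordered `(2N+1) × (2N+1)` matrix with first row `(Gᵀ, 0)` and further rows `(M, F)`. -/
def matMΔ (x t : ℝ) : Matrix (Fin (N + N + 1)) (Fin (N + N + 1)) ℂ :=
  Matrix.of (Fin.cons (Fin.snoc (α := fun _ => ℂ) (vecG P ζ c x t) 0)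
    (fun j => Fin.snoc (α := fun _ => ℂ) (matM P ζ c x t j) (vecF P ζ c x t j)))

end Determinants

/-- `ω₊(x,t) = T ∫_x^∞ (|q(y,t)|² - q₀²) dy`. -/
def omegaP (q : ℝ → ℝ → ℂ) (x t : ℝ) : ℝ :=
  P.T * ∫ y in Set.Ioi x, (‖q y t‖ ^ 2 - P.q₀ ^ 2)

end KunduEckhaus

end

noncomputable section

namespace KunduEckhaus

/-! The proof is inverse scattering at a fixed time t, with the time dependence entering only
through Θ. Put u = q e^{-iΥ} and f = T(|q|² - q₀²), and let n = e^{-iΘ}ψ₊₂ and m = e^{iΘ}ψ₋₁ be the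
normalized Jost columns. On Σ ∪ D₁, which is the region Im λ ≥ 0 without 0 and the branch points
±iq₀, each solves a Volterra equation on a half line. Stability of such equations makes n and m
differentiable in ζ within this region and gives limits with first order expansions at the branch
points, where the weight (1+|x|)² is needed (`exists_volterra_slope`, `exists_jost_slope`). A
Riemann-Lebesgue argument gives their limits as ζ → ∞, up to the gauge factor e^{i∫f}
(`jost_tendsto_infinity`), and the symmetry ζ ↦ -q₀²/ζ̄ transfers these to ζ → 0.

Let (a, b)* = (b̄, -ā) denote the antilinear map `dual`. Since b = 0, the function equal to m/a on Σ
∪ D₁ and to n(ζ̄)* on the mirror image is continuous across Σ, hence holomorphic off finitely many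
points. Its poles are 0 and the zeros η_k of a, all simple with known residues. The branch points
are removable because a has a nonzero limit there (`IsJostPair.limits_branch`). Liouville's theorem
writes the function as a sum of partial fractions (`IsJostPair.explicit`).

Evaluated at the points η̄_j, this formula closes to a linear system with matrix M for the values of
n at the η_j. M is invertible: a kernel vector yields rational functions A, B with |A|² + |B|² = 0
on the real line (`det_one_sub_cauchy_ne_zero`). Inserting the partial fractions into the x-equation
and letting ζ → ∞ expresses u through the solution of this system (`IsJostPair.potential_eq`), and
Cramer's rule for a bordered matrix (`mul_det_bordered`) turns the result into the quotient of
determinants. The gauge factor is e^{iω₊}, which produces the phase e^{-2iω₊}. -/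

/-! ### Complex analysis: removable lines and circles, Liouville's theorem with poles -/

/-- The integral along the boundary of the rectangle with opposite corners `a + bi`, `c + di`. -/
def rectInt (f : ℂ → ℂ) (a b c d : ℝ) : ℂ :=
  (∫ x : ℝ in a..c, f (x + b * Complex.I)) - (∫ x : ℝ in a..c, f (x + d * Complex.I)) +
    Complex.I • (∫ y : ℝ in b..d, f (c + y * Complex.I)) -
    Complex.I • (∫ y : ℝ in b..d, f (a + y * Complex.I))

/-- The open rectangle avoids the real axis, so only boundary points can lie on it, and there
Cauchy's theorem needs continuity alone. -/
theorem rectInt_eq_zero {f : ℂ → ℂ} {a b c d : ℝ}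
    (hc : ContinuousOn f (Set.uIcc a c ×ℂ Set.uIcc b d))
    (hd : ∀ z ∈ Set.uIcc a c ×ℂ Set.uIcc b d, z.im ≠ 0 → DifferentiableAt ℂ f z)
    (h0 : ∀ y ∈ Set.Ioo (min b d) (max b d), y ≠ 0) : rectInt f a b c d = 0 := by
  have := Complex.integral_boundary_rect_eq_zero_of_continuousOn_of_differentiableOn f
    ⟨a, b⟩ ⟨c, d⟩ hc (fun z hz => (hd z ?_ (h0 _ hz.2)).differentiableWithinAt)
  · exact this
  · exact ⟨Set.Ioo_subset_Icc_self hz.1, Set.Ioo_subset_Icc_self hz.2⟩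

theorem rectInt_split {f : ℂ → ℂ} {a b c d : ℝ} (h0 : (0 : ℝ) ∈ Set.uIcc b d)
    (hc : ContinuousOn f (Set.uIcc a c ×ℂ Set.uIcc b d)) :
    rectInt f a b c d = rectInt f a b c 0 + rectInt f a 0 c d := by
  have key : ∀ e ∈ Set.uIcc a c,
      (∫ y : ℝ in b..d, f (e + y * Complex.I)) =
        (∫ y : ℝ in b..0, f (e + y * Complex.I)) + ∫ y : ℝ in (0 : ℝ)..d, f (e + y * Complex.I) := by
    intro e he
    have hco : ContinuousOn (fun y : ℝ => f (e + y * Complex.I)) (Set.uIcc b d) := by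
      refine hc.comp (by fun_prop) fun y hy => ?_
      simpa [Complex.mem_reProdIm] using ⟨he, hy⟩
    refine (intervalIntegral.integral_add_adjacent_intervals ?_ ?_).symm
    · exact (hco.mono (Set.uIcc_subset_uIcc Set.left_mem_uIcc h0)).intervalIntegrable
    · exact (hco.mono (Set.uIcc_subset_uIcc h0 Set.right_mem_uIcc)).intervalIntegrable
  simp only [rectInt, key a Set.left_mem_uIcc, key c Set.right_mem_uIcc, smul_add]
  ring

/-- A continuous function that is holomorphic off the real line is holomorphic. -/
theorem differentiableOn_of_off_real {f : ℂ → ℂ} {U : Set ℂ} (hU : IsOpen U)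
    (hc : ContinuousOn f U) (hd : ∀ z ∈ U, z.im ≠ 0 → DifferentiableAt ℂ f z) :
    DifferentiableOn ℂ f U := by
  refine (Complex.isConservativeOn_and_continuousOn_iff_isDifferentiableOn hU).1 ⟨?_, hc⟩
  intro z w hzw
  rw [← add_eq_zero_iff_eq_neg, Complex.wedgeIntegral_add_wedgeIntegral_eq]
  change rectInt f z.re z.im w.re w.im = 0
  have hsub : Set.uIcc z.re w.re ×ℂ Set.uIcc z.im w.im ⊆ U := hzw
  -- Morera: a rectangle that meets the real axis is cut along it, and each part touches the axis
  -- only with an edge.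
  by_cases h0 : (0 : ℝ) ∈ Set.uIcc z.im w.im
  · rw [rectInt_split h0 (hc.mono hsub)]
    have h1 : Set.uIcc z.re w.re ×ℂ Set.uIcc z.im 0 ⊆ U := fun p hp =>
      hsub ⟨hp.1, Set.uIcc_subset_uIcc Set.left_mem_uIcc h0 hp.2⟩
    have h2 : Set.uIcc z.re w.re ×ℂ Set.uIcc 0 w.im ⊆ U := fun p hp =>
      hsub ⟨hp.1, Set.uIcc_subset_uIcc h0 Set.right_mem_uIcc hp.2⟩
    rw [rectInt_eq_zero (hc.mono h1) (fun p hp => hd p (h1 hp)),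
      rectInt_eq_zero (hc.mono h2) (fun p hp => hd p (h2 hp)), add_zero]
    · rintro y ⟨hy1, hy2⟩ rfl
      rcases le_total 0 w.im with h | h <;> simp [h] at hy1 hy2
    · rintro y ⟨hy1, hy2⟩ rfl
      rcases le_total z.im 0 with h | h <;> simp [h] at hy1 hy2
  · refine rectInt_eq_zero (hc.mono hsub) (fun p hp => hd p (hsub hp)) ?_
    rintro y hy rfl
    exact h0 (Set.Ioo_subset_Icc_self hy)

/-- A continuous function that is holomorphic off a circle around `0` is holomorphic off `0`. -/
theorem differentiableAt_of_off_circle {f : ℂ → ℂ} {U : Set ℂ} {ρ : ℝ} (hρ : 0 < ρ) (hU : IsOpen U)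
    (hc : ContinuousOn f U) (hd : ∀ z ∈ U, ‖z‖ ≠ ρ → DifferentiableAt ℂ f z) {p : ℂ} (hp : p ∈ U)
    (hp0 : p ≠ 0) : DifferentiableAt ℂ f p := by
  have hρ' : (ρ : ℂ) ≠ 0 := by exact_mod_cast hρ.ne'
  -- The map w ↦ ρe^{iw} is locally biholomorphic and sends exactly the real line to the circle,
  -- which reduces the claim to the previous theorem.
  set e : ℂ → ℂ := fun w => ρ * Complex.exp (Complex.I * w) with he
  have hed : Differentiable ℂ e := by fun_prop
  have hV : IsOpen (e ⁻¹' U) := hU.preimage hed.continuous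
  have hg : DifferentiableOn ℂ (f ∘ e) (e ⁻¹' U) := by
    refine differentiableOn_of_off_real hV
      (hc.comp hed.continuous.continuousOn fun _ h => h) fun w hw him => ?_
    refine (hd (e w) hw ?_).comp w hed.differentiableAt
    simp only [he, norm_mul, Complex.norm_real, Complex.norm_exp, Real.norm_eq_abs, abs_of_pos hρ]
    intro h
    have : Real.exp (Complex.I * w).re = 1 := by
      field_simp at h
      exact h
    rw [Real.exp_eq_one_iff] at this
    simp at this
    exact him this
  -- A right inverse of e that is holomorphic at p: dividing by p puts the argument of the variable
  -- logarithm near 1, away from the cut.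
  set l : ℂ → ℂ := fun ζ => -Complex.I * (Complex.log (p / ρ) + Complex.log (ζ / p)) with hl
  have hel : ∀ ζ : ℂ, ζ ≠ 0 → e (l ζ) = ζ := by
    intro ζ hζ
    simp only [he, hl]
    rw [show Complex.I * (-Complex.I * (Complex.log (p / ρ) + Complex.log (ζ / p)))
      = Complex.log (p / ρ) + Complex.log (ζ / p) by
        linear_combination (-(Complex.log (p / ρ) + Complex.log (ζ / p))) * Complex.I_sq,
      Complex.exp_add, Complex.exp_log (div_ne_zero hp0 hρ'), Complex.exp_log (div_ne_zero hζ hp0)]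
    field_simp
  have hld : DifferentiableAt ℂ l p := by
    refine ((differentiableAt_const _).add ?_).const_mul _
    refine DifferentiableAt.clog (by fun_prop) ?_
    rw [div_self hp0]
    exact Complex.one_mem_slitPlane
  have hlp : l p ∈ e ⁻¹' U := by
    change e (l p) ∈ U
    rwa [hel p hp0]
  have h1 : DifferentiableAt ℂ ((f ∘ e) ∘ l) p :=
    ((hg.differentiableAt (hV.mem_nhds hlp))).comp p hld
  refine h1.congr_of_eventuallyEq ?_
  filter_upwards [isOpen_ne.mem_nhds hp0] with ζ hζ
  simp [hel ζ hζ]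

/-- The singularities are filled in one at a time; the limit condition is Riemann's little-o
criterion in multiplied form. -/
theorem exists_differentiable_of_removable (s : Finset ℂ) : ∀ G : ℂ → ℂ,
    (∀ z ∉ s, DifferentiableAt ℂ G z) →
    (∀ p ∈ s, Tendsto (fun z => (z - p) * G z) (𝓝[≠] p) (𝓝 0)) →
    ∃ H : ℂ → ℂ, Differentiable ℂ H ∧ ∀ z ∉ s, H z = G z := by
  classical
  induction s using Finset.induction_on with
  | empty => exact fun G hd _ => ⟨G, fun z => hd z (by simp), fun _ _ => rfl⟩
  | insert p s hps ih =>
    intro G hd hs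
    set G' := Function.update G p (limUnder (𝓝[≠] p) G) with hG'
    have hso : IsOpen ((s : Set ℂ)ᶜ) := s.finite_toSet.isClosed.isOpen_compl
    have hpn : ((s : Set ℂ)ᶜ) ∈ 𝓝 p := hso.mem_nhds hps
    have hdp : DifferentiableOn ℂ G' ((s : Set ℂ)ᶜ) := by
      refine Complex.differentiableOn_update_limUnder_of_isLittleO hpn ?_ ?_
      · rintro z ⟨hz, hzp⟩
        refine (hd z ?_).differentiableWithinAt
        simp only [Finset.mem_insert, not_or]
        exact ⟨hzp, hz⟩
      · rw [Asymptotics.isLittleO_iff_tendsto']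
        · have h1 := hs p (by simp)
          have h2 : Tendsto (fun z => (z - p) * G p) (𝓝[≠] p) (𝓝 0) := by
            have : Tendsto (fun z => (z - p) * G p) (𝓝 p) (𝓝 ((p - p) * G p)) :=
              Continuous.tendsto (by fun_prop) p
            simpa using this.mono_left nhdsWithin_le_nhds
          have h3 := h1.sub h2
          rw [sub_zero] at h3
          refine h3.congr fun z => ?_
          rw [div_inv_eq_mul]
          ring
        · filter_upwards [self_mem_nhdsWithin] with z hz h
          exact absurd (inv_eq_zero.1 h) (sub_ne_zero.2 hz)
    obtain ⟨H, hH, hHG⟩ := ih G' (fun z hz => hdp.differentiableAt (hso.mem_nhds hz)) (by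
      intro r hr
      have hrp : r ≠ p := fun h => hps (h ▸ hr)
      refine (hs r (by simp [hr])).congr' ?_
      filter_upwards [mem_nhdsWithin_of_mem_nhds (isOpen_ne.mem_nhds hrp)] with z hz
      rw [hG', Function.update_of_ne hz])
    refine ⟨H, hH, fun z hz => ?_⟩
    simp only [Finset.mem_insert, not_or] at hz
    rw [hHG z hz.2, hG', Function.update_of_ne hz.1]

/-- A function with finitely many removable singularities that vanishes at infinity is zero. -/
theorem eq_zero_of_removable {s : Finset ℂ} {G : ℂ → ℂ} (hd : ∀ z ∉ s, DifferentiableAt ℂ G z)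
    (hs : ∀ p ∈ s, Tendsto (fun z => (z - p) * G z) (𝓝[≠] p) (𝓝 0))
    (hinf : Tendsto G (cocompact ℂ) (𝓝 0)) {z : ℂ} (hz : z ∉ s) : G z = 0 := by
  obtain ⟨H, hH, hHG⟩ := exists_differentiable_of_removable s G hd hs
  rw [← hHG z hz]
  refine hH.apply_eq_of_tendsto_cocompact z (hinf.congr' ?_)
  have : ((s : Set ℂ)ᶜ) ∈ cocompact ℂ := s.finite_toSet.isCompact.compl_mem_cocompact
  filter_upwards [this] with w hw
  exact (hHG w hw).symm

/-! ### Algebra of Cauchy matrices and bordered determinants -/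

section Cauchy

variable {ι : Type*} [Fintype ι]

/-- Partial fractions of a product: each coefficient of one factor is multiplied by the value of the
other factor at the pole. It serves to expand |A|² and |B|² on the real line. -/
theorem sum_div_mul_sum_div (a b u v : ι → ℂ) (x : ℂ) (hu : ∀ k, x ≠ u k) (hv : ∀ l, x ≠ v l)
    (huv : ∀ k l, u k ≠ v l) :
    (∑ k, a k / (x - u k)) * (∑ l, b l / (x - v l)) =
      ∑ k, a k * (∑ l, b l / (u k - v l)) / (x - u k) +
        ∑ l, b l * (∑ k, a k / (v l - u k)) / (x - v l) := by
  have h1 : ∑ l, b l * (∑ k, a k / (v l - u k)) / (x - v l) =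
      ∑ k, ∑ l, b l * (a k / (v l - u k)) / (x - v l) := by
    rw [Finset.sum_comm]
    simp only [Finset.mul_sum, Finset.sum_div]
  rw [h1, Finset.sum_mul_sum, ← Finset.sum_add_distrib]
  refine Finset.sum_congr rfl fun k _ => ?_
  rw [Finset.mul_sum, Finset.sum_div, ← Finset.sum_add_distrib]
  refine Finset.sum_congr rfl fun l _ => ?_
  have := sub_ne_zero.2 (hu k)
  have := sub_ne_zero.2 (hv l)
  have h3 := sub_ne_zero.2 (huv k l)
  rw [← neg_sub (u k) (v l)]
  field_simp
  ring

/-- A sum of simple fractions that vanishes on the real line vanishes. -/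
theorem sum_div_eq_zero_of_real (a u : ι → ℂ) (hr : ∀ x : ℝ, ∑ k, a k / (x - u k) = 0)
    (hu : ∀ k, ∀ x : ℝ, (x : ℂ) ≠ u k) (z : ℂ) (hz : ∀ k, z ≠ u k) :
    ∑ k, a k / (z - u k) = 0 := by
  classical
  set p : Polynomial ℂ := ∑ k, Polynomial.C (a k) *
    ∏ i ∈ Finset.univ.erase k, (Polynomial.X - Polynomial.C (u i)) with hp
  have heval : ∀ w : ℂ, (∀ k, w ≠ u k) →
      p.eval w = (∏ i, (w - u i)) * ∑ k, a k / (w - u k) := by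
    intro w hw
    rw [hp, Polynomial.eval_finsetSum, Finset.mul_sum]
    refine Finset.sum_congr rfl fun k _ => ?_
    rw [Polynomial.eval_mul, Polynomial.eval_prod, Polynomial.eval_C,
      ← Finset.mul_prod_erase Finset.univ _ (Finset.mem_univ k)]
    simp only [Polynomial.eval_sub, Polynomial.eval_X, Polynomial.eval_C]
    have := sub_ne_zero.2 (hw k)
    field_simp
  have hp0 : p = 0 := by
    refine Polynomial.eq_zero_of_infinite_isRoot p
      ((Set.infinite_range_of_injective Complex.ofReal_injective).mono ?_)
    rintro _ ⟨x, rfl⟩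
    simp [Polynomial.IsRoot, heval x (fun k => hu k x), hr x]
  have := heval z hz
  rw [hp0, Polynomial.eval_zero] at this
  exact (mul_eq_zero.1 this.symm).resolve_left
    (Finset.prod_ne_zero_iff.2 fun i _ => sub_ne_zero.2 (hz i))

/-- The matrix of the reflectionless system for the focusing symmetry is invertible. -/
theorem det_one_sub_cauchy_ne_zero [DecidableEq ι] (η C g : ι → ℂ)
    (hη : ∀ k l, η k ≠ conj (η l)) (hg : ∀ l, g l = -conj (C l)) :
    (Matrix.of fun j l => (if j = l then (1 : ℂ) else 0)
      - ∑ k, C k / (conj (η j) - η k) * (g l / (η k - conj (η l)))).det ≠ 0 := by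
  intro hdet
  obtain ⟨r, hr0, hr⟩ := Matrix.exists_mulVec_eq_zero_iff.2 hdet
  -- Put A(z) = Σ C_k p_k/(z - η_k) and B(z) = Σ g_l r_l/(z - η̄_l). Then p_k = B(η_k) by
  -- definition, and the kernel equation says A(η̄_j) = r_j.
  set p : ι → ℂ := fun k => ∑ l, g l * r l / (η k - conj (η l)) with hp
  have hrj : ∀ j, ∑ k, C k * p k / (conj (η j) - η k) = r j := by
    intro j
    have h := congrFun hr j
    simp only [Matrix.mulVec, dotProduct, Matrix.of_apply, sub_mul, Finset.sum_sub_distrib,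
      ite_mul, one_mul, zero_mul, Finset.sum_ite_eq, Finset.mem_univ, if_true, Pi.zero_apply] at h
    rw [sub_eq_zero] at h
    rw [h]
    simp only [hp, Finset.mul_sum, Finset.sum_mul, Finset.sum_div]
    rw [Finset.sum_comm]
    refine Finset.sum_congr rfl fun l _ => Finset.sum_congr rfl fun k _ => ?_
    ring
  have hreal : ∀ k, ∀ x : ℝ, (x : ℂ) ≠ η k := by
    intro k x hx
    apply hη k k
    rw [← hx, Complex.conj_ofReal]
  have hreal' : ∀ k, ∀ x : ℝ, (x : ℂ) ≠ conj (η k) := by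
    intro k x hx
    apply hreal k x
    rw [← Complex.conj_conj (η k), ← hx, Complex.conj_ofReal]
  -- In |A|² + |B|² the coefficients at 1/(x - η_k) are C_k p_k r̄_k and, because g = -C̄, its
  -- negative; those at the conjugate poles cancel in the same way. Hence A vanishes on the real
  -- line.
  have hzero : ∀ x : ℝ, ∑ k, C k * p k / (x - η k) = 0 := by
    intro x
    have h1 := sum_div_mul_sum_div (fun k => C k * p k) (fun l => conj (C l * p l)) η
      (fun l => conj (η l)) x (fun k => hreal k x) (fun l => hreal' l x) hη
    have h2 := sum_div_mul_sum_div (fun k => conj (g k * r k)) (fun l => g l * r l) η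
      (fun l => conj (η l)) x (fun k => hreal k x) (fun l => hreal' l x) hη
    have e1 : ∀ k, ∑ l, conj (C l * p l) / (η k - conj (η l)) = conj (r k) := by
      intro k
      rw [← hrj k, map_sum]
      simp
    have e2 : ∀ k, ∑ l, conj (g l * r l) / (conj (η k) - η l) = conj (p k) := by
      intro k
      rw [hp, map_sum]
      simp
    simp only [e1, hrj] at h1
    have e3 : ∀ k, ∑ l, g l * r l / (η k - conj (η l)) = p k := fun _ => rfl
    simp only [e2, e3] at h2
    have c1 : ∑ l, conj (C l * p l) / ((x : ℂ) - conj (η l)) =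
        conj (∑ k, C k * p k / ((x : ℂ) - η k)) := by
      rw [map_sum]
      simp
    have c2 : ∑ k, conj (g k * r k) / ((x : ℂ) - η k) =
        conj (∑ l, g l * r l / ((x : ℂ) - conj (η l))) := by
      rw [map_sum]
      simp
    rw [c1] at h1
    rw [c2] at h2
    have hsum : (∑ k, C k * p k / ((x : ℂ) - η k)) * conj (∑ k, C k * p k / ((x : ℂ) - η k)) +
        conj (∑ l, g l * r l / ((x : ℂ) - conj (η l))) *
          (∑ l, g l * r l / ((x : ℂ) - conj (η l))) = 0 := by
      rw [h1, h2]
      have d1 : ∑ k, C k * p k * conj (r k) / ((x : ℂ) - η k) +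
          ∑ k, conj (g k * r k) * p k / (x - η k) = 0 := by
        rw [← Finset.sum_add_distrib]
        refine Finset.sum_eq_zero fun k _ => ?_
        rw [hg]
        simp only [map_mul, map_neg, Complex.conj_conj]
        ring
      have d2 : ∑ l, conj (C l * p l) * r l / ((x : ℂ) - conj (η l)) +
          ∑ l, g l * r l * conj (p l) / ((x : ℂ) - conj (η l)) = 0 := by
        rw [← Finset.sum_add_distrib]
        refine Finset.sum_eq_zero fun k _ => ?_
        rw [hg]
        simp only [map_mul]
        ring
      linear_combination d1 + d2
    rw [Complex.mul_conj, mul_comm, Complex.mul_conj, ← Complex.ofReal_add] at hsum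
    have h3 := Complex.ofReal_eq_zero.1 hsum
    have h4 := Complex.normSq_nonneg (∑ k, C k * p k / ((x : ℂ) - η k))
    have h5 := Complex.normSq_nonneg (∑ l, g l * r l / ((x : ℂ) - conj (η l)))
    exact Complex.normSq_eq_zero.1 (le_antisymm (by linarith) h4)
  apply hr0
  funext j
  rw [← hrj j]
  exact sum_div_eq_zero_of_real (fun k => C k * p k) η hzero hreal _ fun k h => hη k j h.symm

end Cauchy

/-- Cramer's rule for a bordered determinant of odd size. -/
theorem mul_det_bordered {n : ℕ} (hn : Even n) (M : Matrix (Fin n) (Fin n) ℂ) (G F r : Fin n → ℂ)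
    (y : ℂ) (hr : M *ᵥ r = y • F) :
    y * (Matrix.of (Fin.cons (Fin.snoc (α := fun _ => ℂ) G 0)
      (fun j => Fin.snoc (α := fun _ => ℂ) (M j) (F j))) :
        Matrix (Fin (n + 1)) (Fin (n + 1)) ℂ).det = -(G ⬝ᵥ r) * M.det := by
  set A : Matrix (Fin (n + 1)) (Fin (n + 1)) ℂ := Matrix.of
    (Fin.cons (Fin.snoc (α := fun _ => ℂ) G 0)
      (fun j => Fin.snoc (α := fun _ => ℂ) (M j) (F j))) with hA
  -- Moving the last column to the front is a cycle of sign (-1)^n = 1; this is where the parity of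
  -- n enters.
  set B := A.submatrix id (finRotate (n + 1)).symm with hB
  have hdet : B.det = A.det := by
    rw [hB, Matrix.det_permute']
    simp [Equiv.Perm.sign_symm, sign_finRotate, hn.neg_one_pow]
  have h0 : (finRotate (n + 1)).symm 0 = Fin.last n := by
    rw [Equiv.symm_apply_eq, finRotate_last]
  have hs : ∀ l : Fin n, (finRotate (n + 1)).symm l.succ = l.castSucc := by
    intro l
    rw [Equiv.symm_apply_eq, finRotate_apply, Fin.coeSucc_eq_succ]
  have b00 : B 0 0 = 0 := by simp [hB, hA, h0]
  have b0s : ∀ l : Fin n, B 0 l.succ = G l := by intro l; simp [hB, hA, hs]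
  have bs0 : ∀ j : Fin n, B j.succ 0 = F j := by intro j; simp [hB, hA, h0]
  have bss : ∀ j l : Fin n, B j.succ l.succ = M j l := by intro j l; simp [hB, hA, hs]
  -- B maps (y, -r) to a multiple of the first basis vector. Applying the adjugate isolates y · det
  -- B without dividing by det M.
  have hv : B *ᵥ (Fin.cons y (-r) : Fin (n + 1) → ℂ) = Pi.single 0 (-(G ⬝ᵥ r)) := by
    funext i
    refine Fin.cases ?_ (fun j => ?_) i
    · simp [Matrix.mulVec, dotProduct, Fin.sum_univ_succ, b00, b0s]
    · have := congrFun hr j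
      simp only [Matrix.mulVec, dotProduct, Pi.smul_apply, smul_eq_mul] at this
      simp [Matrix.mulVec, dotProduct, Fin.sum_univ_succ, bs0, bss, this]
      ring
  have hc := congrFun (congrArg (fun v => B.adjugate *ᵥ v) hv) 0
  simp only [Matrix.mulVec_mulVec, Matrix.adjugate_mul, Matrix.smul_mulVec, Matrix.one_mulVec,
    Pi.smul_apply, Fin.cons_zero, smul_eq_mul, Matrix.mulVec_single] at hc
  rw [← hdet, mul_comm, hc]
  have : B.adjugate 0 0 = M.det := by
    rw [Matrix.adjugate_fin_succ_eq_det_submatrix]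
    simp only [Fin.val_zero, add_zero, pow_zero, one_mul]
    congr 1
    ext j l
    simp [bss]
  simp [this, mul_comm]

/-! ### Integrals over half lines and Gronwall's inequality -/

section HalfLine

variable {E : Type*} [NormedAddCommGroup E] [NormedSpace ℝ E]

omit [NormedSpace ℝ E] in
theorem integrableOn_Ioi_of_continuous {F : ℝ → E} (hF : Continuous F) {a : ℝ}
    (hi : IntegrableOn F (Set.Ioi a)) (b : ℝ) : IntegrableOn F (Set.Ioi b) := by
  have h1 : IntegrableOn F (Set.Icc b a) := hF.continuousOn.integrableOn_Icc
  refine (h1.union hi).mono_set fun y hy => ?_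
  rcases le_or_gt y a with h | h
  · exact Or.inl ⟨le_of_lt hy, h⟩
  · exact Or.inr h

theorem integral_Ioi_eq_sub {F : ℝ → E} (hF : Continuous F) {a : ℝ}
    (hi : IntegrableOn F (Set.Ioi a)) (x : ℝ) :
    ∫ y in Set.Ioi x, F y = (∫ y in Set.Ioi a, F y) - ∫ y in a..x, F y := by
  have h := integrableOn_Ioi_of_continuous hF hi x
  have := intervalIntegral.integral_interval_add_Ioi hi h
  rw [← this]
  abel

variable [CompleteSpace E]

theorem hasDerivAt_integral_Ioi {F : ℝ → E} (hF : Continuous F) {a : ℝ}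
    (hi : IntegrableOn F (Set.Ioi a)) (x : ℝ) :
    HasDerivAt (fun x => ∫ y in Set.Ioi x, F y) (-F x) x := by
  have h1 : HasDerivAt (fun x => ∫ y in a..x, F y) (F x) x :=
    intervalIntegral.integral_hasDerivAt_right (hF.intervalIntegrable _ _)
      (hF.stronglyMeasurableAtFilter _ _) hF.continuousAt
  have h2 := h1.const_sub (∫ y in Set.Ioi a, F y)
  exact h2.congr_of_eventuallyEq (Eventually.of_forall fun x => integral_Ioi_eq_sub hF hi x)

omit [CompleteSpace E] in
theorem tendsto_integral_Ioi_zero {F : ℝ → E} (hF : Continuous F) {a : ℝ}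
    (hi : IntegrableOn F (Set.Ioi a)) :
    Tendsto (fun x => ∫ y in Set.Ioi x, F y) atTop (𝓝 0) := by
  have h1 := (intervalIntegral_tendsto_integral_Ioi a hi tendsto_id).const_sub
    (∫ y in Set.Ioi a, F y)
  rw [sub_self] at h1
  exact h1.congr fun x => (integral_Ioi_eq_sub hF hi x).symm

end HalfLine

/-- Gronwall's inequality for a backward integral inequality on a half line. -/
theorem gronwall_Ici {φ h : ℝ → ℝ} {x₀ G B : ℝ} (hφ : ContinuousOn φ (Set.Ici x₀))
    (hφ0 : ∀ x, x₀ ≤ x → 0 ≤ φ x) (hB : ∀ x, x₀ ≤ x → φ x ≤ B) (hh : Continuous h)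
    (hh0 : ∀ y, 0 ≤ h y) (hi : IntegrableOn h (Set.Ioi x₀))
    (hle : ∀ x, x₀ ≤ x → φ x ≤ G + ∫ y in Set.Ioi x, h y * φ y) {x : ℝ} (hx : x₀ ≤ x) :
    φ x ≤ G * Real.exp (∫ y in Set.Ioi x₀, h y) := by
  -- φ is frozen to the left of x₀ so that the integrands are continuous on the whole line.
  set ψ : ℝ → ℝ := fun y => φ (max x₀ y) with hψ
  have hψc : Continuous ψ := by
    have : Continuous fun y => max x₀ y := by fun_prop
    exact hφ.comp_continuous this fun y => Set.mem_Ici.2 (le_max_left _ _)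
  have hψe : ∀ y, x₀ ≤ y → ψ y = φ y := fun y hy => by simp [hψ, max_eq_right hy]
  have hhψ : Continuous fun y => h y * ψ y := hh.mul hψc
  have hhi : IntegrableOn (fun y => h y * ψ y) (Set.Ioi x₀) := by
    refine Integrable.mono' (hi.mul_const B) hhψ.aestronglyMeasurable.restrict ?_
    refine (ae_restrict_iff' measurableSet_Ioi).2 (Eventually.of_forall fun y hy => ?_)
    have hy' : x₀ ≤ y := le_of_lt hy
    rw [hψe y hy', Real.norm_of_nonneg (mul_nonneg (hh0 y) (hφ0 y hy'))]
    exact mul_le_mul_of_nonneg_left (hB y hy') (hh0 y)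
  set H : ℝ → ℝ := fun x => ∫ y in Set.Ioi x, h y with hH
  set Φ : ℝ → ℝ := fun x => ∫ y in Set.Ioi x, h y * ψ y with hΦ
  have hΦe : ∀ x, x₀ ≤ x → Φ x = ∫ y in Set.Ioi x, h y * φ y := by
    intro x hx
    refine setIntegral_congr_fun measurableSet_Ioi fun y hy => ?_
    rw [hψe y (hx.trans (le_of_lt hy))]
  -- Integrating factor: Ψ' = h(G + Φ - ψ)e^{-H} is nonnegative beyond x₀ by the integral
  -- inequality, and Ψ → G at +∞, so Ψ ≤ G.
  set Ψ : ℝ → ℝ := fun x => (G + Φ x) * Real.exp (-H x) with hΨ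
  have hd : ∀ x, HasDerivAt Ψ (h x * (G + Φ x - ψ x) * Real.exp (-H x)) x := by
    intro x
    have h1 := (hasDerivAt_integral_Ioi hhψ hhi x).const_add G
    have h2 := (hasDerivAt_integral_Ioi hh hi x).neg.exp
    refine (h1.mul h2).congr_deriv ?_
    simp only [hH, Pi.neg_apply]
    ring
  have hmono : MonotoneOn Ψ (Set.Ici x₀) := by
    refine monotoneOn_of_deriv_nonneg (convex_Ici x₀)
      (fun x _ => (hd x).continuousAt.continuousWithinAt)
      (fun x _ => (hd x).differentiableAt.differentiableWithinAt) fun x hx => ?_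
    rw [interior_Ici] at hx
    have hx' : x₀ ≤ x := le_of_lt hx
    rw [(hd x).deriv]
    refine mul_nonneg (mul_nonneg (hh0 x) ?_) (Real.exp_pos _).le
    rw [hψe x hx', hΦe x hx']
    linarith [hle x hx']
  have hlim : Tendsto Ψ atTop (𝓝 G) := by
    have h1 := (tendsto_integral_Ioi_zero hhψ hhi).const_add G
    have h2 := (Real.continuous_exp.tendsto _).comp (tendsto_integral_Ioi_zero hh hi).neg
    simpa using h1.mul h2
  have hΨG : ∀ x, x₀ ≤ x → Ψ x ≤ G := fun x hx =>
    ge_of_tendsto hlim <| by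
      filter_upwards [eventually_ge_atTop x] with y hy
      exact hmono hx (hx.trans hy) hy
  have hle2 : ∀ x, x₀ ≤ x → φ x ≤ G * Real.exp (H x) := by
    intro x hx
    have h1 := hle x hx
    rw [← hΦe x hx] at h1
    have h2 := mul_le_mul_of_nonneg_right (hΨG x hx) (Real.exp_pos (H x)).le
    rw [hΨ] at h2
    simp only [mul_assoc, ← Real.exp_add, neg_add_cancel, Real.exp_zero, mul_one] at h2
    linarith
  have hG : 0 ≤ G := by
    have := (hφ0 x hx).trans (hle2 x hx)
    exact nonneg_of_mul_nonneg_left this (Real.exp_pos _)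
  refine (hle2 x hx).trans (mul_le_mul_of_nonneg_left (Real.exp_le_exp.2 ?_) hG)
  exact setIntegral_mono_set hi (Eventually.of_forall hh0) (Set.Ioi_subset_Ioi hx).eventuallyLE

/-! ### Volterra equations on a half line -/

section Volterra

variable {E : Type*} [NormedAddCommGroup E] [NormedSpace ℂ E] [CompleteSpace E]

/-- `N` is a bounded continuous solution of `N x = f x - ∫_x^∞ A x y (N y) dy` on `[x₀, ∞)`. -/
structure IsVolterra (x₀ : ℝ) (A : ℝ → ℝ → E →L[ℂ] E) (f N : ℝ → E) : Prop where
  cont : ContinuousOn N (Set.Ici x₀)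
  bdd : ∃ B, ∀ x, x₀ ≤ x → ‖N x‖ ≤ B
  eq : ∀ x, x₀ ≤ x → N x = f x - ∫ y in Set.Ioi x, A x y (N y)

/-- `A` is a continuous Volterra kernel on `[x₀, ∞)` dominated by `h`. -/
structure IsKernelBound (x₀ : ℝ) (A : ℝ → ℝ → E →L[ℂ] E) (h : ℝ → ℝ) : Prop where
  cont : ∀ x, Continuous (A x)
  le : ∀ x y, x₀ ≤ x → x ≤ y → ‖A x y‖ ≤ h y

omit [CompleteSpace E] in
theorem IsKernelBound.integrableOn {x₀ : ℝ} {A : ℝ → ℝ → E →L[ℂ] E} {h : ℝ → ℝ}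
    (hA : IsKernelBound x₀ A h) (hi : IntegrableOn h (Set.Ioi x₀)) {N : ℝ → E} {B : ℝ}
    (hN : ContinuousOn N (Set.Ici x₀)) (hB : ∀ x, x₀ ≤ x → ‖N x‖ ≤ B) {x : ℝ} (hx : x₀ ≤ x) :
    IntegrableOn (fun y => A x y (N y)) (Set.Ioi x) := by
  refine Integrable.mono' ((hi.mono_set (Set.Ioi_subset_Ioi hx)).mul_const B) ?_ ?_
  · refine ContinuousOn.aestronglyMeasurable ?_ measurableSet_Ioi
    exact (hA.cont x).continuousOn.clm_apply
      (hN.mono fun y hy => hx.trans (le_of_lt hy))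
  · refine (ae_restrict_iff' measurableSet_Ioi).2 (Eventually.of_forall fun y hy => ?_)
    have hy' : x ≤ y := le_of_lt hy
    have h1 := hA.le x y hx hy'
    calc ‖A x y (N y)‖ ≤ ‖A x y‖ * ‖N y‖ := (A x y).le_opNorm _
      _ ≤ h y * B := mul_le_mul h1 (hB y (hx.trans hy')) (norm_nonneg _)
          ((norm_nonneg _).trans h1)

omit [CompleteSpace E] in
theorem IsKernelBound.norm_integral_le {x₀ : ℝ} {A : ℝ → ℝ → E →L[ℂ] E} {h : ℝ → ℝ}
    (hA : IsKernelBound x₀ A h) (hi : IntegrableOn h (Set.Ioi x₀)) (hh0 : ∀ y, 0 ≤ h y)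
    {N : ℝ → E} {B : ℝ}
    (hB : ∀ x, x₀ ≤ x → ‖N x‖ ≤ B) {x : ℝ} (hx : x₀ ≤ x) :
    ‖∫ y in Set.Ioi x, A x y (N y)‖ ≤ (∫ y in Set.Ioi x₀, h y) * B := by
  have hB0 : 0 ≤ B := (norm_nonneg _).trans (hB x hx)
  rw [← integral_mul_const]
  refine (norm_integral_le_of_norm_le
    ((hi.mono_set (Set.Ioi_subset_Ioi hx)).mul_const B) ?_).trans ?_
  · refine (ae_restrict_iff' measurableSet_Ioi).2 (Eventually.of_forall fun y hy => ?_)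
    have hy' : x ≤ y := le_of_lt hy
    have h1 := hA.le x y hx hy'
    calc ‖A x y (N y)‖ ≤ ‖A x y‖ * ‖N y‖ := (A x y).le_opNorm _
      _ ≤ h y * B := mul_le_mul h1 (hB y (hx.trans hy')) (norm_nonneg _)
          ((norm_nonneg _).trans h1)
  · exact setIntegral_mono_set (hi.mul_const B)
      (Eventually.of_forall fun y => mul_nonneg (hh0 y) hB0) (Set.Ioi_subset_Ioi hx).eventuallyLE

omit [CompleteSpace E] in
theorem IsVolterra.norm_le {x₀ : ℝ} {A : ℝ → ℝ → E →L[ℂ] E} {f N : ℝ → E} {h : ℝ → ℝ} {G : ℝ}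
    (hN : IsVolterra x₀ A f N) (hA : IsKernelBound x₀ A h) (hh : Continuous h)
    (hh0 : ∀ y, 0 ≤ h y) (hi : IntegrableOn h (Set.Ioi x₀)) (hf : ∀ x, x₀ ≤ x → ‖f x‖ ≤ G)
    {x : ℝ} (hx : x₀ ≤ x) : ‖N x‖ ≤ G * Real.exp (∫ y in Set.Ioi x₀, h y) := by
  obtain ⟨B, hB⟩ := hN.bdd
  refine gronwall_Ici (φ := fun x => ‖N x‖) hN.cont.norm (fun _ _ => norm_nonneg _) hB hh hh0 hi
    (fun x hx => ?_) hx
  have hcN : ContinuousOn N (Set.Ioi x) := hN.cont.mono fun y hy => hx.trans (le_of_lt hy)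
  rw [hN.eq x hx]
  refine (norm_sub_le _ _).trans (add_le_add (hf x hx) ?_)
  refine norm_integral_le_of_norm_le ?_ ?_
  · refine Integrable.mono' ((hi.mono_set (Set.Ioi_subset_Ioi hx)).mul_const B)
      ((hh.continuousOn.mul hcN.norm).aestronglyMeasurable measurableSet_Ioi) ?_
    refine (ae_restrict_iff' measurableSet_Ioi).2 (Eventually.of_forall fun y hy => ?_)
    rw [Real.norm_of_nonneg (mul_nonneg (hh0 y) (norm_nonneg _))]
    exact mul_le_mul_of_nonneg_left (hB y (hx.trans (le_of_lt hy))) (hh0 y)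
  · refine (ae_restrict_iff' measurableSet_Ioi).2 (Eventually.of_forall fun y hy => ?_)
    exact ((A x y).le_opNorm _).trans
      (mul_le_mul_of_nonneg_right (hA.le x y hx (le_of_lt hy)) (norm_nonneg _))

omit [CompleteSpace E] in
/-- Stability of bounded solutions of Volterra equations. -/
theorem IsVolterra.norm_sub_le {x₀ : ℝ} {A₁ A₂ : ℝ → ℝ → E →L[ℂ] E} {f₁ f₂ N₁ N₂ : ℝ → E}
    {h : ℝ → ℝ} {ε δ B : ℝ} (h₁ : IsVolterra x₀ A₁ f₁ N₁) (h₂ : IsVolterra x₀ A₂ f₂ N₂)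
    (hA₁ : IsKernelBound x₀ A₁ h) (hA₂ : IsKernelBound x₀ A₂ h) (hh : Continuous h)
    (hh0 : ∀ y, 0 ≤ h y) (hi : IntegrableOn h (Set.Ioi x₀))
    (hA : ∀ x y, x₀ ≤ x → x ≤ y → ‖A₁ x y - A₂ x y‖ ≤ ε * h y) (hε : 0 ≤ ε)
    (hB : ∀ x, x₀ ≤ x → ‖N₂ x‖ ≤ B) (hf : ∀ x, x₀ ≤ x → ‖f₁ x - f₂ x‖ ≤ δ)
    {x : ℝ} (hx : x₀ ≤ x) : ‖N₁ x - N₂ x‖ ≤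
      (δ + ε * (∫ y in Set.Ioi x₀, h y) * B) * Real.exp (∫ y in Set.Ioi x₀, h y) := by
  obtain ⟨B₁, hB₁⟩ := h₁.bdd
  have hAd : IsKernelBound x₀ (fun x y => A₁ x y - A₂ x y) (fun y => ε * h y) :=
    ⟨fun x => (hA₁.cont x).sub (hA₂.cont x), hA⟩
  have hD : IsVolterra x₀ A₁
      (fun x => f₁ x - f₂ x - ∫ y in Set.Ioi x, (A₁ x y - A₂ x y) (N₂ y))
      (fun x => N₁ x - N₂ x) := by
    refine ⟨h₁.cont.sub h₂.cont, ⟨B₁ + B, fun x hx =>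
      (_root_.norm_sub_le _ _).trans (add_le_add (hB₁ x hx) (hB x hx))⟩, fun x hx => ?_⟩
    have i1 := hA₁.integrableOn hi h₁.cont hB₁ hx
    have i2 := hA₁.integrableOn hi h₂.cont hB hx
    have i3 := hA₂.integrableOn hi h₂.cont hB hx
    simp only [map_sub, _root_.sub_apply]
    rw [integral_sub i1 i2, integral_sub i2 i3]
    nth_rewrite 1 [h₁.eq x hx]
    nth_rewrite 1 [h₂.eq x hx]
    abel
  refine hD.norm_le hA₁ hh hh0 hi (fun x hx => ?_) hx
  refine (_root_.norm_sub_le _ _).trans (add_le_add (hf x hx) ?_)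
  have := hAd.norm_integral_le (hi.const_mul ε) (fun y => mul_nonneg hε (hh0 y)) hB hx
  rwa [integral_const_mul] at this

/-- Bounded solutions of Volterra equations converge when the data converge. -/
theorem exists_volterra_limit {ι : Type*} {l : Filter ι} [l.NeBot] {x₀ : ℝ}
    {A : ι → ℝ → ℝ → E →L[ℂ] E} {A₀ : ℝ → ℝ → E →L[ℂ] E} {f N : ι → ℝ → E} {f₀ : ℝ → E}
    {h : ℝ → ℝ} {ε δ : ι → ℝ} {G : ℝ}
    (hN : ∀ᶠ i in l, IsVolterra x₀ (A i) (f i) (N i))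
    (hA : ∀ᶠ i in l, IsKernelBound x₀ (A i) h) (hA₀ : IsKernelBound x₀ A₀ h)
    (hh : Continuous h) (hh0 : ∀ y, 0 ≤ h y) (hi : IntegrableOn h (Set.Ioi x₀))
    (hAe : ∀ᶠ i in l, ∀ x y, x₀ ≤ x → x ≤ y → ‖A i x y - A₀ x y‖ ≤ ε i * h y)
    (hε0 : ∀ i, 0 ≤ ε i) (hε : Tendsto ε l (𝓝 0))
    (hG : ∀ x, x₀ ≤ x → ‖f₀ x‖ ≤ G)
    (hf : ∀ᶠ i in l, ∀ x, x₀ ≤ x → ‖f i x - f₀ x‖ ≤ δ i) (hδ : Tendsto δ l (𝓝 0)) :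
    ∃ N₀ : ℝ → E, IsVolterra x₀ A₀ f₀ N₀ ∧ TendstoUniformlyOn N N₀ l (Set.Ici x₀) := by
  set I := ∫ y in Set.Ioi x₀, h y with hI
  have hI0 : 0 ≤ I := integral_nonneg hh0
  set B := (G + 1) * Real.exp I with hB
  have hNB : ∀ᶠ i in l, ∀ x, x₀ ≤ x → ‖N i x‖ ≤ B := by
    filter_upwards [hN, hA, hf, hδ.eventually (ge_mem_nhds zero_lt_one)] with i h1 h2 h3 h4 x hx
    refine h1.norm_le h2 hh hh0 hi (fun x hx => ?_) hx
    calc ‖f i x‖ = ‖f₀ x + (f i x - f₀ x)‖ := by abel_nf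
      _ ≤ G + 1 := (norm_add_le _ _).trans (add_le_add (hG x hx) ((h3 x hx).trans h4))
  have hB0 : 0 ≤ B := by
    obtain ⟨i, hi'⟩ := hNB.exists
    exact (norm_nonneg _).trans (hi' x₀ le_rfl)
  -- Stability makes the family uniformly Cauchy along l. The limit solution is then obtained by
  -- completeness, without a separate existence theorem.
  have hpair : ∀ᶠ p in l ×ˢ l, ∀ x, x₀ ≤ x → ‖N p.1 x - N p.2 x‖ ≤
      ((δ p.1 + δ p.2) + (ε p.1 + ε p.2) * I * B) * Real.exp I := by
    have e1 := (hN.and (hA.and (hAe.and hf))).prod_mk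
      ((hN.and (hA.and (hAe.and hf))).and hNB)
    filter_upwards [e1] with p hp x hx
    obtain ⟨⟨n1, a1, b1, c1⟩, ⟨n2, a2, b2, c2⟩, d2⟩ := hp
    refine n1.norm_sub_le n2 a1 a2 hh hh0 hi (fun x y hx hy => ?_)
      (add_nonneg (hε0 _) (hε0 _)) d2 (fun x hx => ?_) hx
    · calc ‖A p.1 x y - A p.2 x y‖ = ‖(A p.1 x y - A₀ x y) - (A p.2 x y - A₀ x y)‖ := by abel_nf
        _ ≤ ε p.1 * h y + ε p.2 * h y :=
          (norm_sub_le _ _).trans (add_le_add (b1 x y hx hy) (b2 x y hx hy))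
        _ = _ := by ring
    · calc ‖f p.1 x - f p.2 x‖ = ‖(f p.1 x - f₀ x) - (f p.2 x - f₀ x)‖ := by abel_nf
        _ ≤ δ p.1 + δ p.2 := (norm_sub_le _ _).trans (add_le_add (c1 x hx) (c2 x hx))
  have hsm : Tendsto (fun p : ι × ι => ((δ p.1 + δ p.2) + (ε p.1 + ε p.2) * I * B) * Real.exp I)
      (l ×ˢ l) (𝓝 0) := by
    have t1 : Tendsto (Prod.fst : ι × ι → ι) (l ×ˢ l) l := tendsto_fst
    have t2 : Tendsto (Prod.snd : ι × ι → ι) (l ×ˢ l) l := tendsto_snd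
    have d := (hδ.comp t1).add (hδ.comp t2)
    have e := ((hε.comp t1).add (hε.comp t2)).mul_const I |>.mul_const B
    simpa using (d.add e).mul_const (Real.exp I)
  have hCau : UniformCauchySeqOn N l (Set.Ici x₀) := by
    intro u hu
    obtain ⟨r, hr, hru⟩ := Metric.mem_uniformity_dist.1 hu
    filter_upwards [hpair, hsm.eventually (gt_mem_nhds hr)] with p h1 h2 x hx
    refine hru ?_
    rw [dist_eq_norm]
    exact (h1 x hx).trans_lt h2
  have hlim : ∀ x ∈ Set.Ici x₀, ∃ y, Tendsto (fun i => N i x) l (𝓝 y) := fun x hx =>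
    cauchy_map_iff_exists_tendsto.1 (hCau.cauchy_map hx)
  choose! N₀ hN₀ using hlim
  have hU : TendstoUniformlyOn N N₀ l (Set.Ici x₀) :=
    hCau.tendstoUniformlyOn_of_tendsto hN₀
  have hcont : ContinuousOn N₀ (Set.Ici x₀) :=
    hU.continuousOn (hN.mono fun i h => h.cont).frequently
  have hbd : ∀ x, x₀ ≤ x → ‖N₀ x‖ ≤ B := fun x hx =>
    le_of_tendsto (hN₀ x hx).norm (hNB.mono fun i h => h x hx)
  refine ⟨N₀, ⟨hcont, ⟨B, hbd⟩, fun x hx => ?_⟩, hU⟩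
  have hfx : Tendsto (fun i => f i x) l (𝓝 (f₀ x)) := by
    rw [tendsto_iff_norm_sub_tendsto_zero]
    exact squeeze_zero' (Eventually.of_forall fun _ => norm_nonneg _)
      (hf.mono fun i h => h x hx) hδ
  have hint : Tendsto (fun i => ∫ y in Set.Ioi x, A i x y (N i y)) l
      (𝓝 (∫ y in Set.Ioi x, A₀ x y (N₀ y))) := by
    rw [Metric.tendsto_nhds]
    intro r hr
    obtain ⟨s, hs, hsr⟩ : ∃ s > 0, (s * B + s) * I < r := by
      refine ⟨r / (2 * ((B + 1) * (I + 1))), by positivity, ?_⟩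
      have : r / (2 * ((B + 1) * (I + 1))) * B + r / (2 * ((B + 1) * (I + 1))) = r / (2 * (I + 1)) := by
        field_simp
      rw [this, div_mul_eq_mul_div, div_lt_iff₀ (by positivity)]
      nlinarith
    filter_upwards [hN, hA, hAe, hNB, hε.eventually (gt_mem_nhds hs),
      Metric.tendstoUniformlyOn_iff.1 hU s hs] with i n a b c d u
    have i1 := a.integrableOn hi n.cont c hx
    have i2 := hA₀.integrableOn hi hcont hbd hx
    rw [dist_eq_norm, ← integral_sub i1 i2]
    refine lt_of_le_of_lt ?_ hsr
    have hi' := hi.mono_set (Set.Ioi_subset_Ioi hx)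
    have : ‖∫ y in Set.Ioi x, A i x y (N i y) - A₀ x y (N₀ y)‖ ≤
        ∫ y in Set.Ioi x, (s * B + s) * h y := by
      refine norm_integral_le_of_norm_le (hi'.const_mul _) ?_
      refine (ae_restrict_iff' measurableSet_Ioi).2 (Eventually.of_forall fun y hy => ?_)
      have hy' : x ≤ y := le_of_lt hy
      have e1 : A i x y (N i y) - A₀ x y (N₀ y) =
          (A i x y - A₀ x y) (N i y) + A₀ x y (N i y - N₀ y) := by
        simp only [map_sub, _root_.sub_apply]
        abel
      rw [e1]
      have e2 : ‖(A i x y - A₀ x y) (N i y)‖ ≤ s * h y * B :=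
        ((A i x y - A₀ x y).le_opNorm _).trans (mul_le_mul ((b x y hx hy').trans
          (mul_le_mul_of_nonneg_right d.le (hh0 y))) (c y (hx.trans hy')) (norm_nonneg _)
          (mul_nonneg hs.le (hh0 y)))
      have e3 : ‖A₀ x y (N i y - N₀ y)‖ ≤ h y * s := by
        refine ((A₀ x y).le_opNorm _).trans (mul_le_mul (hA₀.le x y hx hy') ?_ (norm_nonneg _)
          (hh0 y))
        have := (u y (hx.trans hy')).le
        rwa [dist_comm, dist_eq_norm] at this
      calc _ ≤ s * h y * B + h y * s := (norm_add_le _ _).trans (add_le_add e2 e3)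
        _ = _ := by ring
    refine this.trans ?_
    rw [integral_const_mul]
    refine mul_le_mul_of_nonneg_left ?_ (by positivity)
    exact setIntegral_mono_set hi (Eventually.of_forall hh0) (Set.Ioi_subset_Ioi hx).eventuallyLE
  refine tendsto_nhds_unique (hN₀ x hx) ((hfx.sub hint).congr' ?_)
  filter_upwards [hN] with i n
  exact (n.eq x hx).symm

end Volterra

/-! ### First order expansions with polynomially growing bounds -/

section Taylor

variable {V : Type*} [NormedAddCommGroup V] [NormedSpace ℂ V]

/-- `φ r ζ` has the first order expansion `φ r ζ₀ + (ζ - ζ₀) φ' r` along `l`, with bounds that grow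
at most polynomially in `r ≥ 0`. -/
def TaylorBound (l : Filter ℂ) (ζ₀ : ℂ) (n : ℕ) (φ : ℝ → ℂ → V) (φ' : ℝ → V) : Prop :=
  ∃ C : ℝ, 0 ≤ C ∧ (∀ r, 0 ≤ r → ‖φ r ζ₀‖ ≤ C * (1 + r) ^ n) ∧
    (∀ r, 0 ≤ r → ‖φ' r‖ ≤ C * (1 + r) ^ (n + 1)) ∧
    ∀ᶠ ζ in l, ∀ r, 0 ≤ r → ‖φ r ζ‖ ≤ C * (1 + r) ^ n ∧
      ‖φ r ζ - φ r ζ₀ - (ζ - ζ₀) • φ' r‖ ≤ C * (1 + r) ^ (n + 2) * ‖ζ - ζ₀‖ ^ 2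

variable {l : Filter ℂ} {ζ₀ : ℂ} {n m : ℕ} {φ ψ : ℝ → ℂ → V} {φ' ψ' : ℝ → V}

/-- Where (1+r)|ζ-ζ₀| ≤ 1 the expansion gives the estimate; elsewhere the bounds on the two values
suffice, since then 1 < (1+r)|ζ-ζ₀|. -/
theorem TaylorBound.lipschitz (h : TaylorBound l ζ₀ n φ φ') :
    ∃ C : ℝ, 0 ≤ C ∧ ∀ᶠ ζ in l, ∀ r, 0 ≤ r →
      ‖φ r ζ - φ r ζ₀‖ ≤ C * (1 + r) ^ (n + 1) * ‖ζ - ζ₀‖ := by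
  obtain ⟨C, hC, h0, h1, h2⟩ := h
  refine ⟨2 * C, by positivity, h2.mono fun ζ hζ r hr => ?_⟩
  obtain ⟨a, b⟩ := hζ r hr
  have hr1 : 0 < 1 + r := by linarith
  rcases le_or_gt ((1 + r) * ‖ζ - ζ₀‖) 1 with hs | hs
  · calc ‖φ r ζ - φ r ζ₀‖ = ‖(φ r ζ - φ r ζ₀ - (ζ - ζ₀) • φ' r) + (ζ - ζ₀) • φ' r‖ := by abel_nf
      _ ≤ C * (1 + r) ^ (n + 2) * ‖ζ - ζ₀‖ ^ 2 + ‖ζ - ζ₀‖ * (C * (1 + r) ^ (n + 1)) := by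
        refine (norm_add_le _ _).trans (add_le_add b ?_)
        rw [norm_smul]
        exact mul_le_mul_of_nonneg_left (h1 r hr) (norm_nonneg _)
      _ = C * (1 + r) ^ (n + 1) * ‖ζ - ζ₀‖ * ((1 + r) * ‖ζ - ζ₀‖) +
          C * (1 + r) ^ (n + 1) * ‖ζ - ζ₀‖ := by ring
      _ ≤ C * (1 + r) ^ (n + 1) * ‖ζ - ζ₀‖ * 1 + C * (1 + r) ^ (n + 1) * ‖ζ - ζ₀‖ := by gcongr
      _ = _ := by ring
  · calc ‖φ r ζ - φ r ζ₀‖ ≤ C * (1 + r) ^ n + C * (1 + r) ^ n :=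
        (norm_sub_le _ _).trans (add_le_add a (h0 r hr))
      _ = 2 * C * (1 + r) ^ n * 1 := by ring
      _ ≤ 2 * C * (1 + r) ^ n * ((1 + r) * ‖ζ - ζ₀‖) := by gcongr
      _ = _ := by ring

theorem TaylorBound.mono {n' : ℕ} (h : TaylorBound l ζ₀ n φ φ') (hn : n ≤ n') :
    TaylorBound l ζ₀ n' φ φ' := by
  obtain ⟨C, hC, h0, h1, h2⟩ := h
  have key : ∀ r : ℝ, 0 ≤ r → ∀ k, (1 + r) ^ (n + k) ≤ (1 + r) ^ (n' + k) := fun r hr k =>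
    pow_le_pow_right₀ (by linarith) (by omega)
  refine ⟨C, hC, fun r hr => (h0 r hr).trans ?_, fun r hr => (h1 r hr).trans ?_,
    h2.mono fun ζ hζ r hr => ⟨(hζ r hr).1.trans ?_, (hζ r hr).2.trans ?_⟩⟩
  · have := key r hr 0
    simp only [add_zero] at this
    gcongr
  · have := key r hr 1
    gcongr
  · have := key r hr 0
    simp only [add_zero] at this
    gcongr
  · have := key r hr 2
    gcongr

theorem TaylorBound.add (h : TaylorBound l ζ₀ n φ φ') (h' : TaylorBound l ζ₀ n ψ ψ') :
    TaylorBound l ζ₀ n (fun r ζ => φ r ζ + ψ r ζ) (fun r => φ' r + ψ' r) := by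
  obtain ⟨C, hC, h0, h1, h2⟩ := h
  obtain ⟨D, hD, k0, k1, k2⟩ := h'
  refine ⟨C + D, by positivity, fun r hr => ?_, fun r hr => ?_, ?_⟩
  · rw [add_mul]
    exact (norm_add_le _ _).trans (add_le_add (h0 r hr) (k0 r hr))
  · rw [add_mul]
    exact (norm_add_le _ _).trans (add_le_add (h1 r hr) (k1 r hr))
  · filter_upwards [h2, k2] with ζ a b r hr
    constructor
    · rw [add_mul]
      exact (norm_add_le _ _).trans (add_le_add (a r hr).1 (b r hr).1)
    · rw [show φ r ζ + ψ r ζ - (φ r ζ₀ + ψ r ζ₀) - (ζ - ζ₀) • (φ' r + ψ' r) =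
        (φ r ζ - φ r ζ₀ - (ζ - ζ₀) • φ' r) + (ψ r ζ - ψ r ζ₀ - (ζ - ζ₀) • ψ' r) by
          rw [smul_add]; abel, add_mul, add_mul]
      exact (norm_add_le _ _).trans (add_le_add (a r hr).2 (b r hr).2)

/-- Growth exponents add. The remainder of a product is remainder times value, value times
remainder, and the product of the two increments, which the Lipschitz bounds control. -/
theorem TaylorBound.smul {σ : ℝ → ℂ → ℂ} {σ' : ℝ → ℂ} (h : TaylorBound l ζ₀ m σ σ')
    (h' : TaylorBound l ζ₀ n ψ ψ') :
    TaylorBound l ζ₀ (m + n) (fun r ζ => σ r ζ • ψ r ζ)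
      (fun r => σ' r • ψ r ζ₀ + σ r ζ₀ • ψ' r) := by
  obtain ⟨L, hL, hl⟩ := h.lipschitz
  obtain ⟨L', hL', hl'⟩ := h'.lipschitz
  obtain ⟨C, hC, h0, h1, h2⟩ := h
  obtain ⟨D, hD, k0, k1, k2⟩ := h'
  refine ⟨2 * C * D + L * L', by positivity, fun r hr => ?_, fun r hr => ?_, ?_⟩
  · have hr1 : 0 < 1 + r := by linarith
    rw [norm_smul]
    calc ‖σ r ζ₀‖ * ‖ψ r ζ₀‖ ≤ (C * (1 + r) ^ m) * (D * (1 + r) ^ n) :=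
        mul_le_mul (h0 r hr) (k0 r hr) (norm_nonneg _) (by positivity)
      _ = (C * D) * (1 + r) ^ (m + n) := by ring
      _ ≤ _ := by
        refine mul_le_mul_of_nonneg_right ?_ (by positivity)
        nlinarith [mul_nonneg hC hD, mul_nonneg hL hL']
  · have hr1 : 0 < 1 + r := by linarith
    refine (norm_add_le _ _).trans ?_
    rw [norm_smul, norm_smul]
    calc _ ≤ (C * (1 + r) ^ (m + 1)) * (D * (1 + r) ^ n) +
          (C * (1 + r) ^ m) * (D * (1 + r) ^ (n + 1)) :=
        add_le_add (mul_le_mul (h1 r hr) (k0 r hr) (norm_nonneg _) (by positivity))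
          (mul_le_mul (h0 r hr) (k1 r hr) (norm_nonneg _) (by positivity))
      _ = (2 * C * D) * (1 + r) ^ (m + n + 1) := by ring
      _ ≤ _ := by
        refine mul_le_mul_of_nonneg_right ?_ (by positivity)
        nlinarith [mul_nonneg hL hL']
  · filter_upwards [h2, k2, hl, hl'] with ζ a b c d r hr
    have hr1 : 0 < 1 + r := by linarith
    constructor
    · rw [norm_smul]
      calc ‖σ r ζ‖ * ‖ψ r ζ‖ ≤ (C * (1 + r) ^ m) * (D * (1 + r) ^ n) :=
          mul_le_mul (a r hr).1 (b r hr).1 (norm_nonneg _) (by positivity)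
        _ = (C * D) * (1 + r) ^ (m + n) := by ring
        _ ≤ _ := by
          refine mul_le_mul_of_nonneg_right ?_ (by positivity)
          nlinarith [mul_nonneg hC hD, mul_nonneg hL hL']
    · have e : σ r ζ • ψ r ζ - σ r ζ₀ • ψ r ζ₀ - (ζ - ζ₀) • (σ' r • ψ r ζ₀ + σ r ζ₀ • ψ' r) =
          (σ r ζ - σ r ζ₀ - (ζ - ζ₀) • σ' r) • ψ r ζ₀ +
            σ r ζ₀ • (ψ r ζ - ψ r ζ₀ - (ζ - ζ₀) • ψ' r) +
            (σ r ζ - σ r ζ₀) • (ψ r ζ - ψ r ζ₀) := by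
        simp only [smul_eq_mul]
        module
      rw [e]
      refine (norm_add_le _ _).trans ((add_le_add_left (norm_add_le _ _) _).trans ?_)
      rw [norm_smul, norm_smul, norm_smul]
      calc _ ≤ (C * (1 + r) ^ (m + 2) * ‖ζ - ζ₀‖ ^ 2) * (D * (1 + r) ^ n) +
            (C * (1 + r) ^ m) * (D * (1 + r) ^ (n + 2) * ‖ζ - ζ₀‖ ^ 2) +
            (L * (1 + r) ^ (m + 1) * ‖ζ - ζ₀‖) * (L' * (1 + r) ^ (n + 1) * ‖ζ - ζ₀‖) :=
          add_le_add (add_le_add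
            (mul_le_mul (a r hr).2 (k0 r hr) (norm_nonneg _) (by positivity))
            (mul_le_mul (h0 r hr) (b r hr).2 (norm_nonneg _) (by positivity)))
            (mul_le_mul (c r hr) (d r hr) (norm_nonneg _) (by positivity))
        _ = _ := by ring

theorem taylorBound_const (v : V) : TaylorBound l ζ₀ 0 (fun _ _ => v) (fun _ => 0) := by
  refine ⟨‖v‖, norm_nonneg _, by simp, fun r hr => ?_, Eventually.of_forall fun ζ r hr => ?_⟩
  · rw [norm_zero]; positivity
  · simp only [sub_self, smul_zero, norm_zero, pow_zero, mul_one, le_refl, true_and]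
    positivity

theorem TaylorBound.congr {φ₂ : ℝ → ℂ → V} {φ₂' : ℝ → V} (h : TaylorBound l ζ₀ n φ φ')
    (e : ∀ r ζ, φ₂ r ζ = φ r ζ) (e' : ∀ r, φ₂' r = φ' r) : TaylorBound l ζ₀ n φ₂ φ₂' := by
  obtain rfl : φ₂ = φ := funext fun r => funext fun ζ => e r ζ
  obtain rfl : φ₂' = φ' := funext e'
  exact h

theorem taylorBound_id (hl : l ≤ 𝓝 ζ₀) :
    TaylorBound l ζ₀ 0 (fun _ ζ => ζ) (fun _ => (1 : ℂ)) := by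
  refine ⟨‖ζ₀‖ + 1, by positivity, fun r hr => by simp, fun r hr => ?_, ?_⟩
  · simp only [norm_one, zero_add, pow_one]
    nlinarith [norm_nonneg ζ₀, mul_nonneg (norm_nonneg ζ₀) hr]
  · filter_upwards [hl (Metric.ball_mem_nhds ζ₀ one_pos)] with ζ hζ r hr
    rw [Metric.mem_ball, dist_eq_norm] at hζ
    constructor
    · calc ‖ζ‖ = ‖ζ₀ + (ζ - ζ₀)‖ := by ring_nf
        _ ≤ ‖ζ₀‖ + 1 := (norm_add_le _ _).trans (by linarith)
        _ = _ := by simp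
    · simp only [smul_eq_mul, mul_one, sub_self, norm_zero]
      positivity

theorem taylorBound_inv (hl : l ≤ 𝓝 ζ₀) (h0 : ζ₀ ≠ 0) :
    TaylorBound l ζ₀ 0 (fun _ ζ => ζ⁻¹) (fun _ => -(ζ₀ ^ 2)⁻¹) := by
  have hn : 0 < ‖ζ₀‖ := norm_pos_iff.2 h0
  set D := 2 / ‖ζ₀‖ with hD
  refine ⟨D + (‖ζ₀‖ ^ 2)⁻¹ + D * (‖ζ₀‖ ^ 2)⁻¹, by positivity, fun r hr => ?_, fun r hr => ?_, ?_⟩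
  · rw [norm_inv, pow_zero, mul_one]
    have : ‖ζ₀‖⁻¹ ≤ D := by rw [hD, inv_eq_one_div]; gcongr; norm_num
    have : 0 ≤ (‖ζ₀‖ ^ 2)⁻¹ := by positivity
    have : 0 ≤ D * (‖ζ₀‖ ^ 2)⁻¹ := by positivity
    linarith
  · rw [norm_neg, norm_inv, norm_pow, zero_add, pow_one]
    have h1 : 0 ≤ (‖ζ₀‖ ^ 2)⁻¹ := by positivity
    have h2 : 0 ≤ D * (‖ζ₀‖ ^ 2)⁻¹ := by positivity
    have h3 : 0 ≤ D := by positivity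
    nlinarith [mul_nonneg (add_nonneg (add_nonneg h3 h1) h2) hr]
  · filter_upwards [hl (Metric.ball_mem_nhds ζ₀ (half_pos hn))] with ζ hζ r hr
    rw [Metric.mem_ball, dist_eq_norm] at hζ
    have hr1 : 1 ≤ (1 + r) ^ 2 := by nlinarith
    have hz : ‖ζ₀‖ / 2 ≤ ‖ζ‖ := by
      have := norm_sub_norm_le ζ₀ ζ
      rw [norm_sub_rev] at this
      linarith
    have hzp : 0 < ‖ζ‖ := by linarith
    have hinv : ‖ζ‖⁻¹ ≤ D := by
      rw [hD, show 2 / ‖ζ₀‖ = (‖ζ₀‖ / 2)⁻¹ by rw [inv_div]]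
      exact inv_anti₀ (by positivity) hz
    have h1 : 0 ≤ (‖ζ₀‖ ^ 2)⁻¹ := by positivity
    have h2 : 0 ≤ D * (‖ζ₀‖ ^ 2)⁻¹ := by positivity
    have h3 : 0 ≤ D := by positivity
    constructor
    · rw [norm_inv, pow_zero, mul_one]
      linarith
    · have hne : ζ ≠ 0 := norm_pos_iff.1 hzp
      have : ζ⁻¹ - ζ₀⁻¹ - (ζ - ζ₀) • -(ζ₀ ^ 2)⁻¹ = (ζ - ζ₀) ^ 2 * (ζ⁻¹ * (ζ₀ ^ 2)⁻¹) := by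
        rw [smul_eq_mul]
        field_simp
        ring
      rw [this, norm_mul, norm_mul, norm_pow, norm_inv, norm_inv, norm_pow, mul_comm]
      refine mul_le_mul_of_nonneg_right ?_ (by positivity)
      calc ‖ζ‖⁻¹ * (‖ζ₀‖ ^ 2)⁻¹ ≤ (D + (‖ζ₀‖ ^ 2)⁻¹ + D * (‖ζ₀‖ ^ 2)⁻¹) * 1 := by
            have := mul_le_mul_of_nonneg_right hinv h1
            linarith
        _ ≤ _ := by rw [zero_add]; gcongr

/-- Composition of a uniform expansion on the upper half plane with an expansion of `λ`. -/
theorem TaylorBound.comp {ψ : ℝ → ℂ → V} {ψ' : ℝ → V} {Λ : ℂ → ℂ} {Λ' : ℂ} {C : ℝ} (hC : 0 ≤ C)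
    (hΛ : TaylorBound l ζ₀ 0 (fun _ ζ => Λ ζ) (fun _ => Λ')) (him₀ : 0 ≤ (Λ ζ₀).im)
    (him : ∀ᶠ ζ in l, 0 ≤ (Λ ζ).im)
    (h0 : ∀ w : ℂ, 0 ≤ w.im → ∀ r, 0 ≤ r → ‖ψ r w‖ ≤ C * (1 + r) ^ n)
    (h1 : ∀ r, 0 ≤ r → ‖ψ' r‖ ≤ C * (1 + r) ^ (n + 1))
    (h2 : ∀ w : ℂ, 0 ≤ w.im → ∀ r, 0 ≤ r →
      ‖ψ r w - ψ r (Λ ζ₀) - (w - Λ ζ₀) • ψ' r‖ ≤ C * (1 + r) ^ (n + 2) * ‖w - Λ ζ₀‖ ^ 2) :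
    TaylorBound l ζ₀ n (fun r ζ => ψ r (Λ ζ)) (fun r => Λ' • ψ' r) := by
  obtain ⟨L, hL, hl⟩ := hΛ.lipschitz
  obtain ⟨D, hD, -, k1, k2⟩ := hΛ
  have hD' : ‖Λ'‖ ≤ D := by simpa using k1 0 le_rfl
  refine ⟨C + D * C + C * L ^ 2, by positivity, fun r hr => ?_, fun r hr => ?_, ?_⟩
  · refine (h0 _ him₀ r hr).trans ?_
    gcongr
    nlinarith [mul_nonneg hD hC, mul_nonneg hC (sq_nonneg L)]
  · rw [norm_smul]
    calc _ ≤ D * (C * (1 + r) ^ (n + 1)) :=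
          mul_le_mul hD' (h1 r hr) (norm_nonneg _) hD
      _ = (D * C) * (1 + r) ^ (n + 1) := by ring
      _ ≤ _ := by
        gcongr
        nlinarith [mul_nonneg hC (sq_nonneg L)]
  · filter_upwards [him, hl, k2] with ζ a b c r hr
    have hr1 : 1 ≤ 1 + r := by linarith
    constructor
    · refine (h0 _ a r hr).trans ?_
      gcongr
      nlinarith [mul_nonneg hD hC, mul_nonneg hC (sq_nonneg L)]
    · have b0 : ‖Λ ζ - Λ ζ₀‖ ≤ L * ‖ζ - ζ₀‖ := by simpa using b 0 le_rfl
      have c0 : ‖Λ ζ - Λ ζ₀ - (ζ - ζ₀) • Λ'‖ ≤ D * ‖ζ - ζ₀‖ ^ 2 := by simpa using (c 0 le_rfl).2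
      have e : ψ r (Λ ζ) - ψ r (Λ ζ₀) - (ζ - ζ₀) • Λ' • ψ' r =
          (ψ r (Λ ζ) - ψ r (Λ ζ₀) - (Λ ζ - Λ ζ₀) • ψ' r) +
            (Λ ζ - Λ ζ₀ - (ζ - ζ₀) • Λ') • ψ' r := by
        simp only [sub_smul, smul_assoc]
        abel
      rw [e]
      refine (norm_add_le _ _).trans ?_
      rw [norm_smul]
      calc _ ≤ C * (1 + r) ^ (n + 2) * (L * ‖ζ - ζ₀‖) ^ 2 +
            (D * ‖ζ - ζ₀‖ ^ 2) * (C * (1 + r) ^ (n + 1)) := by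
            refine add_le_add ((h2 _ a r hr).trans ?_)
              (mul_le_mul c0 (h1 r hr) (norm_nonneg _) (by positivity))
            gcongr
        _ ≤ C * (1 + r) ^ (n + 2) * (L * ‖ζ - ζ₀‖) ^ 2 +
            (D * ‖ζ - ζ₀‖ ^ 2) * (C * (1 + r) ^ (n + 2)) := by
            gcongr
            norm_num
        _ = (D * C + C * L ^ 2) * (1 + r) ^ (n + 2) * ‖ζ - ζ₀‖ ^ 2 := by ring
        _ ≤ _ := by
            gcongr
            linarith

end Taylor

/-! ### Exponentials on the upper half plane -/

theorem norm_exp_I_mul_le {w : ℂ} (hw : 0 ≤ w.im) : ‖Complex.exp (Complex.I * w)‖ ≤ 1 := by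
  rw [Complex.norm_exp, Real.exp_le_one_iff]
  simpa using hw

theorem norm_exp_I_mul_sub_le {w w₀ : ℂ} (hw : 0 ≤ w.im) (hw₀ : 0 ≤ w₀.im) :
    ‖Complex.exp (Complex.I * w) - Complex.exp (Complex.I * w₀)‖ ≤ ‖w - w₀‖ := by
  have hconv : Convex ℝ {w : ℂ | 0 ≤ w.im} := convex_halfSpace_im_ge 0
  have := hconv.norm_image_sub_le_of_norm_hasDerivWithin_le (C := 1)
    (f := fun w => Complex.exp (Complex.I * w))
    (f' := fun w => Complex.exp (Complex.I * w) * Complex.I)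
    (fun z _ => by
      have h := ((hasDerivAt_id z).const_mul Complex.I).cexp
      simpa using h.hasDerivWithinAt)
    (fun z hz => by
      rw [norm_mul, Complex.norm_I, mul_one]
      exact norm_exp_I_mul_le hz) hw₀ hw
  simpa using this

/-- Mean value inequality for the function minus its linear part, on the half plane intersected with
the ball of radius |w-w₀|, where the derivative is bounded by the preceding Lipschitz estimate. -/
theorem norm_exp_I_mul_sub_sub_le {w w₀ : ℂ} (hw : 0 ≤ w.im) (hw₀ : 0 ≤ w₀.im) :
    ‖Complex.exp (Complex.I * w) - Complex.exp (Complex.I * w₀) -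
      (w - w₀) * (Complex.I * Complex.exp (Complex.I * w₀))‖ ≤ ‖w - w₀‖ ^ 2 := by
  have hconv : Convex ℝ ({w : ℂ | 0 ≤ w.im} ∩ Metric.closedBall w₀ ‖w - w₀‖) :=
    (convex_halfSpace_im_ge 0).inter (convex_closedBall _ _)
  have := hconv.norm_image_sub_le_of_norm_hasDerivWithin_le (C := ‖w - w₀‖)
    (f := fun w => Complex.exp (Complex.I * w) - w * (Complex.I * Complex.exp (Complex.I * w₀)))
    (f' := fun w => Complex.exp (Complex.I * w) * Complex.I
      - Complex.I * Complex.exp (Complex.I * w₀))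
    (x := w₀) (y := w)
    (fun z _ => by
      have h := (((hasDerivAt_id z).const_mul Complex.I).cexp).fun_sub
        ((hasDerivAt_id z).mul_const (Complex.I * Complex.exp (Complex.I * w₀)))
      simpa using h.hasDerivWithinAt)
    (fun z hz => by
      rw [mul_comm, ← mul_sub, norm_mul, Complex.norm_I, one_mul]
      refine (norm_exp_I_mul_sub_le hz.1 hw₀).trans ?_
      simpa [dist_eq_norm] using hz.2)
    ⟨hw₀, by simp⟩ ⟨hw, by simp [dist_eq_norm]⟩
  rw [sq]
  refine le_of_eq_of_le ?_ this
  congr 1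
  ring

/-- `∫_0^r e^{2iλρ} dρ`. -/
def expInt (r : ℝ) (Λ : ℂ) : ℂ := ∫ ρ in (0 : ℝ)..r, Complex.exp (Complex.I * (2 * Λ * ρ))

/-- The derivative of `expInt r` at `Λ`. -/
def expIntDeriv (r : ℝ) (Λ : ℂ) : ℂ :=
  ∫ ρ in (0 : ℝ)..r, 2 * ρ * (Complex.I * Complex.exp (Complex.I * (2 * Λ * ρ)))

theorem im_two_mul_mul_nonneg {w : ℂ} (hw : 0 ≤ w.im) {r : ℝ} (hr : 0 ≤ r) :
    0 ≤ (2 * w * r).im := by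
  have : (2 * w * r).im = 2 * w.im * r := by simp
  rw [this]
  positivity

theorem norm_two_mul_sub (w w₀ : ℂ) {r : ℝ} (hr : 0 ≤ r) :
    ‖2 * w * r - 2 * w₀ * r‖ = 2 * r * ‖w - w₀‖ := by
  rw [show 2 * w * r - 2 * w₀ * r = ((2 * r : ℝ) : ℂ) * (w - w₀) by push_cast; ring, norm_mul,
    Complex.norm_real, Real.norm_of_nonneg (by positivity)]

theorem norm_expInt_le {w : ℂ} (hw : 0 ≤ w.im) {r : ℝ} (hr : 0 ≤ r) : ‖expInt r w‖ ≤ r := by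
  have := intervalIntegral.norm_integral_le_of_norm_le_const (a := 0) (b := r) (C := 1)
    (f := fun ρ : ℝ => Complex.exp (Complex.I * (2 * w * ρ))) (fun ρ hρ => by
      rw [Set.uIoc_of_le hr] at hρ
      exact norm_exp_I_mul_le (im_two_mul_mul_nonneg hw hρ.1.le))
  simpa [expInt, abs_of_nonneg hr] using this

theorem norm_expIntDeriv_le {w : ℂ} (hw : 0 ≤ w.im) {r : ℝ} (hr : 0 ≤ r) :
    ‖expIntDeriv r w‖ ≤ 2 * r * r := by
  have := intervalIntegral.norm_integral_le_of_norm_le_const (a := 0) (b := r) (C := 2 * r)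
    (f := fun ρ : ℝ => 2 * (ρ : ℂ) * (Complex.I * Complex.exp (Complex.I * (2 * w * ρ))))
    (fun ρ hρ => by
      rw [Set.uIoc_of_le hr] at hρ
      rw [norm_mul, norm_mul, norm_mul, Complex.norm_I, one_mul, Complex.norm_real,
        Real.norm_of_nonneg hρ.1.le]
      have h1 := norm_exp_I_mul_le (im_two_mul_mul_nonneg hw hρ.1.le)
      have h2 : ‖(2 : ℂ)‖ = 2 := by norm_num
      rw [h2]
      calc 2 * ρ * _ ≤ 2 * ρ * 1 := mul_le_mul_of_nonneg_left h1 (by linarith [hρ.1])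
        _ ≤ 2 * r := by linarith [hρ.2])
  simpa [expIntDeriv, abs_of_nonneg hr] using this

theorem norm_expInt_sub_sub_le {w w₀ : ℂ} (hw : 0 ≤ w.im) (hw₀ : 0 ≤ w₀.im) {r : ℝ} (hr : 0 ≤ r) :
    ‖expInt r w - expInt r w₀ - (w - w₀) * expIntDeriv r w₀‖ ≤ (2 * r * ‖w - w₀‖) ^ 2 * r := by
  have i1 : ∀ w : ℂ, IntervalIntegrable
      (fun ρ : ℝ => Complex.exp (Complex.I * (2 * w * ρ))) volume 0 r := fun w =>
    Continuous.intervalIntegrable (by fun_prop) _ _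
  have i2 : IntervalIntegrable (fun ρ : ℝ => (w - w₀) *
      (2 * ρ * (Complex.I * Complex.exp (Complex.I * (2 * w₀ * ρ))))) volume 0 r :=
    Continuous.intervalIntegrable (by fun_prop) _ _
  rw [expInt, expInt, expIntDeriv, ← intervalIntegral.integral_const_mul,
    ← intervalIntegral.integral_sub (i1 w) (i1 w₀),
    ← intervalIntegral.integral_sub ((i1 w).sub (i1 w₀)) i2]
  have := intervalIntegral.norm_integral_le_of_norm_le_const (a := 0) (b := r)
    (C := (2 * r * ‖w - w₀‖) ^ 2)
    (f := fun ρ : ℝ => Complex.exp (Complex.I * (2 * w * ρ)) -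
      Complex.exp (Complex.I * (2 * w₀ * ρ)) - (w - w₀) *
      (2 * ρ * (Complex.I * Complex.exp (Complex.I * (2 * w₀ * ρ)))))
    (fun ρ hρ => by
      rw [Set.uIoc_of_le hr] at hρ
      have h := norm_exp_I_mul_sub_sub_le (im_two_mul_mul_nonneg hw hρ.1.le)
        (im_two_mul_mul_nonneg hw₀ hρ.1.le)
      rw [norm_two_mul_sub w w₀ hρ.1.le] at h
      rw [show (w - w₀) * (2 * ρ * (Complex.I * Complex.exp (Complex.I * (2 * w₀ * ρ)))) =
        (2 * w * ρ - 2 * w₀ * ρ) * (Complex.I * Complex.exp (Complex.I * (2 * w₀ * ρ))) by ring]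
      refine h.trans ?_
      have := hρ.1.le
      have := hρ.2
      gcongr)
  simpa [abs_of_nonneg hr] using this

/-- `expInt` is (e^{2iΛr} - 1)/(2iΛ) with the singularity at Λ = 0 removed. The integral form keeps
all estimates valid at the branch points, where λ vanishes. -/
theorem two_I_mul_expInt (r : ℝ) (Λ : ℂ) :
    2 * Complex.I * Λ * expInt r Λ = Complex.exp (Complex.I * (2 * Λ * r)) - 1 := by
  have h : ∀ ρ ∈ Set.uIcc 0 r, HasDerivAt
      (fun ρ : ℝ => Complex.exp (Complex.I * (2 * Λ * ρ)))
      (2 * Complex.I * Λ * Complex.exp (Complex.I * (2 * Λ * ρ))) ρ := by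
    intro ρ _
    have := (((Complex.ofRealCLM.hasDerivAt (x := ρ)).const_mul (2 * Λ)).const_mul Complex.I).cexp
    refine this.congr_deriv ?_
    simp only [Complex.ofRealCLM_apply, Complex.ofReal_one, mul_one]
    ring
  have := intervalIntegral.integral_eq_sub_of_hasDerivAt h
    (Continuous.intervalIntegrable (by fun_prop) _ _)
  rw [expInt, ← intervalIntegral.integral_const_mul, this]
  simp

theorem hasDerivAt_expInt (r : ℝ) (Λ : ℂ) :
    HasDerivAt (fun r => expInt r Λ) (Complex.exp (Complex.I * (2 * Λ * r))) r := by
  have hc : Continuous fun ρ : ℝ => Complex.exp (Complex.I * (2 * Λ * ρ)) := by fun_prop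
  exact intervalIntegral.integral_hasDerivAt_right (hc.intervalIntegrable _ _)
    (hc.stronglyMeasurableAtFilter _ _) hc.continuousAt

theorem continuous_expIntDeriv (Λ : ℂ) : Continuous fun r => expIntDeriv r Λ := by
  have hc : Continuous fun ρ : ℝ =>
    2 * (ρ : ℂ) * (Complex.I * Complex.exp (Complex.I * (2 * Λ * ρ))) := by fun_prop
  exact intervalIntegral.continuous_primitive (fun _ _ => hc.intervalIntegrable _ _) 0

section

variable {l : Filter ℂ} {ζ₀ : ℂ} {Λ : ℂ → ℂ} {Λ' : ℂ}

theorem taylorBound_exp (hΛ : TaylorBound l ζ₀ 0 (fun _ ζ => Λ ζ) (fun _ => Λ'))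
    (him₀ : 0 ≤ (Λ ζ₀).im) (him : ∀ᶠ ζ in l, 0 ≤ (Λ ζ).im) :
    TaylorBound l ζ₀ 0 (fun r ζ => Complex.exp (Complex.I * (2 * Λ ζ * r)))
      (fun r => Λ' • (2 * r * (Complex.I * Complex.exp (Complex.I * (2 * Λ ζ₀ * r))))) := by
  refine TaylorBound.comp (C := 4) (n := 0)
    (ψ := fun r w => Complex.exp (Complex.I * (2 * w * r))) (by norm_num) hΛ him₀ him
    (fun w hw r hr => ?_) (fun r hr => ?_) (fun w hw r hr => ?_)
  · have := norm_exp_I_mul_le (im_two_mul_mul_nonneg hw hr)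
    rw [pow_zero]
    linarith
  · have h1 := norm_exp_I_mul_le (im_two_mul_mul_nonneg him₀ hr)
    rw [norm_mul, norm_mul, norm_mul, Complex.norm_I, one_mul, Complex.norm_real,
      Real.norm_of_nonneg hr, show ‖(2 : ℂ)‖ = 2 by norm_num, zero_add, pow_one]
    nlinarith [mul_le_mul_of_nonneg_left h1 hr]
  · have h := norm_exp_I_mul_sub_sub_le (im_two_mul_mul_nonneg hw hr)
        (im_two_mul_mul_nonneg him₀ hr)
    rw [norm_two_mul_sub w _ hr] at h
    rw [smul_eq_mul, show (w - Λ ζ₀) * (2 * r * (Complex.I * Complex.exp (Complex.I *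
      (2 * Λ ζ₀ * r)))) = (2 * w * r - 2 * Λ ζ₀ * r) *
        (Complex.I * Complex.exp (Complex.I * (2 * Λ ζ₀ * r))) by ring]
    refine h.trans ?_
    rw [mul_pow, mul_pow, zero_add]
    gcongr
    · norm_num
    · linarith

theorem taylorBound_expInt (hΛ : TaylorBound l ζ₀ 0 (fun _ ζ => Λ ζ) (fun _ => Λ'))
    (him₀ : 0 ≤ (Λ ζ₀).im) (him : ∀ᶠ ζ in l, 0 ≤ (Λ ζ).im) :
    TaylorBound l ζ₀ 1 (fun r ζ => expInt r (Λ ζ)) (fun r => Λ' • expIntDeriv r (Λ ζ₀)) := by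
  refine TaylorBound.comp (C := 4) (n := 1) (ψ := fun r w => expInt r w) (by norm_num) hΛ him₀ him
    (fun w hw r hr => ?_) (fun r hr => ?_) (fun w hw r hr => ?_)
  · have := norm_expInt_le hw hr
    linarith
  · have := norm_expIntDeriv_le him₀ hr
    refine this.trans ?_
    rw [show (4 : ℝ) * (1 + r) ^ (1 + 1) = 2 * r * r + (2 * r * r + 8 * r + 4) by ring]
    have : 0 ≤ 2 * r * r := by positivity
    linarith
  · refine (norm_expInt_sub_sub_le hw him₀ hr).trans ?_
    rw [show (2 * r * ‖w - Λ ζ₀‖) ^ 2 * r = 4 * r ^ (1 + 2) * ‖w - Λ ζ₀‖ ^ 2 by ring]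
    gcongr
    linarith

end

/-! ### Differentiability of solutions of Volterra equations in the parameter -/

/-- The two entries are two bounds for the Taylor remainder of the kernel divided by ε. The second
tends to zero but has one power of 1+|y| more than the weight controls; the first is integrable and
serves as dominating function. -/
theorem tendsto_integral_min_zero {w : ℝ → ℝ} {x₀ : ℝ} (hw : Continuous w) (hw0 : ∀ y, 0 ≤ w y)
    (hi : IntegrableOn (fun y => (1 + |y|) ^ 2 * w y) (Set.Ioi x₀)) (M : ℝ) (hM : 0 ≤ M) :
    Tendsto (fun ε : ℝ => ∫ y in Set.Ioi x₀,
      min (M * (1 + |y|) ^ 2) (M * (1 + |y|) ^ 3 * |ε|) * w y) (𝓝 0) (𝓝 0) := by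
  have h := tendsto_integral_filter_of_dominated_convergence (μ := volume.restrict (Set.Ioi x₀))
    (l := 𝓝 (0 : ℝ)) (F := fun ε y => min (M * (1 + |y|) ^ 2) (M * (1 + |y|) ^ 3 * |ε|) * w y)
    (f := fun _ => (0 : ℝ)) (fun y => M * ((1 + |y|) ^ 2 * w y)) ?_ ?_ ?_ ?_
  · simpa using h
  · refine Eventually.of_forall fun ε => Continuous.aestronglyMeasurable ?_
    fun_prop
  · refine Eventually.of_forall fun ε => Eventually.of_forall fun y => ?_
    have h1 : 0 ≤ min (M * (1 + |y|) ^ 2) (M * (1 + |y|) ^ 3 * |ε|) := by positivity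
    rw [Real.norm_of_nonneg (mul_nonneg h1 (hw0 y)), ← mul_assoc]
    exact mul_le_mul_of_nonneg_right (min_le_left _ _) (hw0 y)
  · exact hi.const_mul M
  · refine Eventually.of_forall fun y => ?_
    have : Continuous fun ε : ℝ => min (M * (1 + |y|) ^ 2) (M * (1 + |y|) ^ 3 * |ε|) * w y := by
      fun_prop
    have h0 : 0 ≤ M * (1 + |y|) ^ 2 := by positivity
    simpa [min_eq_right h0] using this.tendsto 0

theorem one_add_sub_le {x₀ x y : ℝ} (hx : x₀ ≤ x) : 1 + (y - x) ≤ (1 + |x₀|) * (1 + |y|) := by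
  have h1 := le_abs_self y
  have h2 := neg_abs_le x₀
  nlinarith [mul_nonneg (abs_nonneg x₀) (abs_nonneg y)]

theorem pow_one_add_sub_le {x₀ x y : ℝ} (hx : x₀ ≤ x) (hy : x ≤ y) {n m : ℕ} (hn : n ≤ m) :
    (1 + (y - x)) ^ n ≤ (1 + |x₀|) ^ m * (1 + |y|) ^ m := by
  rw [← mul_pow]
  calc (1 + (y - x)) ^ n ≤ (1 + (y - x)) ^ m := pow_le_pow_right₀ (by linarith) hn
    _ ≤ _ := pow_le_pow_left₀ (by linarith) (one_add_sub_le hx) m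

variable {E : Type*} [NormedAddCommGroup E] [NormedSpace ℂ E] [CompleteSpace E]

/-- A family of bounded solutions of Volterra equations whose kernels and inhomogeneities have first
order expansions at `ζ₀` has itself a first order expansion there. -/
theorem exists_volterra_slope {S : Set ℂ} {ζ₀ : ℂ} {x₀ : ℝ} {K : ℝ → ℂ → E →L[ℂ] E}
    {K' : ℝ → E →L[ℂ] E} {Δ : ℝ → E →L[ℂ] E} {e : ℂ → E} {e' : E} {N : ℂ → ℝ → E}
    [hne : (𝓝[S \ {ζ₀}] ζ₀).NeBot] (hK : TaylorBound (𝓝[S \ {ζ₀}] ζ₀) ζ₀ 1 K K')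
    (hKc : ∀ ζ, Continuous fun r => K r ζ) (hK'c : Continuous K') (hΔ : Continuous Δ)
    (hw : IntegrableOn (fun y => (1 + |y|) ^ 2 * ‖Δ y‖) (Set.Ioi x₀))
    (he : HasDerivWithinAt e e' S ζ₀)
    (hN : ∀ ζ ∈ S, IsVolterra x₀ (fun x y => K (y - x) ζ * Δ y) (fun _ => e ζ) (N ζ)) :
    ∃ N₀ N₁ : E, Tendsto (fun ζ => N ζ x₀) (𝓝[S \ {ζ₀}] ζ₀) (𝓝 N₀) ∧
      Tendsto (fun ζ => (ζ - ζ₀)⁻¹ • (N ζ x₀ - N₀)) (𝓝[S \ {ζ₀}] ζ₀) (𝓝 N₁) ∧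
      (ζ₀ ∈ S → N ζ₀ x₀ = N₀) := by
  set l := 𝓝[S \ {ζ₀}] ζ₀ with hl
  obtain ⟨L, hL, hLip⟩ := hK.lipschitz
  obtain ⟨C, hC, k0, k1, k2⟩ := hK
  set D := (1 + |x₀|) ^ 3 with hD
  have hD2 : (1 + |x₀|) ^ 2 ≤ D :=
    pow_le_pow_right₀ (by linarith [abs_nonneg x₀]) (by norm_num)
  -- 2C + L dominates the constants of the kernel (C), of its difference quotient (L), and of the
  -- difference quotient minus K' (C + L). D absorbs the passage from 1 + (y-x) to (1+|x₀|)(1+|y|).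
  set M := (2 * C + L) * D with hM
  have hM0 : 0 ≤ M := by positivity
  set h : ℝ → ℝ := fun y => M * ((1 + |y|) ^ 2 * ‖Δ y‖) with hh
  have hhc : Continuous h := by fun_prop
  have hh0 : ∀ y, 0 ≤ h y := fun y => by positivity
  have hhi : IntegrableOn h (Set.Ioi x₀) := hw.const_mul M
  have hmem : ∀ᶠ ζ in l, ζ ∈ S := by
    filter_upwards [self_mem_nhdsWithin] with ζ hζ using hζ.1
  have hne0 : ∀ᶠ ζ in l, ζ - ζ₀ ≠ 0 := by
    filter_upwards [self_mem_nhdsWithin] with ζ hζ using sub_ne_zero.2 hζ.2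
  have hbound : ∀ {T : E →L[ℂ] E} {c x y : ℝ} {n : ℕ}, x₀ ≤ x → x ≤ y → n ≤ 2 → 0 ≤ c →
      c ≤ 2 * C + L → ‖T‖ ≤ c * (1 + (y - x)) ^ n → ‖T * Δ y‖ ≤ h y := by
    intro T c x y n hx hy hn hc hcM hT
    refine (norm_mul_le _ _).trans ?_
    simp only [hh, ← mul_assoc M]
    refine mul_le_mul_of_nonneg_right (hT.trans ?_) (norm_nonneg _)
    calc c * (1 + (y - x)) ^ n ≤ (2 * C + L) * ((1 + |x₀|) ^ 2 * (1 + |y|) ^ 2) :=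
          mul_le_mul hcM (pow_one_add_sub_le hx hy hn) (pow_nonneg (by linarith) _) (by positivity)
      _ ≤ (2 * C + L) * (D * (1 + |y|) ^ 2) := by gcongr
      _ = _ := by rw [hM]; ring
  have hAc : ∀ ζ x, Continuous fun y => K (y - x) ζ * Δ y := fun ζ x =>
    ((hKc ζ).comp (continuous_id.sub continuous_const)).mul hΔ
  have hA : ∀ᶠ ζ in l, IsKernelBound x₀ (fun x y => K (y - x) ζ * Δ y) h := by
    filter_upwards [k2] with ζ hζ
    exact ⟨hAc ζ, fun x y hx hy => hbound hx hy (n := 1) (by norm_num) hC (by linarith)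
      (hζ (y - x) (by linarith)).1⟩
  have hA₀ : IsKernelBound x₀ (fun x y => K (y - x) ζ₀ * Δ y) h :=
    ⟨hAc ζ₀, fun x y hx hy => hbound hx hy (n := 1) (by norm_num) hC (by linarith)
      (k0 (y - x) (by linarith))⟩
  have hA' : IsKernelBound x₀ (fun x y => K' (y - x) * Δ y) h :=
    ⟨fun x => (hK'c.comp (continuous_id.sub continuous_const)).mul hΔ,
      fun x y hx hy => hbound hx hy (n := 2) le_rfl hC (by linarith)
      (k1 (y - x) (by linarith))⟩
  have hAe : ∀ᶠ ζ in l, ∀ x y, x₀ ≤ x → x ≤ y →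
      ‖K (y - x) ζ * Δ y - K (y - x) ζ₀ * Δ y‖ ≤ ‖ζ - ζ₀‖ * h y := by
    filter_upwards [hLip, hne0] with ζ hζ hn x y hx hy
    have hn' : 0 < ‖ζ - ζ₀‖ := norm_pos_iff.2 hn
    have h1 : ‖(ζ - ζ₀)⁻¹ • (K (y - x) ζ - K (y - x) ζ₀)‖ ≤ L * (1 + (y - x)) ^ 2 := by
      rw [norm_smul, norm_inv, inv_mul_le_iff₀ hn', mul_comm]
      exact hζ (y - x) (by linarith)
    have h2 := hbound hx hy (n := 2) le_rfl hL (by linarith) h1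
    rw [smul_mul_assoc, sub_mul, norm_smul, norm_inv, inv_mul_le_iff₀ hn'] at h2
    exact h2
  have hε : Tendsto (fun ζ => ‖ζ - ζ₀‖) l (𝓝 0) := by
    have : Tendsto (fun ζ => ‖ζ - ζ₀‖) (𝓝 ζ₀) (𝓝 ‖ζ₀ - ζ₀‖) :=
      (continuous_id.sub continuous_const).norm.tendsto ζ₀
    rw [sub_self, norm_zero] at this
    exact this.mono_left nhdsWithin_le_nhds
  have het : Tendsto (fun ζ => e ζ) l (𝓝 (e ζ₀)) :=
    (he.continuousWithinAt.mono Set.sdiff_subset).tendsto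
  have hδ : Tendsto (fun ζ => ‖e ζ - e ζ₀‖) l (𝓝 0) := tendsto_iff_norm_sub_tendsto_zero.1 het
  have hNe : ∀ᶠ ζ in l, IsVolterra x₀ (fun x y => K (y - x) ζ * Δ y) (fun _ => e ζ) (N ζ) :=
    hmem.mono fun ζ hζ => hN ζ hζ
  -- The point ζ₀ need not lie in S: N₀ is produced as a limit of solutions, which makes the branch
  -- points accessible.
  obtain ⟨N₀, hN₀, hU⟩ := exists_volterra_limit (f₀ := fun _ => e ζ₀) (G := ‖e ζ₀‖)
    hNe hA hA₀ hhc hh0 hhi hAe (fun _ => norm_nonneg _) hε (fun _ _ => le_rfl)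
    (Eventually.of_forall fun ζ x _ => le_rfl) hδ
  obtain ⟨B, hB⟩ := hN₀.bdd
  have hB0 : 0 ≤ B := (norm_nonneg _).trans (hB x₀ le_rfl)
  -- the difference quotients solve a Volterra equation
  have hslope : ∀ᶠ ζ in l, IsVolterra x₀ (fun x y => K (y - x) ζ * Δ y)
      (fun x => (ζ - ζ₀)⁻¹ • (e ζ - e ζ₀) - ∫ y in Set.Ioi x,
        ((ζ - ζ₀)⁻¹ • (K (y - x) ζ * Δ y - K (y - x) ζ₀ * Δ y)) (N₀ y))
      (fun x => (ζ - ζ₀)⁻¹ • (N ζ x - N₀ x)) := by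
    filter_upwards [hNe, hA] with ζ n a
    obtain ⟨B₁, hB₁⟩ := n.bdd
    refine ⟨(n.cont.sub hN₀.cont).const_smul _, ⟨‖(ζ - ζ₀)⁻¹‖ * (B₁ + B), fun x hx => ?_⟩,
      fun x hx => ?_⟩
    · rw [norm_smul]
      exact mul_le_mul_of_nonneg_left
        ((norm_sub_le _ _).trans (add_le_add (hB₁ x hx) (hB x hx))) (norm_nonneg _)
    · have i1 := a.integrableOn hhi n.cont hB₁ hx
      have i2 := a.integrableOn hhi hN₀.cont hB hx
      have i3 := hA₀.integrableOn hhi hN₀.cont hB hx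
      simp only [map_smul, map_sub, _root_.sub_apply, _root_.smul_apply]
      rw [integral_smul, integral_smul, integral_sub i1 i2, integral_sub i2 i3,
        n.eq x hx, hN₀.eq x hx, ← smul_sub, ← smul_sub]
      congr 1
      abel
  -- J bounds the error made when the difference quotient of the kernel is replaced by K'.
  set J : ℝ → ℝ := fun ε => ∫ y in Set.Ioi x₀,
      min (M * (1 + |y|) ^ 2) (M * (1 + |y|) ^ 3 * |ε|) * ‖Δ y‖ with hJ
  have hJt : Tendsto (fun ζ => J ‖ζ - ζ₀‖) l (𝓝 0) :=
    (tendsto_integral_min_zero hΔ.norm (fun _ => norm_nonneg _) hw M hM0).comp hε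
  have hsl : Tendsto (fun ζ => (ζ - ζ₀)⁻¹ • (e ζ - e ζ₀)) l (𝓝 e') := by
    have := hasDerivWithinAt_iff_tendsto_slope.1 he
    exact this
  have hδ' : Tendsto (fun ζ => ‖(ζ - ζ₀)⁻¹ • (e ζ - e ζ₀) - e'‖ + J ‖ζ - ζ₀‖ * B) l (𝓝 0) := by
    simpa using (tendsto_iff_norm_sub_tendsto_zero.1 hsl).add (hJt.mul_const B)
  have hf : ∀ᶠ ζ in l, ∀ x, x₀ ≤ x →
      ‖((ζ - ζ₀)⁻¹ • (e ζ - e ζ₀) - ∫ y in Set.Ioi x,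
        ((ζ - ζ₀)⁻¹ • (K (y - x) ζ * Δ y - K (y - x) ζ₀ * Δ y)) (N₀ y)) -
        (e' - ∫ y in Set.Ioi x, (K' (y - x) * Δ y) (N₀ y))‖ ≤
      ‖(ζ - ζ₀)⁻¹ • (e ζ - e ζ₀) - e'‖ + J ‖ζ - ζ₀‖ * B := by
    filter_upwards [hA, hne0, k2, hLip] with ζ a hn hζ hζL x hx
    have hn' : 0 < ‖ζ - ζ₀‖ := norm_pos_iff.2 hn
    have i2 := a.integrableOn hhi hN₀.cont hB hx
    have i3 := hA₀.integrableOn hhi hN₀.cont hB hx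
    have i4 := hA'.integrableOn hhi hN₀.cont hB hx
    have i5 : IntegrableOn (fun y =>
        ((ζ - ζ₀)⁻¹ • (K (y - x) ζ * Δ y - K (y - x) ζ₀ * Δ y)) (N₀ y)) (Set.Ioi x) := by
      simp only [_root_.sub_apply, _root_.smul_apply]
      exact (i2.sub i3).smul _
    rw [sub_sub_sub_comm, ← integral_sub i5 i4]
    refine (norm_sub_le _ _).trans (add_le_add le_rfl ?_)
    have hmc : Continuous fun y =>
        min (M * (1 + |y|) ^ 2) (M * (1 + |y|) ^ 3 * |‖ζ - ζ₀‖|) * ‖Δ y‖ := by fun_prop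
    have hm0 : ∀ y, 0 ≤ min (M * (1 + |y|) ^ 2) (M * (1 + |y|) ^ 3 * |‖ζ - ζ₀‖|) * ‖Δ y‖ :=
      fun y => by positivity
    have hmi : IntegrableOn (fun y =>
        min (M * (1 + |y|) ^ 2) (M * (1 + |y|) ^ 3 * |‖ζ - ζ₀‖|) * ‖Δ y‖) (Set.Ioi x₀) := by
      refine Integrable.mono' hhi hmc.aestronglyMeasurable (Eventually.of_forall fun y => ?_)
      rw [Real.norm_of_nonneg (hm0 y)]
      simp only [hh, ← mul_assoc M]
      exact mul_le_mul_of_nonneg_right (min_le_left _ _) (norm_nonneg _)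
    rw [hJ, ← integral_mul_const]
    refine (norm_integral_le_of_norm_le
      ((hmi.mono_set (Set.Ioi_subset_Ioi hx)).mul_const B) ?_).trans
      (setIntegral_mono_set (hmi.mul_const B)
        (Eventually.of_forall fun y => mul_nonneg (hm0 y) hB0)
        (Set.Ioi_subset_Ioi hx).eventuallyLE)
    refine (ae_restrict_iff' measurableSet_Ioi).2 (Eventually.of_forall fun y hy => ?_)
    have hy' : x ≤ y := le_of_lt hy
    have hr : 0 ≤ y - x := by linarith
    rw [← _root_.sub_apply, ← sub_mul, ← smul_mul_assoc, ← sub_mul]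
    refine ((ContinuousLinearMap.le_opNorm _ _).trans ?_)
    refine mul_le_mul ((norm_mul_le _ _).trans
      (mul_le_mul_of_nonneg_right (le_min ?_ ?_) (norm_nonneg _)))
      (hB y (hx.trans hy')) (norm_nonneg _) (hm0 y)
    · calc ‖(ζ - ζ₀)⁻¹ • (K (y - x) ζ - K (y - x) ζ₀) - K' (y - x)‖
          ≤ L * (1 + (y - x)) ^ 2 + C * (1 + (y - x)) ^ 2 := by
            refine (norm_sub_le _ _).trans (add_le_add ?_ (k1 _ hr))
            rw [norm_smul, norm_inv, inv_mul_le_iff₀ hn', mul_comm]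
            exact hζL (y - x) hr
        _ = (C + L) * (1 + (y - x)) ^ 2 := by ring
        _ ≤ (2 * C + L) * (D * (1 + |y|) ^ 2) := by
            refine mul_le_mul (by linarith) ((pow_one_add_sub_le hx hy' le_rfl).trans ?_)
              (by positivity) (by positivity)
            gcongr
        _ = _ := by rw [hM]; ring
    · have e1 : (ζ - ζ₀)⁻¹ • (K (y - x) ζ - K (y - x) ζ₀) - K' (y - x) =
          (ζ - ζ₀)⁻¹ • (K (y - x) ζ - K (y - x) ζ₀ - (ζ - ζ₀) • K' (y - x)) := by
        rw [smul_sub _ _ ((ζ - ζ₀) • K' (y - x)), smul_smul, inv_mul_cancel₀ hn, one_smul]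
      rw [e1, norm_smul, norm_inv, inv_mul_le_iff₀ hn']
      refine (hζ (y - x) hr).2.trans ?_
      rw [abs_of_nonneg hn'.le]
      calc C * (1 + (y - x)) ^ (1 + 2) * ‖ζ - ζ₀‖ ^ 2
          ≤ (2 * C + L) * (D * (1 + |y|) ^ 3) * ‖ζ - ζ₀‖ ^ 2 := by
            refine mul_le_mul_of_nonneg_right (mul_le_mul (by linarith)
              (pow_one_add_sub_le hx hy' le_rfl) (by positivity) (by positivity)) (by positivity)
        _ = _ := by rw [hM]; ring
  obtain ⟨N₁, -, hU₁⟩ := exists_volterra_limit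
    (f₀ := fun x => e' - ∫ y in Set.Ioi x, (K' (y - x) * Δ y) (N₀ y))
    (G := ‖e'‖ + (∫ y in Set.Ioi x₀, h y) * B)
    hslope hA hA₀ hhc hh0 hhi hAe (fun _ => norm_nonneg _) hε
    (fun x hx => (norm_sub_le _ _).trans
      (add_le_add le_rfl (hA'.norm_integral_le hhi hh0 hB hx))) hf hδ'
  refine ⟨N₀ x₀, N₁ x₀, hU.tendsto_at Set.self_mem_Ici, hU₁.tendsto_at Set.self_mem_Ici, fun hS => ?_⟩
  -- Uniqueness is stability with equal kernels and equal inhomogeneities.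
  have := (hN ζ₀ hS).norm_sub_le (ε := 0) (δ := 0) hN₀ hA₀ hA₀ hhc hh0 hhi
    (by simp) le_rfl hB (by simp) (le_refl x₀)
  simp only [zero_mul, add_zero] at this
  exact sub_eq_zero.1 (norm_le_zero_iff.1 this)

/-! ### The spectral functions -/

section Spectral

variable (P : Params)

/-- `(ζ - q₀²/ζ)/2 = z - Tq₀² + α/2`. -/
def kap (ζ : ℂ) : ℂ := (ζ - (P.q₀ : ℂ) ^ 2 / ζ) / 2

theorem Params.q₀_ne : (P.q₀ : ℂ) ≠ 0 := by exact_mod_cast P.q₀_pos.ne'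

theorem lam_add_kap (ζ : ℂ) : lam P ζ + kap P ζ = ζ := by
  simp only [lam, kap]
  ring

theorem lam_sub_kap (ζ : ℂ) : lam P ζ - kap P ζ = (P.q₀ : ℂ) ^ 2 / ζ := by
  simp only [lam, kap]
  ring

theorem lam_sq {ζ : ℂ} (h0 : ζ ≠ 0) : lam P ζ ^ 2 = kap P ζ ^ 2 + (P.q₀ : ℂ) ^ 2 := by
  simp only [lam, kap]
  field_simp
  ring

/-- D₁ is therefore the set Im λ > 0 (off the origin), where e^{2iλr} is bounded for r ≥ 0; this is
what the Volterra equations from +∞ require. -/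
theorem lam_im {ζ : ℂ} (h0 : ζ ≠ 0) :
    (lam P ζ).im = ((‖ζ‖ ^ 2 - P.q₀ ^ 2) * ζ.im) / (2 * ‖ζ‖ ^ 2) := by
  have hn : Complex.normSq ζ ≠ 0 := (Complex.normSq_pos.2 h0).ne'
  have e : lam P ζ = ((1 / 2 : ℝ) : ℂ) * (ζ + ((P.q₀ ^ 2 : ℝ) : ℂ) * ζ⁻¹) := by
    simp only [lam]
    push_cast
    ring
  rw [e, ← Complex.normSq_eq_norm_sq]
  simp only [Complex.im_ofReal_mul, Complex.add_im, Complex.inv_im]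
  field_simp
  ring

/-- `ζ ↦ -q₀²/ζ` exchanges the sign of `λ` and fixes `k`. -/
theorem lam_neg_div {ζ : ℂ} (h0 : ζ ≠ 0) : lam P (-(P.q₀ : ℂ) ^ 2 / ζ) = -lam P ζ := by
  have := P.q₀_ne
  simp only [lam]
  field_simp
  ring

theorem kap_neg_div {ζ : ℂ} (h0 : ζ ≠ 0) : kap P (-(P.q₀ : ℂ) ^ 2 / ζ) = kap P ζ := by
  have := P.q₀_ne
  simp only [kap]
  field_simp
  ring

theorem lam_conj (ζ : ℂ) : lam P (conj ζ) = conj (lam P ζ) := by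
  simp [lam, Complex.conj_ofNat]

theorem kap_conj (ζ : ℂ) : kap P (conj ζ) = conj (kap P ζ) := by
  simp [kap, Complex.conj_ofNat]

theorem specZ_eq (ζ : ℂ) : specZ P ζ = kap P ζ + P.T * (P.q₀ : ℂ) ^ 2 - P.α / 2 := rfl

/-- The set `Σ ∪ D₁`, on which the Jost functions `ψ₋₁` and `ψ₊₂` live. -/
def S₁ : Set ℂ := Sig P ∪ D₁ P

theorem ne_zero_of_mem_S₁ {ζ : ℂ} (h : ζ ∈ S₁ P) : ζ ≠ 0 := by
  rcases h with h | h
  · exact h.2.1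
  · rintro rfl
    simp [D₁] at h

theorem ne_branch_of_mem_S₁ {ζ : ℂ} (h : ζ ∈ S₁ P) :
    ζ ≠ Complex.I * P.q₀ ∧ ζ ≠ -(Complex.I * P.q₀) := by
  rcases h with h | h
  · exact h.2.2
  · constructor <;>
    · rintro rfl
      simp [D₁] at h

theorem mem_S₁_iff {ζ : ℂ} : ζ ∈ S₁ P ↔ ζ ≠ 0 ∧ ζ ≠ Complex.I * P.q₀ ∧ ζ ≠ -(Complex.I * P.q₀) ∧
    0 ≤ (‖ζ‖ ^ 2 - P.q₀ ^ 2) * ζ.im := by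
  constructor
  · intro h
    refine ⟨ne_zero_of_mem_S₁ P h, (ne_branch_of_mem_S₁ P h).1, (ne_branch_of_mem_S₁ P h).2, ?_⟩
    rcases h with h | h
    · rcases h.1 with h | h
      · rw [h, mul_zero]
      · rw [h, sub_self, zero_mul]
    · exact le_of_lt h
  · rintro ⟨h0, h1, h2, h3⟩
    rcases h3.eq_or_lt with h | h
    · refine Or.inl ⟨?_, h0, h1, h2⟩
      rcases mul_eq_zero.1 h.symm with h | h
      · right
        exact (pow_left_inj₀ (norm_nonneg _) P.q₀_pos.le two_ne_zero).1 (sub_eq_zero.1 h)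
      · exact Or.inl h
    · exact Or.inr h

theorem lam_im_nonneg {ζ : ℂ} (h : ζ ∈ S₁ P) : 0 ≤ (lam P ζ).im := by
  rw [lam_im P (ne_zero_of_mem_S₁ P h)]
  have := ((mem_S₁_iff P).1 h).2.2.2
  positivity

theorem lam_ne_zero {ζ : ℂ} (h0 : ζ ≠ 0) (h1 : ζ ≠ Complex.I * P.q₀)
    (h2 : ζ ≠ -(Complex.I * P.q₀)) : lam P ζ ≠ 0 := by
  intro h
  have : (ζ - Complex.I * P.q₀) * (ζ + Complex.I * P.q₀) = 0 := by
    have e : lam P ζ * (2 * ζ) = ζ ^ 2 + (P.q₀ : ℂ) ^ 2 := by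
      simp only [lam]
      field_simp
    rw [h, zero_mul] at e
    linear_combination (-(P.q₀ : ℂ) ^ 2) * Complex.I_sq - e
  rcases mul_eq_zero.1 this with h | h
  · exact h1 (sub_eq_zero.1 h)
  · exact h2 (eq_neg_of_add_eq_zero_left h)

end Spectral

/-! ### The one sided scattering problem -/

/-- A matrix as a continuous linear operator on `ℂ²`. -/
def matOp (A : Matrix (Fin 2) (Fin 2) ℂ) : (Fin 2 → ℂ) →L[ℂ] (Fin 2 → ℂ) :=
  LinearMap.toContinuousLinearMap (Matrix.toLin' A)

@[simp] theorem matOp_apply (A : Matrix (Fin 2) (Fin 2) ℂ) (v : Fin 2 → ℂ) :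
    matOp A v = A *ᵥ v := rfl

/-- The potentials `u` (off diagonal) and `f` (diagonal) approach the background `w` at `+∞`. -/
structure IsPotential (P : Params) (w : ℂ) (u : ℝ → ℂ) (f : ℝ → ℝ) : Prop where
  norm_eq : conj w * w = (P.q₀ : ℂ) ^ 2
  contDiff : ContDiff ℝ 1 u
  continuous : Continuous f
  integrable_u : IntegrableOn (fun y => (1 + |y|) ^ 2 * ‖u y - w‖) (Set.Ioi 0)
  integrable_f : IntegrableOn (fun y => (1 + |y|) ^ 2 * |f y|) (Set.Ioi 0)

/-- The second Jost column at `+∞`, normalized by its exponential factor. -/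
structure IsJostColumn (P : Params) (w : ℂ) (u : ℝ → ℂ) (f : ℝ → ℝ) (ζ : ℂ)
    (ν : ℝ → Fin 2 → ℂ) : Prop where
  ode : ∀ x, HasDerivAt ν ![(Complex.I * f x - Complex.I * ζ) * ν x 0 + u x * ν x 1,
    -conj (u x) * ν x 0 + (-Complex.I * f x - Complex.I * ((P.q₀ : ℂ) ^ 2 / ζ)) * ν x 1] x
  lim : Tendsto ν atTop (𝓝 ![-Complex.I * w / ζ, 1])

section OneSided

variable (P : Params) (w : ℂ) (u : ℝ → ℂ) (f : ℝ → ℝ)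

/-- The background generator `-ikσ₃ + Q`. -/
def bgOp (ζ : ℂ) : (Fin 2 → ℂ) →L[ℂ] (Fin 2 → ℂ) :=
  kap P ζ • matOp !![-Complex.I, 0; 0, Complex.I] + matOp !![0, w; -conj w, 0]

/-- The perturbation of the background. -/
def potOp (y : ℝ) : (Fin 2 → ℂ) →L[ℂ] (Fin 2 → ℂ) :=
  (f y : ℂ) • matOp !![Complex.I, 0; 0, -Complex.I] + (u y - w) • matOp !![0, 1; 0, 0]
    - conj (u y - w) • matOp !![0, 0; 1, 0]

/-- The propagator `e^{-r(X - iλ)}` of the background equation. -/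
def bgKer (r : ℝ) (ζ : ℂ) : (Fin 2 → ℂ) →L[ℂ] (Fin 2 → ℂ) :=
  ((1 + Complex.exp (Complex.I * (2 * lam P ζ * r))) / 2) • 1 - expInt r (lam P ζ) • bgOp P w ζ

/-- The background eigenvector of the second Jost column. -/
def bgVec (ζ : ℂ) : Fin 2 → ℂ := ![-Complex.I * w / ζ, 1]

variable {P w u f}

theorem hasDerivAt_clm_apply {E F : Type*} [NormedAddCommGroup E] [NormedSpace ℂ E]
    [NormedAddCommGroup F] [NormedSpace ℂ F] {T : ℝ → E →L[ℂ] F} {T' : E →L[ℂ] F} {v : ℝ → E}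
    {v' : E} {y : ℝ} (hT : HasDerivAt T T' y) (hv : HasDerivAt v v' y) :
    HasDerivAt (fun y => T y (v y)) (T' (v y) + T y v') y := by
  have h := (ContinuousLinearMap.restrictScalarsL ℂ E F ℝ ℝ).hasFDerivAt.comp_hasDerivAt y hT
  exact h.clm_apply hv

/-- Cayley-Hamilton for the traceless generator X. It gives e^{-rX} = cos λr - X sin(λr)/λ, and the
factor e^{iλr} turns this into `bgKer`. -/
theorem bgOp_mul_self (hw : conj w * w = (P.q₀ : ℂ) ^ 2) {ζ : ℂ} (h0 : ζ ≠ 0) :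
    bgOp P w ζ * bgOp P w ζ = (-(lam P ζ) ^ 2) • 1 := by
  ext v i
  rw [lam_sq P h0, ← hw]
  fin_cases i
  · simp [bgOp, dotProduct, Fin.sum_univ_two]
    linear_combination (kap P ζ) ^ 2 * v 0 * Complex.I_sq
  · simp [bgOp, dotProduct, Fin.sum_univ_two]
    linear_combination (kap P ζ) ^ 2 * v 1 * Complex.I_sq

theorem bgOp_bgVec (hw : conj w * w = (P.q₀ : ℂ) ^ 2) {ζ : ℂ} (h0 : ζ ≠ 0) :
    bgOp P w ζ (bgVec w ζ) = (Complex.I * lam P ζ) • bgVec w ζ := by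
  have h1 := lam_add_kap P ζ
  have h2 := lam_sub_kap P ζ
  ext i
  fin_cases i
  · simp [bgOp, bgVec]
    field_simp
    linear_combination (-w) * h1 + (lam P ζ * w + kap P ζ * w) * Complex.I_sq
  · simp [bgOp, bgVec]
    rw [← hw] at h2
    linear_combination (-Complex.I) * h2

/-- The vector is an eigenvector of X for iλ, so the propagator of X - iλ fixes it; this makes the
inhomogeneity of the Volterra equation constant in x. -/
theorem bgKer_bgVec (hw : conj w * w = (P.q₀ : ℂ) ^ 2) {ζ : ℂ} (h0 : ζ ≠ 0) (r : ℝ) :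
    bgKer P w r ζ (bgVec w ζ) = bgVec w ζ := by
  have h := two_I_mul_expInt r (lam P ζ)
  simp only [bgKer, _root_.sub_apply, _root_.smul_apply, bgOp_bgVec hw h0, smul_smul,
    one_apply_eq_self, ← sub_smul]
  convert one_smul ℂ (bgVec w ζ) using 2
  linear_combination (-1 / 2 : ℂ) * h

theorem hasDerivAt_bgKer (hw : conj w * w = (P.q₀ : ℂ) ^ 2) {ζ : ℂ} (h0 : ζ ≠ 0) (r : ℝ) :
    HasDerivAt (fun r => bgKer P w r ζ)
      (-(bgKer P w r ζ * (bgOp P w ζ - (Complex.I * lam P ζ) • 1))) r := by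
  have h := two_I_mul_expInt r (lam P ζ)
  have d1 : HasDerivAt (fun r : ℝ => (1 + Complex.exp (Complex.I * (2 * lam P ζ * r))) / 2)
      (Complex.I * lam P ζ * Complex.exp (Complex.I * (2 * lam P ζ * r))) r := by
    have := (((((Complex.ofRealCLM.hasDerivAt (x := r)).const_mul (2 * lam P ζ)).const_mul
      Complex.I).cexp).const_add 1).div_const 2
    refine this.congr_deriv ?_
    simp only [Complex.ofRealCLM_apply, Complex.ofReal_one, mul_one]
    ring
  have d := (d1.smul_const (1 : (Fin 2 → ℂ) →L[ℂ] (Fin 2 → ℂ))).sub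
    ((hasDerivAt_expInt r (lam P ζ)).smul_const (bgOp P w ζ))
  refine d.congr_deriv ?_
  have e : bgKer P w r ζ * (bgOp P w ζ - (Complex.I * lam P ζ) • 1) =
      ((1 + Complex.exp (Complex.I * (2 * lam P ζ * r))) / 2) • bgOp P w ζ
      - ((1 + Complex.exp (Complex.I * (2 * lam P ζ * r))) / 2 * (Complex.I * lam P ζ)) •
        (1 : (Fin 2 → ℂ) →L[ℂ] (Fin 2 → ℂ))
      - (expInt r (lam P ζ) * -(lam P ζ) ^ 2) • (1 : (Fin 2 → ℂ) →L[ℂ] (Fin 2 → ℂ))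
      + (expInt r (lam P ζ) * (Complex.I * lam P ζ)) • bgOp P w ζ := by
    ext1 v
    have hXX : bgOp P w ζ (bgOp P w ζ v) = (-(lam P ζ) ^ 2) • v :=
      congrArg (fun T => T v) (bgOp_mul_self hw h0)
    simp only [bgKer, mul_apply_eq_comp, _root_.sub_apply, _root_.smul_apply,
      _root_.add_apply, one_apply_eq_self, map_sub, map_smul, hXX]
    module
  rw [e]
  have h1 : expInt r (lam P ζ) * (Complex.I * lam P ζ) =
      (Complex.exp (Complex.I * (2 * lam P ζ * r)) - 1) / 2 := by
    rw [← h]; ring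
  have h2 : expInt r (lam P ζ) * -(lam P ζ) ^ 2 =
      (Complex.I * lam P ζ) * ((Complex.exp (Complex.I * (2 * lam P ζ * r)) - 1) / 2) := by
    rw [← h]
    linear_combination (-(lam P ζ) ^ 2 * expInt r (lam P ζ)) * Complex.I_sq
  rw [h1, h2]
  module

theorem continuous_bgKer (ζ : ℂ) : Continuous fun r => bgKer P w r ζ := by
  have h1 : Continuous fun r => expInt r (lam P ζ) :=
    continuous_iff_continuousAt.2 fun r => (hasDerivAt_expInt r _).continuousAt
  simp only [bgKer]
  fun_prop

/-- At a fixed ζ off the branch points the propagator is bounded in r. The bound degenerates as λ →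
0, which is why the expansion in ζ works with linear growth in r instead. -/
theorem norm_bgKer_le {ζ : ℂ} (hl : lam P ζ ≠ 0) (him : 0 ≤ (lam P ζ).im) {r : ℝ} (hr : 0 ≤ r) :
    ‖bgKer P w r ζ‖ ≤ 1 + ‖bgOp P w ζ‖ / ‖lam P ζ‖ := by
  have hE := norm_exp_I_mul_le (im_two_mul_mul_nonneg him hr)
  have hl' : 0 < ‖lam P ζ‖ := norm_pos_iff.2 hl
  have h := two_I_mul_expInt r (lam P ζ)
  have hk : ‖expInt r (lam P ζ)‖ ≤ 1 / ‖lam P ζ‖ := by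
    rw [le_div_iff₀ hl']
    have e : 2 * (‖expInt r (lam P ζ)‖ * ‖lam P ζ‖) =
        ‖Complex.exp (Complex.I * (2 * lam P ζ * r)) - 1‖ := by
      rw [← h]
      simp only [norm_mul, Complex.norm_I]
      norm_num
      ring
    have := norm_sub_le (Complex.exp (Complex.I * (2 * lam P ζ * r))) 1
    rw [norm_one] at this
    linarith
  have h1 : ‖(1 + Complex.exp (Complex.I * (2 * lam P ζ * r))) / 2‖ ≤ 1 := by
    rw [norm_div]
    have := norm_add_le 1 (Complex.exp (Complex.I * (2 * lam P ζ * r)))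
    rw [norm_one] at this
    norm_num
    linarith
  refine (norm_sub_le _ _).trans (add_le_add ?_ ?_)
  · rw [norm_smul]
    have : ‖(1 : (Fin 2 → ℂ) →L[ℂ] (Fin 2 → ℂ))‖ ≤ 1 := ContinuousLinearMap.norm_id_le
    nlinarith [norm_nonneg ((1 + Complex.exp (Complex.I * (2 * lam P ζ * r))) / 2),
      norm_nonneg (1 : (Fin 2 → ℂ) →L[ℂ] (Fin 2 → ℂ))]
  · rw [norm_smul]
    calc _ ≤ 1 / ‖lam P ζ‖ * ‖bgOp P w ζ‖ := mul_le_mul_of_nonneg_right hk (norm_nonneg _)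
      _ = _ := by ring

/-- The first order expansion of the background propagator in `ζ`. -/
theorem exists_taylorBound_bgKer {l : Filter ℂ} {ζ₀ : ℂ} (hl : l ≤ 𝓝 ζ₀) (h0 : ζ₀ ≠ 0)
    (him₀ : 0 ≤ (lam P ζ₀).im) (him : ∀ᶠ ζ in l, 0 ≤ (lam P ζ).im) :
    ∃ K' : ℝ → (Fin 2 → ℂ) →L[ℂ] (Fin 2 → ℂ), Continuous K' ∧
      TaylorBound l ζ₀ 1 (bgKer P w) K' := by
  have tid := taylorBound_id hl
  have tinv := taylorBound_inv hl h0
  have tq := (taylorBound_const (l := l) (ζ₀ := ζ₀) (((P.q₀ : ℂ) ^ 2 / 2 : ℂ))).smul tinv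
  have tqn := (taylorBound_const (l := l) (ζ₀ := ζ₀) ((-(P.q₀ : ℂ) ^ 2 / 2 : ℂ))).smul tinv
  have thalf := (taylorBound_const (l := l) (ζ₀ := ζ₀) ((1 / 2 : ℂ))).smul tid
  have tlam := (thalf.add tq).congr (φ₂ := fun _ ζ => lam P ζ)
    (fun _ ζ => by simp only [lam, smul_eq_mul]; ring) (fun _ => rfl)
  have tkap := (thalf.add tqn).congr (φ₂ := fun _ ζ => kap P ζ)
    (fun _ ζ => by simp only [kap, smul_eq_mul]; ring) (fun _ => rfl)
  have texp := taylorBound_exp tlam him₀ him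
  have tint := taylorBound_expInt tlam him₀ him
  have tX := ((tkap.smul (taylorBound_const (l := l) (ζ₀ := ζ₀)
    (matOp !![-Complex.I, 0; 0, Complex.I]))).add (taylorBound_const
      (matOp !![0, w; -conj w, 0]))).congr (φ₂ := fun _ ζ => bgOp P w ζ) (fun _ _ => rfl)
      (fun _ => rfl)
  have t1 := (((taylorBound_const (l := l) (ζ₀ := ζ₀) ((1 / 2 : ℂ))).add
    ((taylorBound_const (l := l) (ζ₀ := ζ₀) ((1 / 2 : ℂ))).smul texp)).smul
      (taylorBound_const (l := l) (ζ₀ := ζ₀) (1 : (Fin 2 → ℂ) →L[ℂ] (Fin 2 → ℂ)))).mono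
      (n' := 1) (by norm_num)
  have t2 := ((taylorBound_const (l := l) (ζ₀ := ζ₀) ((-1 : ℂ))).smul (tint.smul tX))
  have t := (t1.add t2).congr (φ₂ := bgKer P w) (fun r ζ => by
    simp only [bgKer, smul_eq_mul]
    module) (fun _ => rfl)
  refine ⟨_, ?_, t⟩
  have c1 := continuous_expIntDeriv (lam P ζ₀)
  have c2 : Continuous fun r => expInt r (lam P ζ₀) :=
    continuous_iff_continuousAt.2 fun r => (hasDerivAt_expInt r _).continuousAt
  fun_prop

theorem IsPotential.continuous_potOp (h : IsPotential P w u f) : Continuous (potOp w u f) := by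
  have := h.contDiff.continuous
  have := h.continuous
  unfold potOp
  fun_prop

theorem exists_norm_potOp_le : ∃ C : ℝ, 0 ≤ C ∧
    ∀ (w : ℂ) (u : ℝ → ℂ) (f : ℝ → ℝ) (y : ℝ), ‖potOp w u f y‖ ≤ C * (|f y| + ‖u y - w‖) := by
  refine ⟨‖matOp !![Complex.I, 0; 0, -Complex.I]‖ + ‖matOp !![0, 1; 0, 0]‖ +
    ‖matOp !![0, 0; 1, 0]‖, by positivity, fun w u f y => ?_⟩
  unfold potOp
  refine (norm_sub_le _ _).trans ((add_le_add_left (norm_add_le _ _) _).trans ?_)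
  simp only [norm_smul, Complex.norm_real, RCLike.norm_conj, Real.norm_eq_abs]
  have h1 := norm_nonneg (matOp !![Complex.I, 0; 0, -Complex.I])
  have h2 := norm_nonneg (matOp !![0, 1; 0, 0])
  have h3 := norm_nonneg (matOp !![0, 0; 1, 0])
  have h4 := abs_nonneg (f y)
  have h5 := norm_nonneg (u y - w)
  nlinarith [mul_nonneg h1 h5, mul_nonneg h2 h4, mul_nonneg h3 h4]

theorem IsPotential.integrableOn_sq (h : IsPotential P w u f) (x₀ : ℝ) :
    IntegrableOn (fun y => (1 + |y|) ^ 2 * ‖potOp w u f y‖) (Set.Ioi x₀) := by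
  obtain ⟨C, hC, hle⟩ := exists_norm_potOp_le
  have hc := h.continuous_potOp
  have hcont : Continuous fun y => (1 + |y|) ^ 2 * ‖potOp w u f y‖ := by fun_prop
  refine integrableOn_Ioi_of_continuous hcont (a := 0) ?_ x₀
  refine Integrable.mono' ((h.integrable_f.add h.integrable_u).const_mul C)
    hcont.aestronglyMeasurable (Eventually.of_forall fun y => ?_)
  rw [Real.norm_of_nonneg (by positivity)]
  calc (1 + |y|) ^ 2 * ‖potOp w u f y‖ ≤ (1 + |y|) ^ 2 * (C * (|f y| + ‖u y - w‖)) :=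
        mul_le_mul_of_nonneg_left (hle w u f y) (by positivity)
    _ = _ := by simp only [Pi.add_apply]; ring

theorem IsPotential.integrableOn (h : IsPotential P w u f) (x₀ : ℝ) :
    IntegrableOn (fun y => ‖potOp w u f y‖) (Set.Ioi x₀) := by
  refine Integrable.mono' (h.integrableOn_sq x₀) h.continuous_potOp.norm.aestronglyMeasurable
    (Eventually.of_forall fun y => ?_)
  rw [Real.norm_of_nonneg (norm_nonneg _)]
  have h1 : 1 ≤ (1 + |y|) ^ 2 := one_le_pow₀ (by linarith [abs_nonneg y])
  nlinarith [norm_nonneg (potOp w u f y)]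

theorem IsJostColumn.hasDerivAt {ζ : ℂ} {ν : ℝ → Fin 2 → ℂ} (h : IsJostColumn P w u f ζ ν) (x : ℝ) :
    HasDerivAt ν ((bgOp P w ζ - (Complex.I * lam P ζ) • 1) (ν x) + potOp w u f x (ν x)) x := by
  refine (h.ode x).congr_deriv ?_
  have h1 := lam_add_kap P ζ
  have h2 := lam_sub_kap P ζ
  ext i
  fin_cases i
  · simp [bgOp, potOp, dotProduct, Fin.sum_univ_two, Matrix.vecHead]
    linear_combination Complex.I * ν x 0 * h1
  · simp [bgOp, potOp, dotProduct, Fin.sum_univ_two, Matrix.vecHead, Matrix.vecTail]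
    linear_combination Complex.I * ν x 1 * h2

theorem bddAbove_norm_of_tendsto {E : Type*} [NormedAddCommGroup E] {ν : ℝ → E} {v : E}
    (hc : Continuous ν) (hl : Tendsto ν atTop (𝓝 v)) (x₀ : ℝ) : ∃ B, ∀ x, x₀ ≤ x → ‖ν x‖ ≤ B := by
  obtain ⟨R, hR⟩ := (hl.norm.eventually (ge_mem_nhds (lt_add_one ‖v‖))).exists_forall_of_atTop
  obtain ⟨B, hB⟩ := (isCompact_Icc (a := x₀) (b := R)).exists_bound_of_continuousOn
    hc.continuousOn
  refine ⟨max B (‖v‖ + 1), fun x hx => ?_⟩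
  rcases le_total x R with h | h
  · exact (hB x ⟨hx, h⟩).trans (le_max_left _ _)
  · exact (hR x h).trans (le_max_right _ _)

/-- A Jost column solves the Volterra equation. -/
theorem IsJostColumn.isVolterra (hP : IsPotential P w u f) {ζ : ℂ} {ν : ℝ → Fin 2 → ℂ}
    (hζ : ζ ∈ S₁ P) (h : IsJostColumn P w u f ζ ν) (x₀ : ℝ) :
    IsVolterra x₀ (fun x y => bgKer P w (y - x) ζ * potOp w u f y) (fun _ => bgVec w ζ) ν := by
  have h0 := ne_zero_of_mem_S₁ P hζ
  have hl := lam_ne_zero P h0 (ne_branch_of_mem_S₁ P hζ).1 (ne_branch_of_mem_S₁ P hζ).2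
  have him := lam_im_nonneg P hζ
  have hw := hP.norm_eq
  have hc : Continuous ν := continuous_iff_continuousAt.2 fun x => (h.ode x).continuousAt
  have hb := bddAbove_norm_of_tendsto hc h.lim
  refine ⟨hc.continuousOn, hb x₀, fun x _ => ?_⟩
  obtain ⟨B, hB⟩ := hb x
  set M := 1 + ‖bgOp P w ζ‖ / ‖lam P ζ‖ with hM
  -- Variation of constants: the background part of the equation for ν cancels the derivative of the
  -- propagator. Integration over (x, ∞) then gives the Volterra equation, with end values ν x and
  -- `bgVec`.
  have hd : ∀ y, HasDerivAt (fun y => bgKer P w (y - x) ζ (ν y))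
      ((bgKer P w (y - x) ζ * potOp w u f y) (ν y)) y := by
    intro y
    have e1 : HasDerivAt (fun y => bgKer P w (y - x) ζ)
        (-(bgKer P w (y - x) ζ * (bgOp P w ζ - (Complex.I * lam P ζ) • 1))) y :=
      HasDerivAt.comp_sub_const y x (hasDerivAt_bgKer hw h0 (y - x))
    refine (hasDerivAt_clm_apply e1 (h.hasDerivAt y)).congr_deriv ?_
    simp only [mul_apply_eq_comp, _root_.neg_apply, map_add]
    abel
  have hK : IsKernelBound x (fun x y => bgKer P w (y - x) ζ * potOp w u f y)
      (fun y => M * ‖potOp w u f y‖) := by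
    refine ⟨fun x => ((continuous_bgKer ζ).comp (continuous_id.sub continuous_const)).mul
      hP.continuous_potOp, fun x' y _ hy => (norm_mul_le _ _).trans ?_⟩
    exact mul_le_mul_of_nonneg_right (norm_bgKer_le hl him (by linarith)) (norm_nonneg _)
  have hi := hK.integrableOn ((hP.integrableOn x).const_mul M) hc.continuousOn hB (le_refl x)
  have hlim : Tendsto (fun y => bgKer P w (y - x) ζ (ν y)) atTop (𝓝 (bgVec w ζ)) := by
    rw [tendsto_iff_norm_sub_tendsto_zero]
    have h1 : Tendsto (fun y => M * ‖ν y - bgVec w ζ‖) atTop (𝓝 0) := by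
      have := (tendsto_iff_norm_sub_tendsto_zero.1 h.lim).const_mul M
      rwa [mul_zero] at this
    refine squeeze_zero' (Eventually.of_forall fun _ => norm_nonneg _) ?_ h1
    filter_upwards [eventually_ge_atTop x] with y hy
    nth_rewrite 1 [← bgKer_bgVec hw h0 (y - x)]
    rw [← map_sub]
    exact (ContinuousLinearMap.le_opNorm _ _).trans
      (mul_le_mul_of_nonneg_right (norm_bgKer_le hl him (by linarith)) (norm_nonneg _))
  have key := integral_Ioi_of_hasDerivAt_of_tendsto' (fun y _ => hd y) hi hlim
  rw [key, sub_self]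
  have : bgKer P w 0 ζ (ν x) = ν x := by
    simp [bgKer, expInt]
  rw [this]
  abel

end OneSided

/-! ### Regularity of the Jost columns in the spectral parameter -/

section Regularity

variable {P : Params} {w : ℂ} {u : ℝ → ℂ} {f : ℝ → ℝ}

theorem hasDerivAt_bgVec {ζ : ℂ} (h0 : ζ ≠ 0) :
    HasDerivAt (bgVec w) ![Complex.I * w / ζ ^ 2, 0] ζ := by
  rw [hasDerivAt_pi]
  intro i
  fin_cases i
  · have := (hasDerivAt_inv h0).const_mul (-Complex.I * w)
    simp only [bgVec, div_eq_mul_inv]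
    refine this.congr_deriv ?_
    simp
  · exact hasDerivAt_const _ _

/-- First order expansion of the Jost column in the spectral parameter, including the branch
points. -/
theorem exists_jost_slope (hP : IsPotential P w u f) {ν : ℂ → ℝ → Fin 2 → ℂ}
    (hν : ∀ ζ ∈ S₁ P, IsJostColumn P w u f ζ (ν ζ)) {ζ₀ : ℂ} (h0 : ζ₀ ≠ 0)
    (him : 0 ≤ (lam P ζ₀).im) [(𝓝[S₁ P \ {ζ₀}] ζ₀).NeBot] (x : ℝ) :
    ∃ N₀ N₁ : Fin 2 → ℂ, Tendsto (fun ζ => ν ζ x) (𝓝[S₁ P \ {ζ₀}] ζ₀) (𝓝 N₀) ∧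
      Tendsto (fun ζ => (ζ - ζ₀)⁻¹ • (ν ζ x - N₀)) (𝓝[S₁ P \ {ζ₀}] ζ₀) (𝓝 N₁) ∧
      (ζ₀ ∈ S₁ P → ν ζ₀ x = N₀) := by
  obtain ⟨K', hK'c, hK'⟩ := exists_taylorBound_bgKer (P := P) (w := w)
    (l := 𝓝[S₁ P \ {ζ₀}] ζ₀) nhdsWithin_le_nhds h0 him (by
      filter_upwards [self_mem_nhdsWithin] with ζ hζ using lam_im_nonneg P hζ.1)
  exact exists_volterra_slope hK' continuous_bgKer hK'c hP.continuous_potOp (hP.integrableOn_sq x)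
    (hasDerivAt_bgVec h0).hasDerivWithinAt fun ζ hζ => (hν ζ hζ).isVolterra hP hζ x

theorem jost_differentiableWithinAt (hP : IsPotential P w u f) {ν : ℂ → ℝ → Fin 2 → ℂ}
    (hν : ∀ ζ ∈ S₁ P, IsJostColumn P w u f ζ (ν ζ)) {ζ₀ : ℂ} (hζ₀ : ζ₀ ∈ S₁ P) (x : ℝ) :
    DifferentiableWithinAt ℂ (fun ζ => ν ζ x) (S₁ P) ζ₀ := by
  rcases (𝓝[S₁ P \ {ζ₀}] ζ₀).eq_or_neBot with h | h
  -- An isolated point of the set satisfies the claim trivially, which spares a proof that there is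
  -- none.
  · refine HasDerivWithinAt.differentiableWithinAt (f' := 0) ?_
    rw [hasDerivWithinAt_iff_tendsto_slope, h]
    exact tendsto_bot
  · obtain ⟨N₀, N₁, -, h2, h3⟩ := exists_jost_slope hP hν (ne_zero_of_mem_S₁ P hζ₀)
      (lam_im_nonneg P hζ₀) x
    refine HasDerivWithinAt.differentiableWithinAt (f' := N₁) ?_
    rw [hasDerivWithinAt_iff_tendsto_slope]
    rw [← h3 hζ₀] at h2
    exact h2

theorem IsJostColumn.unique (hP : IsPotential P w u f) {ζ : ℂ} (hζ : ζ ∈ S₁ P)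
    {ν₁ ν₂ : ℝ → Fin 2 → ℂ} (h₁ : IsJostColumn P w u f ζ ν₁) (h₂ : IsJostColumn P w u f ζ ν₂)
    (x : ℝ) : ν₁ x = ν₂ x := by
  have v₁ := h₁.isVolterra hP hζ x
  have v₂ := h₂.isVolterra hP hζ x
  have hl := lam_ne_zero P (ne_zero_of_mem_S₁ P hζ) (ne_branch_of_mem_S₁ P hζ).1
    (ne_branch_of_mem_S₁ P hζ).2
  have hK : IsKernelBound x (fun x y => bgKer P w (y - x) ζ * potOp w u f y)
      (fun y => (1 + ‖bgOp P w ζ‖ / ‖lam P ζ‖) * ‖potOp w u f y‖) := by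
    refine ⟨fun x => ((continuous_bgKer ζ).comp (continuous_id.sub continuous_const)).mul
      hP.continuous_potOp, fun x' y _ hy => (norm_mul_le _ _).trans ?_⟩
    exact mul_le_mul_of_nonneg_right (norm_bgKer_le hl (lam_im_nonneg P hζ) (by linarith))
      (norm_nonneg _)
  obtain ⟨B, hB⟩ := v₂.bdd
  have := v₁.norm_sub_le (ε := 0) (δ := 0) v₂ hK hK (hP.continuous_potOp.norm.const_mul _)
    (fun y => by positivity) ((hP.integrableOn x).const_mul _) (by simp) le_rfl hB (by simp)
    (le_refl x)
  simp only [zero_mul, add_zero] at this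
  exact sub_eq_zero.1 (norm_le_zero_iff.1 this)

end Regularity

/-! ### Behaviour at infinity -/

/-- A Riemann-Lebesgue lemma on the closed upper half plane, uniform in the base point. -/
theorem riemannLebesgue_Ioi {v v' : ℝ → ℂ} {x₀ : ℝ} (hv : ∀ y, HasDerivAt v (v' y) y)
    (hv' : Continuous v') (hi : IntegrableOn v (Set.Ioi x₀)) {ε : ℝ} (hε : 0 < ε) :
    ∃ R : ℝ, ∀ Λ : ℂ, 0 ≤ Λ.im → R ≤ ‖Λ‖ → ∀ x, x₀ ≤ x →
      ‖∫ y in Set.Ioi x, Complex.exp (Complex.I * (2 * Λ * (y - x : ℝ))) * v y‖ ≤ ε := by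
  have hvc : Continuous v := continuous_iff_continuousAt.2 fun y => (hv y).continuousAt
  have hE : ∀ {Λ : ℂ}, 0 ≤ Λ.im → ∀ {x y : ℝ}, x ≤ y →
      ‖Complex.exp (Complex.I * (2 * Λ * (y - x : ℝ)))‖ ≤ 1 := fun hΛ x y hxy =>
    norm_exp_I_mul_le (im_two_mul_mul_nonneg hΛ (sub_nonneg.2 hxy))
  have htail := tendsto_integral_Ioi_zero hvc.norm hi.norm
  obtain ⟨X₁, hX₁⟩ := (htail.eventually (ge_mem_nhds (half_pos hε))).exists_forall_of_atTop
  -- Beyond X the integral is small because v is integrable. The derivative v' is controlled only on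
  -- compact sets, so integration by parts is confined to [x, X].
  set X := max X₁ x₀ with hX
  have hXε : ∀ x, X ≤ x → ∫ y in Set.Ioi x, ‖v y‖ ≤ ε / 2 := fun x hx =>
    hX₁ x ((le_max_left _ _).trans hx)
  obtain ⟨C₁, hC₁⟩ := (isCompact_Icc (a := x₀) (b := X)).exists_bound_of_continuousOn
    hvc.continuousOn
  obtain ⟨C₂, hC₂⟩ := (isCompact_Icc (a := x₀) (b := X)).exists_bound_of_continuousOn
    hv'.continuousOn
  have hx₀X : x₀ ≤ X := le_max_right _ _
  have hC₁0 : 0 ≤ C₁ := (norm_nonneg _).trans (hC₁ x₀ ⟨le_rfl, hx₀X⟩)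
  have hC₂0 : 0 ≤ C₂ := (norm_nonneg _).trans (hC₂ x₀ ⟨le_rfl, hx₀X⟩)
  have hint : ∀ {Λ : ℂ}, 0 ≤ Λ.im → ∀ {x z : ℝ}, x₀ ≤ x → x ≤ z → IntegrableOn
      (fun y : ℝ => Complex.exp (Complex.I * (2 * Λ * (y - x : ℝ))) * v y) (Set.Ioi z) := by
    intro Λ hΛ x z hx hz
    refine Integrable.mono (hi.mono_set (Set.Ioi_subset_Ioi (hx.trans hz)))
      (Continuous.aestronglyMeasurable (by fun_prop)) ?_
    refine (ae_restrict_iff' measurableSet_Ioi).2 (Eventually.of_forall fun y hy => ?_)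
    rw [norm_mul]
    exact mul_le_of_le_one_left (norm_nonneg _) (hE hΛ (hz.trans (le_of_lt hy)))
  have htl : ∀ {Λ : ℂ}, 0 ≤ Λ.im → ∀ {x z : ℝ}, x₀ ≤ x → x ≤ z → X ≤ z →
      ‖∫ y in Set.Ioi z, Complex.exp (Complex.I * (2 * Λ * (y - x : ℝ))) * v y‖ ≤ ε / 2 := by
    intro Λ hΛ x z hx hz hXz
    refine le_trans ?_ (hXε z hXz)
    refine norm_integral_le_of_norm_le (hi.mono_set (Set.Ioi_subset_Ioi (hx.trans hz))).norm ?_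
    refine (ae_restrict_iff' measurableSet_Ioi).2 (Eventually.of_forall fun y hy => ?_)
    rw [norm_mul]
    exact mul_le_of_le_one_left (norm_nonneg _) (hE hΛ (hz.trans (le_of_lt hy)))
  -- Each boundary term is at most C₁/(2|Λ|) and the integral with v' at most C₂(X-x₀)/(2|Λ|);
  -- beyond this threshold they add up to at most ε/2.
  refine ⟨max 1 ((2 * C₁ + C₂ * (X - x₀)) / ε), fun Λ hΛ hR x hx => ?_⟩
  rcases le_total X x with hxX | hxX
  · exact (htl hΛ hx le_rfl hxX).trans (by linarith)
  · have hΛ1 : 1 ≤ ‖Λ‖ := (le_max_left _ _).trans hR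
    have hΛ2 : (2 * C₁ + C₂ * (X - x₀)) / ε ≤ ‖Λ‖ := (le_max_right _ _).trans hR
    have hΛ0 : Λ ≠ 0 := norm_pos_iff.1 (by linarith)
    have hd0 : (2 * Complex.I * Λ) ≠ 0 := by simp [hΛ0]
    have hn : ‖(2 * Complex.I * Λ)⁻¹‖ = (2 * ‖Λ‖)⁻¹ := by
      rw [norm_inv, norm_mul, norm_mul, Complex.norm_I]; norm_num
    have hd : ∀ y ∈ Set.uIcc x X, HasDerivAt
        (fun y : ℝ => (2 * Complex.I * Λ)⁻¹ *
          (Complex.exp (Complex.I * (2 * Λ * (y - x : ℝ))) * v y))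
        (Complex.exp (Complex.I * (2 * Λ * (y - x : ℝ))) * v y + (2 * Complex.I * Λ)⁻¹ *
          (Complex.exp (Complex.I * (2 * Λ * (y - x : ℝ))) * v' y)) y := by
      intro y _
      have e1 : HasDerivAt (fun y : ℝ => ((y - x : ℝ) : ℂ)) 1 y := by
        have := ((hasDerivAt_id y).sub_const x).ofReal_comp
        simpa using this
      have e2 := (((e1.const_mul (2 * Λ)).const_mul Complex.I).cexp.mul (hv y)).const_mul
        (2 * Complex.I * Λ)⁻¹
      refine e2.congr_deriv ?_
      field_simp
    have hc1 : Continuous fun y : ℝ =>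
        Complex.exp (Complex.I * (2 * Λ * (y - x : ℝ))) * v y := by fun_prop
    have hc2 : Continuous fun y : ℝ => (2 * Complex.I * Λ)⁻¹ *
        (Complex.exp (Complex.I * (2 * Λ * (y - x : ℝ))) * v' y) := by fun_prop
    have hftc := intervalIntegral.integral_eq_sub_of_hasDerivAt hd
      ((hc1.add hc2).intervalIntegrable _ _)
    rw [intervalIntegral.integral_add (hc1.intervalIntegrable _ _)
      (hc2.intervalIntegrable _ _)] at hftc
    have hb : ‖∫ y in x..X, Complex.exp (Complex.I * (2 * Λ * (y - x : ℝ))) * v y‖ ≤ ε / 2 := by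
      rw [eq_sub_of_add_eq hftc]
      have hvX : ‖v X‖ ≤ C₁ := hC₁ X ⟨hx₀X, le_rfl⟩
      have hvx : ‖v x‖ ≤ C₁ := hC₁ x ⟨hx, hxX⟩
      have b1 : ‖(2 * Complex.I * Λ)⁻¹ *
          (Complex.exp (Complex.I * (2 * Λ * (X - x : ℝ))) * v X)‖ ≤ (2 * ‖Λ‖)⁻¹ * C₁ := by
        rw [norm_mul, norm_mul, hn]
        gcongr
        exact (mul_le_of_le_one_left (norm_nonneg _) (hE hΛ hxX)).trans hvX
      have b2 : ‖(2 * Complex.I * Λ)⁻¹ *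
          (Complex.exp (Complex.I * (2 * Λ * (x - x : ℝ))) * v x)‖ ≤ (2 * ‖Λ‖)⁻¹ * C₁ := by
        rw [norm_mul, norm_mul, hn]
        gcongr
        exact (mul_le_of_le_one_left (norm_nonneg _) (hE hΛ le_rfl)).trans hvx
      have b3 : ‖∫ y in x..X, (2 * Complex.I * Λ)⁻¹ *
          (Complex.exp (Complex.I * (2 * Λ * (y - x : ℝ))) * v' y)‖ ≤
          (2 * ‖Λ‖)⁻¹ * C₂ * (X - x₀) := by
        refine (intervalIntegral.norm_integral_le_of_norm_le_const
          (C := (2 * ‖Λ‖)⁻¹ * C₂) fun y hy => ?_).trans ?_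
        · rw [Set.uIoc_of_le hxX] at hy
          rw [norm_mul, norm_mul, hn]
          gcongr
          exact (mul_le_of_le_one_left (norm_nonneg _) (hE hΛ hy.1.le)).trans
            (hC₂ y ⟨hx.trans hy.1.le, hy.2⟩)
        · rw [abs_of_nonneg (by linarith)]
          gcongr
      calc _ ≤ (2 * ‖Λ‖)⁻¹ * C₁ + (2 * ‖Λ‖)⁻¹ * C₁ + (2 * ‖Λ‖)⁻¹ * C₂ * (X - x₀) :=
            (norm_sub_le _ _).trans (add_le_add ((norm_sub_le _ _).trans (add_le_add b1 b2)) b3)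
        _ = (2 * C₁ + C₂ * (X - x₀)) / (2 * ‖Λ‖) := by ring
        _ ≤ ε / 2 := by
          rw [div_le_iff₀ hε] at hΛ2
          rw [div_le_div_iff₀ (by linarith) (by norm_num)]
          nlinarith
    rw [← intervalIntegral.integral_interval_add_Ioi (hint hΛ hx le_rfl) (hint hΛ hx hxX)]
    exact (norm_add_le _ _).trans (by linarith [htl hΛ hx hxX le_rfl])

theorem tendsto_norm_lam (P : Params) : Tendsto (fun ζ => ‖lam P ζ‖) (cocompact ℂ) atTop := by
  have h1 : Tendsto (fun ζ : ℂ => (‖ζ‖ - P.q₀ ^ 2) / 2) (cocompact ℂ) atTop :=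
    (tendsto_atTop_add_const_right _ (-P.q₀ ^ 2)
      (tendsto_norm_cocompact_atTop (E := ℂ))).atTop_div_const two_pos
  refine tendsto_atTop_mono' _ ?_ h1
  filter_upwards [(tendsto_norm_cocompact_atTop (E := ℂ)).eventually_ge_atTop 1] with ζ hζ
  have h2 : ‖(P.q₀ : ℂ) ^ 2 / ζ‖ ≤ P.q₀ ^ 2 := by
    rw [norm_div, norm_pow, Complex.norm_real, Real.norm_of_nonneg P.q₀_pos.le]
    exact div_le_self (by positivity) hζ
  rw [lam, norm_div, show ‖(2 : ℂ)‖ = 2 by norm_num]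
  have h3 := norm_sub_norm_le ζ (-((P.q₀ : ℂ) ^ 2 / ζ))
  rw [norm_neg, sub_neg_eq_add] at h3
  gcongr
  linarith

section Infinity

variable {P : Params} {w : ℂ} {u : ℝ → ℂ} {f : ℝ → ℝ}

/-- For large λ the propagator is compared with diag(e^{2iλr}, 1), which is explicit enough for
Riemann-Lebesgue. The difference carries the factor `expInt`, of size O(1/|λ|) uniformly in r ≥ 0.
-/
theorem diag_sub_bgKer {ζ : ℂ} (r : ℝ) :
    matOp !![Complex.exp (Complex.I * (2 * lam P ζ * r)), 0; 0, 1] - bgKer P w r ζ =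
      expInt r (lam P ζ) • ((Complex.I * ((P.q₀ : ℂ) ^ 2 / ζ)) • matOp !![1, 0; 0, -1]
        + matOp !![0, w; -conj w, 0]) := by
  have h := two_I_mul_expInt r (lam P ζ)
  have h2 := lam_sub_kap P ζ
  rw [← h2]
  ext v i
  fin_cases i
  · simp [bgKer, bgOp, Matrix.vecHead, dotProduct, Fin.sum_univ_two]
    linear_combination (-1 / 2 * v 0) * h
  · simp [bgKer, bgOp, Matrix.vecHead, Matrix.vecTail, dotProduct, Fin.sum_univ_two]
    linear_combination (1 / 2 * v 1) * h

theorem IsPotential.integrableOn_f (hP : IsPotential P w u f) (x₀ : ℝ) :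
    IntegrableOn f (Set.Ioi x₀) := by
  refine integrableOn_Ioi_of_continuous hP.continuous (a := 0) ?_ x₀
  refine Integrable.mono' hP.integrable_f hP.continuous.aestronglyMeasurable
    (Eventually.of_forall fun y => ?_)
  have h1 : 1 ≤ (1 + |y|) ^ 2 := one_le_pow₀ (by linarith [abs_nonneg y])
  rw [Real.norm_eq_abs]
  nlinarith [abs_nonneg (f y)]

/-- The gauge factor `exp (i ∫_x^∞ f)`. -/
def gauge (f : ℝ → ℝ) (x : ℝ) : ℂ := Complex.exp (Complex.I * ((∫ y in Set.Ioi x, f y : ℝ) : ℂ))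

theorem norm_gauge (f : ℝ → ℝ) (x : ℝ) : ‖gauge f x‖ = 1 := by
  rw [gauge, mul_comm, Complex.norm_exp_ofReal_mul_I]

theorem IsPotential.hasDerivAt_gauge (hP : IsPotential P w u f) (x : ℝ) :
    HasDerivAt (gauge f) (-Complex.I * f x * gauge f x) x := by
  have h := (((hasDerivAt_integral_Ioi hP.continuous (hP.integrableOn_f 0) x).ofReal_comp).const_mul
    Complex.I).cexp
  refine h.congr_deriv ?_
  rw [gauge]
  push_cast
  ring

theorem IsPotential.tendsto_gauge (hP : IsPotential P w u f) : Tendsto (gauge f) atTop (𝓝 1) := by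
  have h := tendsto_integral_Ioi_zero hP.continuous (hP.integrableOn_f 0)
  have hc : Continuous fun s : ℝ => Complex.exp (Complex.I * (s : ℂ)) := by fun_prop
  have := (hc.tendsto 0).comp h
  simp only [Function.comp_def, Complex.ofReal_zero, mul_zero, Complex.exp_zero] at this
  exact this

/-- Uniformity in ζ near infinity: the generator grows no faster than λ, so the quotient in
`norm_bgKer_le` stays bounded. -/
theorem exists_norm_bgKer_le (P : Params) (w : ℂ) : ∃ C : ℝ, 0 ≤ C ∧ ∀ᶠ ζ in cocompact ℂ,
    ζ ∈ S₁ P → ∀ r, 0 ≤ r → ‖bgKer P w r ζ‖ ≤ C := by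
  set a := ‖matOp !![-Complex.I, 0; 0, Complex.I]‖
  set b := ‖matOp !![0, w; -conj w, 0]‖
  refine ⟨1 + ((1 + P.q₀ ^ 2) * a + b), by positivity, ?_⟩
  filter_upwards [(tendsto_norm_cocompact_atTop (E := ℂ)).eventually_ge_atTop 1,
    (tendsto_norm_lam P).eventually_ge_atTop 1] with ζ h1 h2 hζ r hr
  refine (norm_bgKer_le (norm_pos_iff.1 (by linarith)) (lam_im_nonneg P hζ) hr).trans ?_
  have hk : ‖kap P ζ‖ ≤ ‖lam P ζ‖ + P.q₀ ^ 2 := by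
    rw [show kap P ζ = lam P ζ - (P.q₀ : ℂ) ^ 2 / ζ by rw [← lam_sub_kap]; ring]
    refine (norm_sub_le _ _).trans (add_le_add le_rfl ?_)
    rw [norm_div, norm_pow, Complex.norm_real, Real.norm_of_nonneg P.q₀_pos.le]
    exact div_le_self (by positivity) h1
  gcongr
  rw [div_le_iff₀ (by linarith)]
  calc ‖bgOp P w ζ‖ ≤ ‖kap P ζ‖ * a + b := by
        refine (norm_add_le _ _).trans ?_
        rw [norm_smul]
    _ ≤ (‖lam P ζ‖ + P.q₀ ^ 2) * a + b := by gcongr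
    _ ≤ ((1 + P.q₀ ^ 2) * a + b) * ‖lam P ζ‖ := by
      have ha : 0 ≤ a := norm_nonneg _
      have hb : 0 ≤ b := norm_nonneg _
      nlinarith [mul_nonneg ha (sq_nonneg P.q₀), mul_nonneg (mul_nonneg ha (sq_nonneg P.q₀))
        (sub_nonneg.2 h2), mul_nonneg hb (sub_nonneg.2 h2)]

theorem norm_expInt_le_inv {Λ : ℂ} (hΛ : Λ ≠ 0) (him : 0 ≤ Λ.im) {r : ℝ} (hr : 0 ≤ r) :
    ‖expInt r Λ‖ ≤ 1 / ‖Λ‖ := by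
  have hE := norm_exp_I_mul_le (im_two_mul_mul_nonneg him hr)
  have hl' : 0 < ‖Λ‖ := norm_pos_iff.2 hΛ
  have h := two_I_mul_expInt r Λ
  rw [le_div_iff₀ hl']
  have e : 2 * (‖expInt r Λ‖ * ‖Λ‖) = ‖Complex.exp (Complex.I * (2 * Λ * r)) - 1‖ := by
    rw [← h]
    simp only [norm_mul, Complex.norm_I]
    norm_num
    ring
  have := norm_sub_le (Complex.exp (Complex.I * (2 * Λ * r))) 1
  rw [norm_one] at this
  linarith

/-- The limit of the Jost column at infinity. -/
theorem jost_tendsto_infinity (hP : IsPotential P w u f) {ν : ℂ → ℝ → Fin 2 → ℂ}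
    (hν : ∀ ζ ∈ S₁ P, IsJostColumn P w u f ζ (ν ζ)) (x₀ : ℝ) :
    Tendsto (fun ζ => ν ζ x₀) (cocompact ℂ ⊓ 𝓟 (S₁ P)) (𝓝 ![0, gauge f x₀]) := by
  set g := gauge f with hg
  have hgd : ∀ x, HasDerivAt g (-Complex.I * f x * g x) x := hP.hasDerivAt_gauge
  have hgn : ∀ x, ‖g x‖ = 1 := norm_gauge f
  have hgc : Continuous g := continuous_iff_continuousAt.2 fun x => (hgd x).continuousAt
  have hfc := hP.continuous
  have huc := hP.contDiff.continuous
  set e₀ : Fin 2 → ℂ := ![1, 0]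
  set e₁ : Fin 2 → ℂ := ![0, 1]
  have he₀ : ‖e₀‖ ≤ 1 := (pi_norm_le_iff_of_nonneg zero_le_one).2 fun i => by
    fin_cases i <;> simp [e₀]
  -- G is the expected limit. The difference ν - G solves a Volterra equation with the same kernel,
  -- and its inhomogeneity `fζ` is shown to be small uniformly in x.
  set G : ℝ → Fin 2 → ℂ := fun x => g x • e₁ with hG
  have hGn : ∀ x, ‖G x‖ ≤ 1 := fun x => (pi_norm_le_iff_of_nonneg zero_le_one).2 fun i => by
    fin_cases i <;> simp [G, e₁, hgn]
  have hGc : Continuous G := hgc.smul continuous_const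
  set v : ℝ → ℂ := fun y => (u y - w) * g y with hv
  set s : ℝ → ℂ := fun y => -Complex.I * f y * g y with hs
  have hvd : ∀ y, HasDerivAt v (deriv u y * g y + (u y - w) * (-Complex.I * f y * g y)) y := by
    intro y
    have h1 : HasDerivAt u (deriv u y) y :=
      ((hP.contDiff.differentiable one_ne_zero) y).hasDerivAt
    exact (h1.sub_const w).mul (hgd y)
  have hv'c : Continuous fun y => deriv u y * g y + (u y - w) * (-Complex.I * f y * g y) := by
    have := hP.contDiff.continuous_deriv le_rfl
    fun_prop
  have hvi : IntegrableOn v (Set.Ioi x₀) := by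
    have hvc : Continuous v := by fun_prop
    refine integrableOn_Ioi_of_continuous hvc (a := 0) ?_ x₀
    refine Integrable.mono' hP.integrable_u hvc.aestronglyMeasurable
      (Eventually.of_forall fun y => ?_)
    have h1 : 1 ≤ (1 + |y|) ^ 2 := one_le_pow₀ (by linarith [abs_nonneg y])
    rw [hv, norm_mul, hgn, mul_one]
    nlinarith [norm_nonneg (u y - w)]
  have hsc : Continuous s := by fun_prop
  have hsi : ∀ x, IntegrableOn s (Set.Ioi x) := fun x => by
    refine Integrable.mono' (hP.integrableOn_f x).norm hsc.aestronglyMeasurable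
      (Eventually.of_forall fun y => ?_)
    simp [hs, hgn]
  have hsint : ∀ x, ∫ y in Set.Ioi x, s y = 1 - g x := fun x =>
    integral_Ioi_of_hasDerivAt_of_tendsto' (fun y _ => hgd y) (hsi x) hP.tendsto_gauge
  -- The second component s equals g', so its integral 1 - g(x) cancels in `fζ`. The first component
  -- meets the factor e^{2iλ(y-x)} and is left to Riemann-Lebesgue.
  have hpot : ∀ y, potOp w u f y (G y) = v y • e₀ + s y • e₁ := by
    intro y
    ext i
    fin_cases i
    · simp [potOp, G, v, s, e₀, e₁, Matrix.vecHead]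
    · simp [potOp, G, v, s, e₀, e₁, Matrix.vecHead, Matrix.vecTail]
      ring
  obtain ⟨M, hM0, hM⟩ := exists_norm_bgKer_le P w
  set h : ℝ → ℝ := fun y => M * ‖potOp w u f y‖ with hh
  have hpc := hP.continuous_potOp
  have hhc : Continuous h := by fun_prop
  have hh0 : ∀ y, 0 ≤ h y := fun y => by positivity
  have hhi : ∀ x, IntegrableOn h (Set.Ioi x) := fun x => (hP.integrableOn x).const_mul M
  set I₀ := ∫ y in Set.Ioi x₀, ‖potOp w u f y‖ with hI₀
  have hI₀0 : 0 ≤ I₀ := integral_nonneg fun _ => norm_nonneg _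
  set ρ : ℂ → ℝ := fun ζ => 1 / ‖lam P ζ‖ * (P.q₀ ^ 2 * ‖matOp !![1, 0; 0, -1]‖ +
    ‖matOp !![0, w; -conj w, 0]‖) with hρ
  have hρt : Tendsto ρ (cocompact ℂ) (𝓝 0) := by
    have := (tendsto_norm_lam P).inv_tendsto_atTop.mul_const (P.q₀ ^ 2 * ‖matOp !![1, 0; 0, -1]‖ +
      ‖matOp !![0, w; -conj w, 0]‖)
    simpa [hρ, Function.comp_def] using this
  have hwt : Tendsto (fun ζ : ℂ => ‖w‖ / ‖ζ‖) (cocompact ℂ) (𝓝 0) :=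
    (tendsto_norm_cocompact_atTop (E := ℂ)).const_div_atTop _
  rw [Metric.tendsto_nhds]
  intro ε hε
  -- X is Gronwall's amplification factor. There are three error terms of size ε'; dividing by 4
  -- instead of 3 makes the final inequality strict.
  set X := Real.exp (∫ y in Set.Ioi x₀, h y) with hX
  have hX0 : 0 < X := Real.exp_pos _
  set ε' := ε / (4 * X) with hε'
  have hε'0 : 0 < ε' := by positivity
  obtain ⟨R, hR⟩ := riemannLebesgue_Ioi hvd hv'c hvi hε'0
  have hev : ∀ᶠ ζ in cocompact ℂ, ρ ζ * I₀ ≤ ε' := by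
    have := hρt.mul_const I₀
    rw [zero_mul] at this
    exact this.eventually (ge_mem_nhds hε'0)
  rw [eventually_inf_principal]
  filter_upwards [hM, hev, hwt.eventually (ge_mem_nhds hε'0),
    (tendsto_norm_lam P).eventually_ge_atTop R, (tendsto_norm_lam P).eventually_ge_atTop 1,
    (tendsto_norm_cocompact_atTop (E := ℂ)).eventually_ge_atTop 1] with ζ c1 c2 c3 c4 c5 c6 hζ
  have him := lam_im_nonneg P hζ
  have hl0 : lam P ζ ≠ 0 := norm_pos_iff.1 (by linarith)
  have hV := (hν ζ hζ).isVolterra hP hζ x₀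
  have hK : IsKernelBound x₀ (fun x y => bgKer P w (y - x) ζ * potOp w u f y) h := by
    refine ⟨fun x => ((continuous_bgKer ζ).comp (continuous_id.sub continuous_const)).mul
      hP.continuous_potOp, fun x' y _ hy => (norm_mul_le _ _).trans ?_⟩
    exact mul_le_mul_of_nonneg_right (c1 hζ _ (by linarith)) (norm_nonneg _)
  obtain ⟨B, hB⟩ := hV.bdd
  set T : (Fin 2 → ℂ) →L[ℂ] (Fin 2 → ℂ) := (Complex.I * ((P.q₀ : ℂ) ^ 2 / ζ)) •
    matOp !![1, 0; 0, -1] + matOp !![0, w; -conj w, 0] with hT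
  have hTn : ‖T‖ ≤ P.q₀ ^ 2 * ‖matOp !![1, 0; 0, -1]‖ + ‖matOp !![0, w; -conj w, 0]‖ := by
    refine (norm_add_le _ _).trans (add_le_add ?_ le_rfl)
    rw [norm_smul, norm_mul, norm_div, norm_pow, Complex.norm_I, one_mul, Complex.norm_real,
      Real.norm_of_nonneg P.q₀_pos.le]
    refine mul_le_mul_of_nonneg_right (div_le_self (by positivity) c6) (norm_nonneg _)
  set fζ : ℝ → Fin 2 → ℂ := fun x => bgVec w ζ - G x -
    ∫ y in Set.Ioi x, (bgKer P w (y - x) ζ * potOp w u f y) (G y) with hfζ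
  have hD : IsVolterra x₀ (fun x y => bgKer P w (y - x) ζ * potOp w u f y) fζ
      (fun x => ν ζ x - G x) := by
    refine ⟨hV.cont.sub hGc.continuousOn, ⟨B + 1, fun x hx =>
      (norm_sub_le _ _).trans (add_le_add (hB x hx) (hGn x))⟩, fun x hx => ?_⟩
    have i1 := hK.integrableOn (hhi x₀) hV.cont hB hx
    have i2 := hK.integrableOn (hhi x₀) hGc.continuousOn (fun y _ => hGn y) hx
    simp only [map_sub]
    rw [integral_sub i1 i2, hfζ]
    nth_rewrite 1 [hV.eq x hx]
    have aux : ∀ b n g k : Fin 2 → ℂ, b - n - g = b - g - k - (n - k) := by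
      intros
      abel
    exact aux _ _ _ _
  have hfb : ∀ x, x₀ ≤ x → ‖fζ x‖ ≤ ε' + ε' + ε' := by
    intro x hx
    have hEi : IntegrableOn (fun y : ℝ =>
        Complex.exp (Complex.I * (2 * lam P ζ * (y - x : ℝ))) * v y) (Set.Ioi x) := by
      refine Integrable.mono (hvi.mono_set (Set.Ioi_subset_Ioi hx))
        (Continuous.aestronglyMeasurable (by fun_prop)) ?_
      refine (ae_restrict_iff' measurableSet_Ioi).2 (Eventually.of_forall fun y hy => ?_)
      rw [norm_mul]
      exact mul_le_of_le_one_left (norm_nonneg _) (norm_exp_I_mul_le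
        (im_two_mul_mul_nonneg him (sub_nonneg.2 (le_of_lt hy))))
    have hker : ∀ y, (bgKer P w (y - x) ζ * potOp w u f y) (G y) =
        (Complex.exp (Complex.I * (2 * lam P ζ * (y - x : ℝ))) * v y) • e₀ + s y • e₁ -
          expInt (y - x) (lam P ζ) • T (potOp w u f y (G y)) := by
      intro y
      have h1 := congrArg (fun S => S (potOp w u f y (G y)))
        (diag_sub_bgKer (P := P) (w := w) (ζ := ζ) (y - x))
      rw [_root_.sub_apply, _root_.smul_apply] at h1
      rw [mul_apply_eq_comp, hT, ← h1, hpot y]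
      refine (sub_sub_cancel _ _).symm.trans (congrArg₂ _ ?_ rfl)
      ext i
      fin_cases i
      · simp [e₀, e₁]
        ring
      · simp [e₀, e₁]
    have hbd : ∀ y, x < y → ‖expInt (y - x) (lam P ζ) • T (potOp w u f y (G y))‖ ≤
        ρ ζ * ‖potOp w u f y‖ := by
      intro y hy
      rw [norm_smul, hρ]
      have k1 := norm_expInt_le_inv hl0 him (sub_nonneg.2 hy.le)
      have k2 : ‖T (potOp w u f y (G y))‖ ≤ (P.q₀ ^ 2 * ‖matOp !![1, 0; 0, -1]‖ +
          ‖matOp !![0, w; -conj w, 0]‖) * ‖potOp w u f y‖ := by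
        refine (T.le_opNorm _).trans (mul_le_mul hTn ?_ (norm_nonneg _) (by positivity))
        exact ((potOp w u f y).le_opNorm _).trans
          (mul_le_of_le_one_right (norm_nonneg _) (hGn y))
      calc _ ≤ 1 / ‖lam P ζ‖ * ((P.q₀ ^ 2 * ‖matOp !![1, 0; 0, -1]‖ +
          ‖matOp !![0, w; -conj w, 0]‖) * ‖potOp w u f y‖) :=
            mul_le_mul k1 k2 (norm_nonneg _) (by positivity)
        _ = _ := by ring
    have i1 := hK.integrableOn (hhi x₀) hGc.continuousOn (fun y _ => hGn y) hx
    have i2 : IntegrableOn (fun y : ℝ => (Complex.exp (Complex.I * (2 * lam P ζ * (y - x : ℝ)))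
        * v y) • e₀ + s y • e₁) (Set.Ioi x) :=
      (hEi.smul_const e₀).add ((hsi x).smul_const e₁)
    have i3 : IntegrableOn (fun y => expInt (y - x) (lam P ζ) • T (potOp w u f y (G y)))
        (Set.Ioi x) := by
      refine (i2.sub i1).congr_fun (fun y _ => ?_) measurableSet_Ioi
      simp only [Pi.sub_apply, hker y, sub_sub_cancel]
    have hI := integral_congr_ae (μ := volume.restrict (Set.Ioi x)) (Eventually.of_forall hker)
    rw [integral_sub i2 i3, integral_add (hEi.smul_const e₀) ((hsi x).smul_const e₁),
      integral_smul_const, integral_smul_const, hsint] at hI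
    have hfe : fζ x = (-Complex.I * w / ζ) • e₀ - (∫ y in Set.Ioi x,
        Complex.exp (Complex.I * (2 * lam P ζ * (y - x : ℝ))) * v y) • e₀ +
        ∫ y in Set.Ioi x, expInt (y - x) (lam P ζ) • T (potOp w u f y (G y)) := by
      have hb : bgVec w ζ = (-Complex.I * w / ζ) • e₀ + e₁ := by
        ext i
        fin_cases i <;> simp [bgVec, e₀, e₁]
      rw [hfζ]
      have aux : ∀ (a g k : ℂ) (d : Fin 2 → ℂ), a • e₀ + e₁ - g • e₁ -
          (k • e₀ + (1 - g) • e₁ - d) = a • e₀ - k • e₀ + d := by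
        intros
        module
      change bgVec w ζ - G x - _ = _
      rw [hI, hb]
      exact aux _ _ _ _
    rw [hfe]
    refine (norm_add_le _ _).trans (add_le_add ((norm_sub_le _ _).trans (add_le_add ?_ ?_)) ?_)
    · rw [norm_smul]
      refine (mul_le_of_le_one_right (norm_nonneg _) he₀).trans ?_
      simpa using c3
    · rw [norm_smul]
      exact (mul_le_of_le_one_right (norm_nonneg _) he₀).trans (hR _ him c4 x hx)
    · refine le_trans ?_ c2
      refine (norm_integral_le_of_norm_le (((hP.integrableOn x).const_mul (ρ ζ)))
        ((ae_restrict_iff' measurableSet_Ioi).2 (Eventually.of_forall hbd))).trans ?_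
      rw [integral_const_mul]
      refine mul_le_mul_of_nonneg_left ?_ (by positivity)
      exact setIntegral_mono_set (hP.integrableOn x₀) (Eventually.of_forall fun _ => norm_nonneg _)
        (Set.Ioi_subset_Ioi hx).eventuallyLE
  have := hD.norm_le hK hhc hh0 (hhi x₀) hfb (le_refl x₀)
  have e : G x₀ = ![0, g x₀] := by simp [G, e₁]
  rw [dist_eq_norm, ← e]
  refine this.trans_lt ?_
  rw [← hX, hε']
  field_simp
  norm_num

end Infinity

/-! ### Vectors in `ℂ²` -/

theorem hasDerivAt_vec2 {a b : ℝ → ℂ} {a' b' : ℂ} {x : ℝ} (ha : HasDerivAt a a' x)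
    (hb : HasDerivAt b b' x) : HasDerivAt (fun x => ![a x, b x]) ![a', b'] x := by
  rw [hasDerivAt_pi]
  intro i
  fin_cases i
  · exact ha
  · exact hb

/-- The determinant of two columns. -/
def det2 (v w : Fin 2 → ℂ) : ℂ := v 0 * w 1 - v 1 * w 0

/-- The antilinear map `(a, b) ↦ (b̄, -ā)`. -/
def dual (v : Fin 2 → ℂ) : Fin 2 → ℂ := ![conj (v 1), -conj (v 0)]

@[simp] theorem dual_zero (v : Fin 2 → ℂ) : dual v 0 = conj (v 1) := rfl

@[simp] theorem dual_one (v : Fin 2 → ℂ) : dual v 1 = -conj (v 0) := rfl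

/-- The linear relation between three vectors of the plane (Cramer's rule); it expands m in the
basis formed by n and the dual column. -/
theorem det2_smul_eq (u v w : Fin 2 → ℂ) : det2 u w • v = det2 v w • u + det2 u v • w := by
  ext i
  fin_cases i <;> simp [det2] <;> ring

theorem hasDerivAt_det2 {v w : ℝ → Fin 2 → ℂ} {v' w' : Fin 2 → ℂ} {x : ℝ}
    (hv : HasDerivAt v v' x) (hw : HasDerivAt w w' x) :
    HasDerivAt (fun x => det2 (v x) (w x)) (det2 v' (w x) + det2 (v x) w') x := by
  rw [hasDerivAt_pi] at hv hw
  refine (((hv 0).mul (hw 1)).sub ((hv 1).mul (hw 0))).congr_deriv ?_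
  simp only [det2]
  ring

theorem continuous_det2 : Continuous fun p : (Fin 2 → ℂ) × (Fin 2 → ℂ) => det2 p.1 p.2 := by
  unfold det2
  fun_prop

theorem continuous_dual : Continuous dual := by
  refine continuous_pi fun i => ?_
  fin_cases i
  · exact Complex.continuous_conj.comp (continuous_apply 1)
  · exact (Complex.continuous_conj.comp (continuous_apply 0)).neg

theorem eq_of_hasDerivAt_zero {g : ℝ → ℂ} (h : ∀ x, HasDerivAt g 0 x) (x y : ℝ) : g x = g y :=
  is_const_of_deriv_eq_zero (fun x => (h x).differentiableAt) (fun x => (h x).deriv) x y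

theorem eq_limit_of_hasDerivAt_zero {g : ℝ → ℂ} (h : ∀ x, HasDerivAt g 0 x) {l : Filter ℝ}
    [l.NeBot] {c : ℂ} (hl : Tendsto g l (𝓝 c)) (x : ℝ) : g x = c := by
  have e : g = fun _ => g x := funext fun y => eq_of_hasDerivAt_zero h y x
  rw [e] at hl
  exact tendsto_nhds_unique tendsto_const_nhds hl

/-! ### Symmetries of the spectral sets -/

section Sets

variable {P : Params}

theorem conj_mem_Sig {ζ : ℂ} (h : ζ ∈ Sig P) : conj ζ ∈ Sig P := by
  obtain ⟨h1, h2, h3, h4⟩ := h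
  refine ⟨?_, ?_, fun h => h4 ?_, fun h => h3 ?_⟩
  · simpa using h1
  · simpa using h2
  · rw [← Complex.conj_conj ζ, h]
    simp
  · rw [← Complex.conj_conj ζ, h]
    simp

theorem tau_mem_S₁ {ζ : ℂ} (h : ζ ∈ S₁ P) : -(P.q₀ : ℂ) ^ 2 / conj ζ ∈ S₁ P := by
  have hq := P.q₀_ne
  rw [mem_S₁_iff] at h ⊢
  obtain ⟨h0, h1, h2, h3⟩ := h
  have hc0 : conj ζ ≠ 0 := by simpa using h0
  have key : ∀ s : ℂ, conj s = -s → s ^ 2 = -(P.q₀ : ℂ) ^ 2 → s ≠ 0 →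
      -(P.q₀ : ℂ) ^ 2 / conj ζ = s → ζ = -s := by
    intro s hs hs2 hs0 he
    rw [div_eq_iff hc0, ← hs2, sq] at he
    have := mul_left_cancel₀ hs0 he
    rw [← Complex.conj_conj ζ, ← this, hs]
  have hI0 : Complex.I * (P.q₀ : ℂ) ≠ 0 := mul_ne_zero Complex.I_ne_zero hq
  refine ⟨div_ne_zero (by simpa using hq) hc0, fun h => h2 ?_, fun h => h1 ?_, ?_⟩
  · exact key _ (by simp) (by rw [mul_pow, Complex.I_sq]; ring) hI0 h
  · have := key _ (by simp) (by rw [neg_sq, mul_pow, Complex.I_sq]; ring) (neg_ne_zero.2 hI0) h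
    rwa [neg_neg] at this
  · have hn : 0 < ‖ζ‖ := norm_pos_iff.2 h0
    have e1 : ‖-(P.q₀ : ℂ) ^ 2 / conj ζ‖ = P.q₀ ^ 2 / ‖ζ‖ := by
      rw [norm_div, norm_neg, norm_pow, Complex.norm_real, Real.norm_of_nonneg P.q₀_pos.le,
        Complex.norm_conj]
    have e2 : (-(P.q₀ : ℂ) ^ 2 / conj ζ).im = -(P.q₀ ^ 2 * ζ.im / ‖ζ‖ ^ 2) := by
      rw [← Complex.normSq_eq_norm_sq, show -(P.q₀ : ℂ) ^ 2 / conj ζ =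
        ((-P.q₀ ^ 2 : ℝ) : ℂ) * (conj ζ)⁻¹ by push_cast; ring, Complex.im_ofReal_mul,
        Complex.inv_im, Complex.normSq_conj, Complex.conj_im]
      ring
    rw [e1, e2]
    have : ((P.q₀ ^ 2 / ‖ζ‖) ^ 2 - P.q₀ ^ 2) * -(P.q₀ ^ 2 * ζ.im / ‖ζ‖ ^ 2) =
        P.q₀ ^ 4 / ‖ζ‖ ^ 4 * ((‖ζ‖ ^ 2 - P.q₀ ^ 2) * ζ.im) := by
      field_simp
      ring
    rw [this]
    positivity

theorem tau_tau {ζ : ℂ} (h : ζ ≠ 0) :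
    -(P.q₀ : ℂ) ^ 2 / conj (-(P.q₀ : ℂ) ^ 2 / conj ζ) = ζ := by
  have := P.q₀_ne
  simp only [map_div₀, map_neg, map_pow, Complex.conj_ofReal, Complex.conj_conj]
  field_simp

theorem one_add_ne_zero {ζ : ℂ} (h : ζ ∈ S₁ P) : 1 + (P.q₀ : ℂ) ^ 2 / ζ ^ 2 ≠ 0 := by
  have h0 := ne_zero_of_mem_S₁ P h
  have hl := lam_ne_zero P h0 (ne_branch_of_mem_S₁ P h).1 (ne_branch_of_mem_S₁ P h).2
  intro h'
  refine hl ?_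
  have : lam P ζ = ζ / 2 * (1 + (P.q₀ : ℂ) ^ 2 / ζ ^ 2) := by
    simp only [lam]
    field_simp
  rw [this, h', mul_zero]

end Sets

/-! ### Symmetries of a Jost column -/

section Column

variable {P : Params} {w : ℂ} {u : ℝ → ℂ} {f : ℝ → ℝ}

theorem IsJostColumn.hasDerivAt_zero {ζ : ℂ} {ν : ℝ → Fin 2 → ℂ}
    (h : IsJostColumn P w u f ζ ν) (x : ℝ) : HasDerivAt (fun x => ν x 0)
      ((Complex.I * f x - Complex.I * ζ) * ν x 0 + u x * ν x 1) x :=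
  hasDerivAt_pi.1 (h.ode x) 0

theorem IsJostColumn.hasDerivAt_one {ζ : ℂ} {ν : ℝ → Fin 2 → ℂ}
    (h : IsJostColumn P w u f ζ ν) (x : ℝ) : HasDerivAt (fun x => ν x 1)
      (-conj (u x) * ν x 0 + (-Complex.I * f x - Complex.I * ((P.q₀ : ℂ) ^ 2 / ζ)) * ν x 1) x :=
  hasDerivAt_pi.1 (h.ode x) 1

/-- The map `dual` preserves the off-diagonal part of the equation and turns q₀²/ζ into the role of
-ζ, up to conjugation. The scalar restores the second entry 1 at infinity. -/
theorem IsJostColumn.tau (hw : conj w * w = (P.q₀ : ℂ) ^ 2) {ζ : ℂ} (h0 : ζ ≠ 0)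
    {ν : ℝ → Fin 2 → ℂ} (h : IsJostColumn P w u f ζ ν) :
    IsJostColumn P w u f (-(P.q₀ : ℂ) ^ 2 / conj ζ)
      (fun x => (-(conj ζ) / (Complex.I * conj w)) • dual (ν x)) := by
  have hq := P.q₀_ne
  have hc0 : conj ζ ≠ 0 := by simpa using h0
  have hw0 : conj w ≠ 0 := fun e => hq (by simpa [e] using hw.symm)
  constructor
  · intro x
    have h1 := ((h.hasDerivAt_one x).star)
    have h2 := ((h.hasDerivAt_zero x).star).neg
    refine ((hasDerivAt_vec2 h1 h2).const_smul (-(conj ζ) / (Complex.I * conj w))).congr_deriv ?_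
    ext i
    fin_cases i
    · simp
      field_simp
      try ring
    · simp
      field_simp
      try ring
  · have h1 := ((continuous_dual.tendsto _).comp h.lim).const_smul
      (-(conj ζ) / (Complex.I * conj w))
    have e : (-(conj ζ) / (Complex.I * conj w)) • dual ![-Complex.I * w / ζ, 1] =
        ![-Complex.I * w / (-(P.q₀ : ℂ) ^ 2 / conj ζ), 1] := by
      have : w ≠ 0 := by simpa using hw0
      ext i
      fin_cases i
      · simp
        rw [← hw]
        field_simp
        rw [Complex.I_sq]
      · simp
        field_simp
    rw [← e]
    exact h1

/-- The dual of ν' solves the equation of the first Jost column at ζ. Its exponential rate cancels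
that of ν, so the determinant is constant and equals its limit at +∞. -/
theorem IsJostColumn.wronskian {ζ : ℂ} (h0 : ζ ≠ 0) (hw : conj w * w = (P.q₀ : ℂ) ^ 2)
    {ν ν' : ℝ → Fin 2 → ℂ} (h : IsJostColumn P w u f ζ ν) (h' : IsJostColumn P w u f (conj ζ) ν')
    (x : ℝ) : det2 (dual (ν' x)) (ν x) = 1 + (P.q₀ : ℂ) ^ 2 / ζ ^ 2 := by
  have hd : ∀ x, HasDerivAt (fun x => det2 (dual (ν' x)) (ν x)) 0 x := by
    intro x
    refine (hasDerivAt_det2 (hasDerivAt_vec2 (h'.hasDerivAt_one x).star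
      (h'.hasDerivAt_zero x).star.neg) (h.ode x)).congr_deriv ?_
    simp [det2]
    ring
  have hl := (continuous_det2.tendsto _).comp
    (((continuous_dual.tendsto _).comp h'.lim).prodMk_nhds h.lim)
  rw [eq_limit_of_hasDerivAt_zero hd hl x]
  simp [det2]
  rw [← hw]
  field_simp
  rw [Complex.I_sq]
  ring

/-- Turns a first column at ζ into a second column at ζ̄, so that uniqueness of second columns also
identifies ψ₊₁. -/
theorem IsJostColumn.of_dual {ζ : ℂ} {φ : ℝ → Fin 2 → ℂ}
    (hd : ∀ x, HasDerivAt φ ![(Complex.I * f x + Complex.I * ((P.q₀ : ℂ) ^ 2 / ζ)) * φ x 0 +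
      u x * φ x 1, -conj (u x) * φ x 0 + (-Complex.I * f x + Complex.I * ζ) * φ x 1] x)
    (hl : Tendsto φ atTop (𝓝 ![1, -Complex.I * conj w / ζ])) :
    IsJostColumn P w u f (conj ζ) (fun x => -dual (φ x)) := by
  constructor
  · intro x
    have h := hasDerivAt_pi.1 (hd x)
    refine (hasDerivAt_vec2 (h 1).star (h 0).star.neg).neg.congr_deriv ?_
    ext i
    fin_cases i
    · simp [-mul_eq_mul_left_iff, -mul_eq_mul_right_iff]
      ring
    · simp
      ring
  · have h1 := ((continuous_dual.tendsto _).comp hl).neg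
    have e : -dual ![1, -Complex.I * conj w / ζ] = ![-Complex.I * w / conj ζ, 1] := by
      ext i
      fin_cases i
      · simp
        ring
      · simp
    rw [← e]
    exact h1

end Column

/-! ### The two sided scattering problem at a fixed time -/

/-- The exchange of the two components. -/
def swap (v : Fin 2 → ℂ) : Fin 2 → ℂ := ![v 1, v 0]

@[simp] theorem swap_zero (v : Fin 2 → ℂ) : swap v 0 = v 1 := rfl

@[simp] theorem swap_one (v : Fin 2 → ℂ) : swap v 1 = v 0 := rfl

theorem swap_swap (v : Fin 2 → ℂ) : swap (swap v) = v := by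
  ext i
  fin_cases i <;> simp

theorem continuous_swap : Continuous swap := by
  refine continuous_pi fun i => ?_
  fin_cases i
  · exact continuous_apply 1
  · exact continuous_apply 0

/-- The normalized Jost columns `n = e^{-iΘ}ψ₊₂` and `m = e^{iΘ}ψ₋₁` of a reflectionless potential
at a fixed time. -/
structure IsJostPair (P : Params) (u : ℝ → ℂ) (f : ℝ → ℝ) (n m : ℂ → ℝ → Fin 2 → ℂ) : Prop where
  pot_p : IsPotential P P.qp u f
  -- Reflection of x, conjugation of u and exchange of the components turn the column at -∞ into a
  -- column at +∞; the one sided theory then covers both ends.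
  pot_m : IsPotential P (conj P.qm) (fun x => conj (u (-x))) (fun x => f (-x))
  col_p : ∀ ζ ∈ S₁ P, IsJostColumn P P.qp u f ζ (n ζ)
  col_m : ∀ ζ ∈ S₁ P, IsJostColumn P (conj P.qm) (fun x => conj (u (-x))) (fun x => f (-x)) ζ
    (fun x => swap (m ζ (-x)))
  reflectionless : ∀ ζ ∈ Sig P, ∀ x, det2 (dual (n (conj ζ) x)) (m ζ x) = 0

theorem conj_qp_mul_qp (P : Params) : conj P.qp * P.qp = (P.q₀ : ℂ) ^ 2 := by
  rw [← Complex.normSq_eq_conj_mul_self, Complex.normSq_eq_norm_sq, Params.qp, norm_mul,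
    mul_comm Complex.I, Complex.norm_exp_ofReal_mul_I, Complex.norm_real,
    Real.norm_of_nonneg P.q₀_pos.le, mul_one]
  push_cast
  rfl

theorem conj_qm_mul_qm (P : Params) : conj P.qm * P.qm = (P.q₀ : ℂ) ^ 2 := by
  rw [← Complex.normSq_eq_conj_mul_self, Complex.normSq_eq_norm_sq, Params.qm, norm_mul,
    mul_comm Complex.I, Complex.norm_exp_ofReal_mul_I, Complex.norm_real,
    Real.norm_of_nonneg P.q₀_pos.le, mul_one]
  push_cast
  rfl

theorem Params.qp_ne (P : Params) : P.qp ≠ 0 := fun e => P.q₀_ne (by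
  simpa [e] using (conj_qp_mul_qp P).symm)

theorem Params.qm_ne (P : Params) : P.qm ≠ 0 := fun e => P.q₀_ne (by
  simpa [e] using (conj_qm_mul_qm P).symm)

/-- The scattering coefficient of a pair of Jost columns. -/
def coefA (P : Params) (n m : ℂ → ℝ → Fin 2 → ℂ) (x : ℝ) (ζ : ℂ) : ℂ :=
  det2 (m ζ x) (n ζ x) / (1 + (P.q₀ : ℂ) ^ 2 / ζ ^ 2)

section Pair

variable {P : Params} {u : ℝ → ℂ} {f : ℝ → ℝ} {n m : ℂ → ℝ → Fin 2 → ℂ}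

theorem IsJostPair.hasDerivAt_m (h : IsJostPair P u f n m) {ζ : ℂ} (hζ : ζ ∈ S₁ P) (x : ℝ) :
    HasDerivAt (m ζ) ![(Complex.I * f x + Complex.I * ((P.q₀ : ℂ) ^ 2 / ζ)) * m ζ x 0 +
      u x * m ζ x 1, -conj (u x) * m ζ x 0 + (-Complex.I * f x + Complex.I * ζ) * m ζ x 1] x := by
  have hc := h.col_m ζ hζ
  have h0 := (hc.hasDerivAt_zero (-x)).scomp x (hasDerivAt_neg x)
  have h1 := (hc.hasDerivAt_one (-x)).scomp x (hasDerivAt_neg x)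
  have e : m ζ = fun x => ![m ζ x 0, m ζ x 1] := by
    ext x i
    fin_cases i <;> rfl
  simp only [Function.comp_def, neg_neg, swap_zero, swap_one] at h0 h1
  rw [e]
  refine (hasDerivAt_vec2 h1 h0).congr_deriv ?_
  ext i
  fin_cases i
  · simp
    ring
  · simp
    ring

theorem IsJostPair.det_eq (h : IsJostPair P u f n m) {ζ : ℂ} (hζ : ζ ∈ S₁ P) (x y : ℝ) :
    det2 (m ζ x) (n ζ x) = det2 (m ζ y) (n ζ y) := by
  refine eq_of_hasDerivAt_zero (g := fun x => det2 (m ζ x) (n ζ x)) (fun x => ?_) x y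
  refine (hasDerivAt_det2 (h.hasDerivAt_m hζ x) ((h.col_p ζ hζ).ode x)).congr_deriv ?_
  simp [det2]
  ring

theorem IsJostPair.coefA_eq (h : IsJostPair P u f n m) {ζ : ℂ} (hζ : ζ ∈ S₁ P) (x y : ℝ) :
    coefA P n m x ζ = coefA P n m y ζ := by
  rw [coefA, h.det_eq hζ x y, coefA]

theorem IsJostPair.n_tau (h : IsJostPair P u f n m) {ζ : ℂ} (hζ : ζ ∈ S₁ P) (x : ℝ) :
    n (-(P.q₀ : ℂ) ^ 2 / conj ζ) x = (-(conj ζ) / (Complex.I * conj P.qp)) • dual (n ζ x) :=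
  IsJostColumn.unique h.pot_p (tau_mem_S₁ hζ) (h.col_p _ (tau_mem_S₁ hζ))
    ((h.col_p ζ hζ).tau h.pot_p.norm_eq (ne_zero_of_mem_S₁ P hζ)) x

theorem dual_swap (v : Fin 2 → ℂ) : dual (swap v) = -swap (dual v) := by
  ext i
  fin_cases i <;> simp

theorem dual_smul (c : ℂ) (v : Fin 2 → ℂ) : dual (c • v) = conj c • dual v := by
  ext i
  fin_cases i <;> simp

theorem IsJostPair.m_tau (h : IsJostPair P u f n m) {ζ : ℂ} (hζ : ζ ∈ S₁ P) (x : ℝ) :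
    m (-(P.q₀ : ℂ) ^ 2 / conj ζ) x = (conj ζ / (Complex.I * P.qm)) • dual (m ζ x) := by
  have e := IsJostColumn.unique h.pot_m (tau_mem_S₁ hζ) (h.col_m _ (tau_mem_S₁ hζ))
    ((h.col_m ζ hζ).tau h.pot_m.norm_eq (ne_zero_of_mem_S₁ P hζ)) (-x)
  simp only [neg_neg] at e
  rw [← swap_swap (m _ x), e, dual_swap]
  ext i
  fin_cases i
  · simp
    ring
  · simp
    ring

theorem IsJostPair.coefA_tau (h : IsJostPair P u f n m) {ζ : ℂ} (hζ : ζ ∈ S₁ P) (x : ℝ) :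
    coefA P n m x (-(P.q₀ : ℂ) ^ 2 / conj ζ) = P.qp / P.qm * conj (coefA P n m x ζ) := by
  have hp := conj_qp_mul_qp P
  have hp0 := P.qp_ne
  have hm0 := P.qm_ne
  have hq0 := P.q₀_ne
  have h0 := ne_zero_of_mem_S₁ P hζ
  have hc0 : conj ζ ≠ 0 := by simpa using h0
  have hcp0 : conj P.qp ≠ 0 := by simpa using hp0
  have hd : conj (1 + (P.q₀ : ℂ) ^ 2 / ζ ^ 2) ≠ 0 := by
    simpa only [ne_eq, map_eq_zero] using one_add_ne_zero hζ
  have e1 : det2 (m (-(P.q₀ : ℂ) ^ 2 / conj ζ) x) (n (-(P.q₀ : ℂ) ^ 2 / conj ζ) x) =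
      conj ζ ^ 2 / (conj P.qp * P.qm) * conj (det2 (m ζ x) (n ζ x)) := by
    rw [h.n_tau hζ, h.m_tau hζ]
    simp [det2]
    field_simp
    rw [Complex.I_sq]
    ring
  have e2 : 1 + (P.q₀ : ℂ) ^ 2 / (-(P.q₀ : ℂ) ^ 2 / conj ζ) ^ 2 =
      conj ζ ^ 2 / (P.q₀ : ℂ) ^ 2 * conj (1 + (P.q₀ : ℂ) ^ 2 / ζ ^ 2) := by
    simp
    field_simp
    ring
  rw [coefA, coefA, e1, e2, map_div₀]
  rw [← hp]
  field_simp

/-- The jump relation on Σ: with b = 0 it says that m/a and the dual of n(ζ̄) agree there. -/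
theorem IsJostPair.m_eq_smul (h : IsJostPair P u f n m) {ζ : ℂ} (hζ : ζ ∈ Sig P) (x : ℝ) :
    m ζ x = coefA P n m x ζ • dual (n (conj ζ) x) := by
  have h1 : ζ ∈ S₁ P := Or.inl hζ
  have hw := (h.col_p ζ h1).wronskian (ne_zero_of_mem_S₁ P h1) h.pot_p.norm_eq
    (h.col_p _ (Or.inl (conj_mem_Sig hζ))) x
  have e := det2_smul_eq (dual (n (conj ζ) x)) (m ζ x) (n ζ x)
  rw [hw, h.reflectionless ζ hζ x, zero_smul, add_zero] at e
  rw [coefA, div_eq_inv_mul, mul_smul, ← e, smul_smul, inv_mul_cancel₀ (one_add_ne_zero h1),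
    one_smul]

/-- The reflectionless form of the unitarity relation, obtained by comparing the Wronskians at the
two ends. It excludes zeros of a on Σ. -/
theorem IsJostPair.coefA_mul_conj (h : IsJostPair P u f n m) {ζ : ℂ} (hζ : ζ ∈ Sig P) (x : ℝ) :
    coefA P n m x ζ * conj (coefA P n m x (conj ζ)) = 1 := by
  have h1 : ζ ∈ S₁ P := Or.inl hζ
  have h2 : conj ζ ∈ S₁ P := Or.inl (conj_mem_Sig hζ)
  have w1 := (h.col_p ζ h1).wronskian (ne_zero_of_mem_S₁ P h1) h.pot_p.norm_eq (h.col_p _ h2) x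
  have w2 := (h.col_m ζ h1).wronskian (ne_zero_of_mem_S₁ P h1) h.pot_m.norm_eq
    (h.col_m _ h2) (-x)
  simp only [neg_neg] at w2
  rw [h.m_eq_smul hζ, h.m_eq_smul (conj_mem_Sig hζ), Complex.conj_conj] at w2
  have e : det2 (dual (swap (coefA P n m x (conj ζ) • dual (n ζ x))))
      (swap (coefA P n m x ζ • dual (n (conj ζ) x))) =
      coefA P n m x ζ * conj (coefA P n m x (conj ζ)) * det2 (dual (n (conj ζ) x)) (n ζ x) := by
    simp [det2]
    ring
  rw [e, w1] at w2
  exact mul_right_cancel₀ (one_add_ne_zero h1) (w2.trans (one_mul _).symm)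

theorem IsJostPair.coefA_ne_zero (h : IsJostPair P u f n m) {ζ : ℂ} (hζ : ζ ∈ Sig P) (x : ℝ) :
    coefA P n m x ζ ≠ 0 := left_ne_zero_of_mul_eq_one (h.coefA_mul_conj hζ x)

/-! ### Regularity of the pair -/

theorem IsJostPair.n_differentiableWithinAt (h : IsJostPair P u f n m) {ζ₀ : ℂ} (hζ₀ : ζ₀ ∈ S₁ P)
    (x : ℝ) : DifferentiableWithinAt ℂ (fun ζ => n ζ x) (S₁ P) ζ₀ :=
  jost_differentiableWithinAt h.pot_p h.col_p hζ₀ x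

theorem differentiableWithinAt_swap {g : ℂ → Fin 2 → ℂ} {s : Set ℂ} {ζ : ℂ}
    (h : DifferentiableWithinAt ℂ (fun ζ => swap (g ζ)) s ζ) : DifferentiableWithinAt ℂ g s ζ := by
  rw [differentiableWithinAt_pi] at h ⊢
  intro i
  fin_cases i
  · exact h 1
  · exact h 0

theorem IsJostPair.m_differentiableWithinAt (h : IsJostPair P u f n m) {ζ₀ : ℂ} (hζ₀ : ζ₀ ∈ S₁ P)
    (x : ℝ) : DifferentiableWithinAt ℂ (fun ζ => m ζ x) (S₁ P) ζ₀ := by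
  have := jost_differentiableWithinAt h.pot_m (ν := fun ζ x => swap (m ζ (-x))) h.col_m hζ₀ (-x)
  simp only [neg_neg] at this
  exact differentiableWithinAt_swap this

theorem IsJostPair.coefA_differentiableWithinAt (h : IsJostPair P u f n m) {ζ₀ : ℂ}
    (hζ₀ : ζ₀ ∈ S₁ P) (x : ℝ) : DifferentiableWithinAt ℂ (coefA P n m x) (S₁ P) ζ₀ := by
  have hn := differentiableWithinAt_pi.1 (h.n_differentiableWithinAt hζ₀ x)
  have hm := differentiableWithinAt_pi.1 (h.m_differentiableWithinAt hζ₀ x)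
  have h0 := ne_zero_of_mem_S₁ P hζ₀
  have hd : DifferentiableWithinAt ℂ (fun ζ : ℂ => 1 + (P.q₀ : ℂ) ^ 2 / ζ ^ 2) (S₁ P) ζ₀ :=
    ((((differentiableAt_id.pow 2).inv (pow_ne_zero 2 h0)).const_mul
      ((P.q₀ : ℂ) ^ 2)).const_add 1).differentiableWithinAt
  exact (((hm 0).mul (hn 1)).sub ((hm 1).mul (hn 0))).div hd (one_add_ne_zero hζ₀)

theorem IsJostPair.n_tendsto_infinity (h : IsJostPair P u f n m) (x : ℝ) :
    Tendsto (fun ζ => n ζ x) (cocompact ℂ ⊓ 𝓟 (S₁ P)) (𝓝 ![0, gauge f x]) :=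
  jost_tendsto_infinity h.pot_p h.col_p x

theorem IsJostPair.m_tendsto_infinity (h : IsJostPair P u f n m) (x : ℝ) :
    ∃ g : ℂ, g ≠ 0 ∧ Tendsto (fun ζ => m ζ x) (cocompact ℂ ⊓ 𝓟 (S₁ P)) (𝓝 ![g, 0]) := by
  refine ⟨gauge (fun x => f (-x)) (-x), fun e => ?_, ?_⟩
  · have := norm_gauge (fun x => f (-x)) (-x)
    rw [e, norm_zero] at this
    exact zero_ne_one this
  · have h1 := (continuous_swap.tendsto _).comp
      (jost_tendsto_infinity h.pot_m (ν := fun ζ x => swap (m ζ (-x))) h.col_m (-x))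
    simp only [Function.comp_def, swap_swap, neg_neg] at h1
    exact h1

/-! ### The branch points -/

/-- The circle through the branch point `p`, parametrized by the angle. -/
def circ (p : ℂ) (φ : ℝ) : ℂ := p * Complex.exp (Complex.I * φ)

theorem tendsto_circ {p : ℂ} (hp : p ^ 2 = -(P.q₀ : ℂ) ^ 2) :
    Tendsto (circ p) (𝓝[≠] 0) (𝓝[S₁ P \ {p}] p) ∧ ∀ᶠ φ in 𝓝[≠] 0, circ p φ ∈ Sig P := by
  have hq := P.q₀_ne
  have hp0 : p ≠ 0 := fun e => hq (by simpa [e] using hp.symm)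
  have hpi : p = Complex.I * P.q₀ ∨ p = -(Complex.I * P.q₀) := by
    rw [← sq_eq_sq_iff_eq_or_eq_neg, hp, mul_pow, Complex.I_sq]
    ring
  have hpn : ‖p‖ = P.q₀ := by
    rcases hpi with h | h <;> simp [h, abs_of_pos P.q₀_pos]
  have hc : Continuous (circ p) := by
    unfold circ
    fun_prop
  have ht : Tendsto (circ p) (𝓝[≠] 0) (𝓝 p) := by
    have := (hc.tendsto 0).mono_left (nhdsWithin_le_nhds (s := {0}ᶜ))
    simpa [circ] using this
  have hne : ∀ᶠ φ in 𝓝[≠] (0 : ℝ), circ p φ ≠ p := by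
    have hd : HasDerivAt (circ p) (p * Complex.I) 0 := by
      have := (((Complex.ofRealCLM.hasDerivAt (x := (0 : ℝ))).const_mul Complex.I).cexp).const_mul p
      refine this.congr_deriv ?_
      simp
    have := hd.eventually_ne (c := p) (mul_ne_zero hp0 Complex.I_ne_zero)
    exact this
  have hne' : ∀ᶠ φ in 𝓝[≠] (0 : ℝ), circ p φ ≠ -p :=
    ht.eventually_ne fun e => hp0 (self_eq_neg.1 e)
  have hS : ∀ᶠ φ in 𝓝[≠] (0 : ℝ), circ p φ ∈ Sig P := by
    filter_upwards [hne, hne'] with φ h1 h2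
    refine ⟨Or.inr ?_, mul_ne_zero hp0 (Complex.exp_ne_zero _), ?_⟩
    · rw [circ, norm_mul, mul_comm Complex.I, Complex.norm_exp_ofReal_mul_I, mul_one, hpn]
    · rcases hpi with h | h
      · rw [← h]
        exact ⟨h1, h2⟩
      · rw [← h, show Complex.I * (P.q₀ : ℂ) = -p by rw [h, neg_neg]]
        exact ⟨h2, h1⟩
  refine ⟨tendsto_nhdsWithin_iff.2 ⟨ht, ?_⟩, hS⟩
  filter_upwards [hS, hne] with φ h1 h2
  exact ⟨Or.inl h1, h2⟩

theorem tau_conj_circ {p : ℂ} (hp : p ^ 2 = -(P.q₀ : ℂ) ^ 2) (hp0 : p ≠ 0) (φ : ℝ) :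
    -(P.q₀ : ℂ) ^ 2 / conj (conj (circ p φ)) = circ p (-φ) := by
  rw [Complex.conj_conj, ← hp, circ, circ, Complex.ofReal_neg, mul_neg, Complex.exp_neg]
  field_simp

/-- At the branch points the Jost columns have limits and the scattering coefficient has a nonzero
limit. -/
theorem IsJostPair.limits_branch (h : IsJostPair P u f n m) {p : ℂ} (hp : p ^ 2 = -(P.q₀ : ℂ) ^ 2)
    (x : ℝ) : ∃ (N₀ M₀ : Fin 2 → ℂ) (a₀ : ℂ), a₀ ≠ 0 ∧
      Tendsto (fun ζ => n ζ x) (𝓝[S₁ P \ {p}] p) (𝓝 N₀) ∧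
      Tendsto (fun ζ => m ζ x) (𝓝[S₁ P \ {p}] p) (𝓝 M₀) ∧
      Tendsto (coefA P n m x) (𝓝[S₁ P \ {p}] p) (𝓝 a₀) := by
  have hq := P.q₀_ne
  have hp0 : p ≠ 0 := fun e => hq (by simpa [e] using hp.symm)
  have hlam : lam P p = 0 := by
    have e : (P.q₀ : ℂ) ^ 2 = -p ^ 2 := by rw [hp, neg_neg]
    rw [lam, e]
    field_simp
    ring
  obtain ⟨hγ, hγS⟩ := tendsto_circ hp
  have : (𝓝[S₁ P \ {p}] p).NeBot := hγ.neBot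
  obtain ⟨N₀, N₁, hN₀, hN₁, -⟩ := exists_jost_slope h.pot_p h.col_p hp0 (by rw [hlam]; simp) x
  obtain ⟨M₀, M₁, hM₀, hM₁, -⟩ := exists_jost_slope h.pot_m
    (ν := fun ζ x => swap (m ζ (-x))) h.col_m hp0 (by rw [hlam]; simp) (-x)
  simp only [neg_neg] at hM₀ hM₁
  have hM₀' : Tendsto (fun ζ => m ζ x) (𝓝[S₁ P \ {p}] p) (𝓝 (swap M₀)) := by
    have := (continuous_swap.tendsto _).comp hM₀
    simpa only [Function.comp_def, swap_swap] using this
  have hM₁' : Tendsto (fun ζ => (ζ - p)⁻¹ • (m ζ x - swap M₀)) (𝓝[S₁ P \ {p}] p)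
      (𝓝 (swap M₁)) := by
    have := (continuous_swap.tendsto _).comp hM₁
    refine this.congr fun ζ => ?_
    ext i
    fin_cases i <;> simp
  have hneg : Tendsto (fun φ : ℝ => -φ) (𝓝[≠] 0) (𝓝[≠] 0) := by
    refine tendsto_nhdsWithin_iff.2 ⟨?_, ?_⟩
    · have := (continuous_neg.tendsto (0 : ℝ)).mono_left (nhdsWithin_le_nhds (s := {0}ᶜ))
      simpa using this
    · filter_upwards [self_mem_nhdsWithin] with φ hφ
      simpa using hφ
  have hγ' := hγ.comp hneg
  -- On the circle, conjugation followed by the symmetry reverses the angle, so m at angle φ is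
  -- proportional to n at angle -φ. In the limit φ → 0 the vectors become parallel.
  have hD₀ : det2 (swap M₀) N₀ = 0 := by
    have h1 := (continuous_det2.tendsto _).comp
      ((hM₀'.comp hγ).prodMk_nhds (hN₀.comp hγ'))
    refine tendsto_nhds_unique h1 (tendsto_const_nhds.congr' ?_)
    filter_upwards [hγS] with φ hφ
    have e1 := h.m_eq_smul hφ x
    have e2 := h.n_tau (Or.inl (conj_mem_Sig hφ)) x
    rw [tau_conj_circ hp hp0] at e2
    simp only [Function.comp_apply]
    rw [e1, e2]
    simp only [det2, Pi.smul_apply, smul_eq_mul]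
    ring
  have hslope : Tendsto (fun ζ => (ζ - p)⁻¹ * det2 (m ζ x) (n ζ x)) (𝓝[S₁ P \ {p}] p)
      (𝓝 (det2 (swap M₁) N₀ + det2 (swap M₀) N₁)) := by
    have h1 := ((continuous_det2.tendsto _).comp (hM₁'.prodMk_nhds hN₀)).add
      ((continuous_det2.tendsto _).comp ((tendsto_const_nhds (x := swap M₀)).prodMk_nhds hN₁))
    have h2 := h1.add ((continuous_det2.tendsto _).comp
      ((tendsto_const_nhds (x := (0 : Fin 2 → ℂ))).prodMk_nhds hN₀))
    have z : det2 0 N₀ = 0 := by simp [det2]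
    rw [z, add_zero] at h2
    refine h2.congr fun ζ => ?_
    simp only [Function.comp_apply, det2, Pi.smul_apply, Pi.sub_apply, smul_eq_mul,
      Pi.zero_apply] at hD₀ ⊢
    linear_combination (-(ζ - p)⁻¹) * hD₀
  -- The denominator 1 + q₀²/ζ² = (ζ-p)(ζ+p)/ζ² of a has a simple zero at p, which is absorbed by
  -- the difference quotient of the determinant.
  have hden : Tendsto (fun ζ : ℂ => ζ ^ 2 / (ζ + p)) (𝓝[S₁ P \ {p}] p)
      (𝓝 (p ^ 2 / (p + p))) := by
    have hpp : p + p ≠ 0 := by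
      rw [← two_mul]
      exact mul_ne_zero two_ne_zero hp0
    have : ContinuousAt (fun ζ : ℂ => ζ ^ 2 / (ζ + p)) p :=
      (continuousAt_id.pow 2).div (continuousAt_id.add continuousAt_const) hpp
    exact this.tendsto.mono_left nhdsWithin_le_nhds
  have hA := (hslope.mul hden).congr' (f₂ := coefA P n m x) (by
    filter_upwards [self_mem_nhdsWithin] with ζ hζ
    have h0 := ne_zero_of_mem_S₁ P hζ.1
    have h1 : ζ - p ≠ 0 := sub_ne_zero.2 hζ.2
    have h3 := one_add_ne_zero hζ.1
    have h2 : ζ + p ≠ 0 := by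
      intro e
      refine h3 ?_
      rw [eq_neg_of_add_eq_zero_left e, neg_sq, hp]
      field_simp
      ring
    have e : 1 + (P.q₀ : ℂ) ^ 2 / ζ ^ 2 = (ζ - p) * (ζ + p) / ζ ^ 2 := by
      rw [show (P.q₀ : ℂ) ^ 2 = -p ^ 2 by rw [hp, neg_neg]]
      field_simp
      ring
    rw [coefA, e]
    field_simp)
  refine ⟨N₀, swap M₀, _, ?_, hN₀, hM₀', hA⟩
  have hprod := (hA.comp hγ).mul (hA.comp hγ')
  -- The two symmetries of a give a(γ(φ)) a(γ(-φ)) = q₊/q₋ on the circle γ, hence a₀² = q₊/q₋ for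
  -- the limit.
  have hconst : (det2 (swap M₁) N₀ + det2 (swap M₀) N₁) * (p ^ 2 / (p + p)) *
      ((det2 (swap M₁) N₀ + det2 (swap M₀) N₁) * (p ^ 2 / (p + p))) = P.qp / P.qm := by
    refine tendsto_nhds_unique hprod (tendsto_const_nhds.congr' ?_)
    filter_upwards [hγS] with φ hφ
    have e1 := h.coefA_tau (Or.inl (conj_mem_Sig hφ)) x
    rw [tau_conj_circ hp hp0] at e1
    have e2 := h.coefA_mul_conj hφ x
    simp only [Function.comp_apply]
    rw [e1]
    linear_combination (-(P.qp / P.qm)) * e2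
  intro e
  rw [e, zero_mul] at hconst
  exact div_ne_zero P.qp_ne P.qm_ne hconst.symm

end Pair

/-! ### Partial fractions, and the covering of the plane by Σ ∪ D₁ and its mirror image. -/

theorem tendsto_const_div_sub_cocompact (r c : ℂ) :
    Tendsto (fun z : ℂ => r / (z - c)) (cocompact ℂ) (𝓝 0) := by
  have h2 := ((tendsto_inv₀_cobounded (α := ℂ)).mono_left
    (Metric.cobounded_eq_cocompact (α := ℂ)).ge).comp
    (Homeomorph.subRight c).isClosedEmbedding.tendsto_cocompact
  have h3 := h2.const_mul r
  rw [mul_zero] at h3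
  exact h3

/-- A function with simple poles which is bounded at infinity is the sum of its principal parts and
of its value at infinity. -/
theorem eq_partial_fractions {κ : Type*} [Fintype κ] {π R : κ → ℂ} (hinj : Function.Injective π)
    {A : ℂ} {s : Finset ℂ} (hπ : ∀ k, π k ∈ s) {F : ℂ → ℂ} (hd : ∀ z ∉ s, DifferentiableAt ℂ F z)
    (hpole : ∀ k, Tendsto (fun z => (z - π k) * F z) (𝓝[≠] π k) (𝓝 (R k)))
    (hreg : ∀ p ∈ s, (∀ k, π k ≠ p) → Tendsto (fun z => (z - p) * F z) (𝓝[≠] p) (𝓝 0))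
    (hinf : Tendsto F (cocompact ℂ) (𝓝 A)) {z : ℂ} (hz : z ∉ s) :
    F z = A + ∑ k, R k / (z - π k) := by
  classical
  have hterm : ∀ k (p : ℂ), Tendsto (fun z => (z - p) * (R k / (z - π k))) (𝓝[≠] p)
      (𝓝 (if π k = p then R k else 0)) := by
    intro k p
    split_ifs with h
    · subst h
      refine tendsto_const_nhds.congr' ?_
      filter_upwards [self_mem_nhdsWithin] with z hz
      have : z - π k ≠ 0 := sub_ne_zero.2 hz
      field_simp
    · have hc : ContinuousAt (fun z : ℂ => (z - p) * (R k / (z - π k))) p :=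
        (continuousAt_id.sub continuousAt_const).mul (continuousAt_const.div
          (continuousAt_id.sub continuousAt_const) (sub_ne_zero.2 (Ne.symm h)))
      have := hc.tendsto.mono_left (nhdsWithin_le_nhds (s := {p}ᶜ))
      simpa using this
  have hE : ∀ p : ℂ, Tendsto (fun z => (z - p) * (A + ∑ k, R k / (z - π k))) (𝓝[≠] p)
      (𝓝 (∑ k, if π k = p then R k else 0)) := by
    intro p
    have hc : Continuous fun z : ℂ => (z - p) * A := by fun_prop
    have h1 := ((hc.tendsto p).mono_left (nhdsWithin_le_nhds (s := {p}ᶜ))).add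
      (tendsto_finsetSum Finset.univ fun k _ => hterm k p)
    simp only [sub_self, zero_mul, zero_add] at h1
    refine h1.congr fun z => ?_
    rw [mul_add, Finset.mul_sum]
  refine sub_eq_zero.1 (eq_zero_of_removable (s := s)
    (G := fun z => F z - (A + ∑ k, R k / (z - π k))) (fun z hz => ?_) (fun p hp => ?_) ?_ hz)
  · refine (hd z hz).sub ((differentiableAt_const A).add ?_)
    refine DifferentiableAt.fun_sum fun k _ => (differentiableAt_const _).div
      (differentiableAt_id.sub (differentiableAt_const _)) (sub_ne_zero.2 ?_)
    rintro rfl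
    exact hz (hπ k)
  · simp only [mul_sub]
    by_cases h : ∃ k, π k = p
    · obtain ⟨k, rfl⟩ := h
      have h2 := (hpole k).sub (hE (π k))
      simpa [hinj.eq_iff] using h2
    · push Not at h
      have h2 := (hreg p hp h).sub (hE p)
      simpa [h] using h2
  · have h1 := fun k => tendsto_const_div_sub_cocompact (R k) (π k)
    have h2 := hinf.sub ((tendsto_const_nhds (x := A)).add
      (tendsto_finsetSum Finset.univ fun k _ => h1 k))
    simpa using h2

theorem isOpen_D₁ (P : Params) : IsOpen (D₁ P) :=
  isOpen_lt continuous_const (by fun_prop)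

section Cover

variable {P : Params}

theorem mem_S₁_or_conj {ζ : ℂ} (h0 : ζ ≠ 0) (h1 : ζ ≠ Complex.I * P.q₀)
    (h2 : ζ ≠ -(Complex.I * P.q₀)) : ζ ∈ S₁ P ∨ conj ζ ∈ S₁ P := by
  rw [mem_S₁_iff, mem_S₁_iff]
  rcases le_total 0 ((‖ζ‖ ^ 2 - P.q₀ ^ 2) * ζ.im) with h | h
  · exact Or.inl ⟨h0, h1, h2, h⟩
  · refine Or.inr ⟨by simpa using h0, fun e => h2 ?_, fun e => h1 ?_, ?_⟩
    · rw [← Complex.conj_conj ζ, e]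
      simp
    · rw [← Complex.conj_conj ζ, e]
      simp
    · rw [Complex.norm_conj, Complex.conj_im, mul_neg]
      exact neg_nonneg.2 h

theorem mem_Sig_of_mem_of_conj_mem {ζ : ℂ} (h : ζ ∈ S₁ P) (h' : conj ζ ∈ S₁ P) : ζ ∈ Sig P := by
  have h1 := ((mem_S₁_iff P).1 h').2.2.2
  rw [Complex.norm_conj, Complex.conj_im, mul_neg] at h1
  refine h.resolve_right fun hD => ?_
  have : 0 < (‖ζ‖ ^ 2 - P.q₀ ^ 2) * ζ.im := hD
  linarith

theorem S₁_mem_nhds {ζ : ℂ} (h : ζ ∈ D₁ P) : S₁ P ∈ 𝓝 ζ :=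
  mem_of_superset ((isOpen_D₁ P).mem_nhds h) fun _ => Or.inr

end Cover

/-! ### The sectionally holomorphic function m/a. -/

section Pair

variable {P : Params} {u : ℝ → ℂ} {f : ℝ → ℝ} {n m : ℂ → ℝ → Fin 2 → ℂ}

open Classical in
/-- The sectionally holomorphic function given by `m/a` and by the dual of `n`. -/
def rhF (P : Params) (n m : ℂ → ℝ → Fin 2 → ℂ) (x : ℝ) (i : Fin 2) (ζ : ℂ) : ℂ :=
  if ζ ∈ S₁ P then m ζ x i / coefA P n m x ζ else dual (n (conj ζ) x) i

theorem rhF_of_mem {ζ : ℂ} (h : ζ ∈ S₁ P) (x : ℝ) (i : Fin 2) :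
    rhF P n m x i ζ = m ζ x i / coefA P n m x ζ := if_pos h

theorem IsJostPair.rhF_of_conj_mem (h : IsJostPair P u f n m) {ζ : ℂ} (hζ : conj ζ ∈ S₁ P) (x : ℝ)
    (i : Fin 2) : rhF P n m x i ζ = dual (n (conj ζ) x) i := by
  by_cases h1 : ζ ∈ S₁ P
  · have hS := mem_Sig_of_mem_of_conj_mem h1 hζ
    rw [rhF_of_mem h1, h.m_eq_smul hS, Pi.smul_apply, smul_eq_mul,
      mul_div_cancel_left₀ _ (h.coefA_ne_zero hS x)]
  · exact if_neg h1

/-- The two regions cover the relevant neighbourhood, so a limit may be checked on each of them with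
its own formula. -/
theorem IsJostPair.tendsto_rhF (h : IsJostPair P u f n m) {x : ℝ} {i : Fin 2} {l : Filter ℂ}
    {g : ℂ → ℂ} {c : ℂ} (hl : ∀ᶠ ζ in l, ζ ∈ S₁ P ∨ conj ζ ∈ S₁ P)
    (h₁ : Tendsto (fun ζ => g ζ * (m ζ x i / coefA P n m x ζ)) (l ⊓ 𝓟 (S₁ P)) (𝓝 c))
    (h₂ : Tendsto (fun ζ => g ζ * dual (n (conj ζ) x) i) (l ⊓ 𝓟 {ζ | conj ζ ∈ S₁ P}) (𝓝 c)) :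
    Tendsto (fun ζ => g ζ * rhF P n m x i ζ) l (𝓝 c) := by
  have e : l ≤ l ⊓ 𝓟 (S₁ P) ⊔ l ⊓ 𝓟 {ζ | conj ζ ∈ S₁ P} := by
    rw [← inf_sup_left, sup_principal]
    exact le_inf le_rfl (le_principal_iff.2 hl)
  refine Tendsto.mono_left (Tendsto.sup (h₁.congr' ?_) (h₂.congr' ?_)) e
  · filter_upwards [mem_inf_of_right (mem_principal_self _)] with ζ hζ
    rw [rhF_of_mem hζ]
  · filter_upwards [mem_inf_of_right (mem_principal_self _)] with ζ hζ
    rw [h.rhF_of_conj_mem hζ]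

theorem IsJostPair.rhF_continuousAt (h : IsJostPair P u f n m) {ζ₀ : ℂ} (hζ : ζ₀ ∈ Sig P) (x : ℝ)
    (i : Fin 2) : ContinuousAt (rhF P n m x i) ζ₀ := by
  have hS : ζ₀ ∈ S₁ P := Or.inl hζ
  have hS' : conj ζ₀ ∈ S₁ P := Or.inl (conj_mem_Sig hζ)
  have e1 := rhF_of_mem (n := n) (m := m) hS x i
  have e2 := h.rhF_of_conj_mem hS' x i
  have hev : ∀ᶠ ζ in 𝓝 ζ₀, ζ ∈ S₁ P ∨ conj ζ ∈ S₁ P := by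
    filter_upwards [isOpen_ne.mem_nhds hζ.2.1, isOpen_ne.mem_nhds hζ.2.2.1,
      isOpen_ne.mem_nhds hζ.2.2.2] with ζ a b c using mem_S₁_or_conj a b c
  have := h.tendsto_rhF (x := x) (i := i) (g := fun _ => 1) hev (c := rhF P n m x i ζ₀) (by
    simp only [one_mul]
    rw [e1]
    exact ((differentiableWithinAt_pi.1 (h.m_differentiableWithinAt hS x) i).continuousWithinAt.div
      (h.coefA_differentiableWithinAt hS x).continuousWithinAt (h.coefA_ne_zero hζ x)))
    (by
    simp only [one_mul]
    rw [e2]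
    have hc := (h.n_differentiableWithinAt hS' x).continuousWithinAt
    have ht : Tendsto (fun ζ : ℂ => conj ζ) (𝓝 ζ₀ ⊓ 𝓟 {ζ | conj ζ ∈ S₁ P})
        (𝓝[S₁ P] (conj ζ₀)) :=
      tendsto_nhdsWithin_iff.2 ⟨(Complex.continuous_conj.tendsto _).mono_left inf_le_left,
        mem_inf_of_right (mem_principal_self _)⟩
    exact (((continuous_apply i).comp continuous_dual).tendsto _).comp (hc.tendsto.comp ht))
  simpa [ContinuousAt] using this

theorem IsJostPair.rhF_differentiableAt_of_D₁ (h : IsJostPair P u f n m) {ζ₀ : ℂ}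
    (hζ : ζ₀ ∈ D₁ P) {x : ℝ} (ha : coefA P n m x ζ₀ ≠ 0) (i : Fin 2) :
    DifferentiableAt ℂ (rhF P n m x i) ζ₀ := by
  have hS : ζ₀ ∈ S₁ P := Or.inr hζ
  have hn := S₁_mem_nhds hζ
  have h1 := ((differentiableWithinAt_pi.1 (h.m_differentiableWithinAt hS x) i).div
    (h.coefA_differentiableWithinAt hS x) ha).differentiableAt hn
  refine h1.congr_of_eventuallyEq ?_
  filter_upwards [hn] with ζ h' using rhF_of_mem h' x i

theorem IsJostPair.rhF_differentiableAt_of_conj (h : IsJostPair P u f n m) {ζ₀ : ℂ}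
    (hζ : conj ζ₀ ∈ D₁ P) (x : ℝ) (i : Fin 2) : DifferentiableAt ℂ (rhF P n m x i) ζ₀ := by
  have hS : conj ζ₀ ∈ S₁ P := Or.inr hζ
  have hn := S₁_mem_nhds hζ
  have h1 : ∀ j, DifferentiableAt ℂ (fun ζ => conj (n (conj ζ) x j)) ζ₀ := fun j => by
    have := ((differentiableWithinAt_pi.1 (h.n_differentiableWithinAt hS x) j).differentiableAt
      hn).conj_conj
    rw [Complex.conj_conj] at this
    exact this
  have h2 : DifferentiableAt ℂ (fun ζ => dual (n (conj ζ) x) i) ζ₀ := by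
    fin_cases i
    · exact h1 1
    · exact (h1 0).neg
  refine h2.congr_of_eventuallyEq ?_
  filter_upwards [Complex.continuous_conj.continuousAt.preimage_mem_nhds hn] with ζ h' using
    h.rhF_of_conj_mem h' x i

/-! ### The limits at infinity, at the origin and at the branch points -/

theorem IsJostPair.coefA_tendsto_infinity (h : IsJostPair P u f n m) (x : ℝ) {g : ℂ}
    (hg : Tendsto (fun ζ => m ζ x) (cocompact ℂ ⊓ 𝓟 (S₁ P)) (𝓝 ![g, 0])) :
    Tendsto (coefA P n m x) (cocompact ℂ ⊓ 𝓟 (S₁ P)) (𝓝 (g * gauge f x)) := by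
  have h1 := (continuous_det2.tendsto _).comp (hg.prodMk_nhds (h.n_tendsto_infinity x))
  have h2 : Tendsto (fun ζ : ℂ => 1 + (P.q₀ : ℂ) ^ 2 / ζ ^ 2) (cocompact ℂ ⊓ 𝓟 (S₁ P)) (𝓝 1) := by
    have h3 : Tendsto (fun ζ : ℂ => ζ⁻¹) (cocompact ℂ) (𝓝 0) := by
      rw [← Metric.cobounded_eq_cocompact]
      exact tendsto_inv₀_cobounded
    have := ((h3.pow 2).const_mul ((P.q₀ : ℂ) ^ 2)).const_add 1
    simp only [ne_eq, OfNat.ofNat_ne_zero, not_false_eq_true, zero_pow, mul_zero, add_zero] at this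
    refine (this.congr fun ζ => ?_).mono_left inf_le_left
    rw [div_eq_mul_inv, inv_pow]
  have e : g * gauge f x = det2 ![g, 0] ![0, gauge f x] / 1 := by simp [det2]
  rw [e]
  exact h1.div h2 one_ne_zero

theorem tendsto_conj_cocompact : Tendsto (fun ζ : ℂ => conj ζ)
    (cocompact ℂ ⊓ 𝓟 {ζ | conj ζ ∈ S₁ P}) (cocompact ℂ ⊓ 𝓟 (S₁ P)) := by
  refine tendsto_inf.2 ⟨?_, tendsto_principal.2 (mem_inf_of_right (mem_principal_self _))⟩
  refine Tendsto.mono_left ?_ inf_le_left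
  exact (Complex.conjCLE.toHomeomorph.isClosedEmbedding.tendsto_cocompact)

theorem eventually_mem_S₁_cocompact :
    ∀ᶠ ζ in cocompact ℂ, ζ ∈ S₁ P ∨ conj ζ ∈ S₁ P := by
  have hf : ∀ p : ℂ, ∀ᶠ ζ in cocompact ℂ, ζ ≠ p := fun p =>
    (isCompact_singleton (x := p)).compl_mem_cocompact
  filter_upwards [hf 0, hf (Complex.I * P.q₀), hf (-(Complex.I * P.q₀))] with ζ a b c using
    mem_S₁_or_conj a b c

/-- The unknown limit g of m cancels in m/a. What remains is the conjugate gauge factor, which is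
also what the dual of n yields on the other region. -/
theorem IsJostPair.rhF_tendsto_infinity (h : IsJostPair P u f n m) (x : ℝ) (i : Fin 2) :
    Tendsto (rhF P n m x i) (cocompact ℂ) (𝓝 (![conj (gauge f x), 0] i)) := by
  obtain ⟨g, hg0, hg⟩ := h.m_tendsto_infinity x
  have hgg : gauge f x * conj (gauge f x) = 1 := by
    rw [Complex.mul_conj, Complex.normSq_eq_norm_sq, norm_gauge]
    simp
  have hgn := left_ne_zero_of_mul_eq_one hgg
  have ha := h.coefA_tendsto_infinity x hg
  have := h.tendsto_rhF (x := x) (i := i) (g := fun _ => 1) (c := ![conj (gauge f x), 0] i)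
    eventually_mem_S₁_cocompact (by
      simp only [one_mul]
      have h1 := (((continuous_apply i).tendsto _).comp hg).div ha (mul_ne_zero hg0 hgn)
      have e : ![g, 0] i / (g * gauge f x) = ![conj (gauge f x), 0] i := by
        fin_cases i
        · simp
          field_simp
          linear_combination -hgg
        · simp
      rw [← e]
      exact h1)
    (by
      simp only [one_mul]
      have h1 := ((continuous_apply i).comp continuous_dual).tendsto _ |>.comp
        ((h.n_tendsto_infinity x).comp (tendsto_conj_cocompact (P := P)))
      have e : dual ![0, gauge f x] i = ![conj (gauge f x), 0] i := by
        fin_cases i <;> simp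
      rw [← e]
      exact h1)
  simpa using this

theorem tendsto_tau_zero : Tendsto (fun ζ : ℂ => -(P.q₀ : ℂ) ^ 2 / conj ζ)
    (𝓝[≠] 0 ⊓ 𝓟 (S₁ P)) (cocompact ℂ ⊓ 𝓟 (S₁ P)) := by
  refine tendsto_inf.2 ⟨?_, tendsto_principal.2
    (mem_inf_of_right (mem_principal.2 fun ζ hζ => tau_mem_S₁ hζ))⟩
  refine Tendsto.mono_left ?_ inf_le_left
  rw [← Metric.cobounded_eq_cocompact, ← tendsto_norm_atTop_iff_cobounded]
  have h1 : Tendsto (fun ζ : ℂ => ‖ζ‖⁻¹) (𝓝[≠] 0) atTop :=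
    tendsto_inv_nhdsGT_zero.comp (tendsto_nhdsWithin_iff.2
      ⟨by simpa using (continuous_norm.tendsto (0 : ℂ)).mono_left nhdsWithin_le_nhds, by
        filter_upwards [self_mem_nhdsWithin] with ζ hζ using norm_pos_iff.2 hζ⟩)
  have h2 := h1.const_mul_atTop (pow_pos P.q₀_pos 2)
  refine h2.congr fun ζ => ?_
  rw [norm_div, norm_neg, norm_pow, Complex.norm_real, Real.norm_of_nonneg P.q₀_pos.le,
    Complex.norm_conj, div_eq_mul_inv]

/-- The symmetry carries 0 to ∞ inside `S₁`, so the behaviour at the origin is read off at infinity;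
the scalar in `IsJostPair.n_tau` creates the simple pole. -/
theorem IsJostPair.n_tendsto_zero (h : IsJostPair P u f n m) (x : ℝ) :
    Tendsto (fun ζ => ζ • n ζ x) (𝓝[≠] 0 ⊓ 𝓟 (S₁ P))
      (𝓝 ((-Complex.I * P.qp) • dual ![0, gauge f x])) := by
  have h1 := ((continuous_dual.tendsto _).comp ((h.n_tendsto_infinity x).comp
    (tendsto_tau_zero (P := P)))).const_smul (-Complex.I * P.qp)
  refine h1.congr' ?_
  filter_upwards [mem_inf_of_right (mem_principal_self _)] with ζ hζ
  have h0 := ne_zero_of_mem_S₁ P hζ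
  have e := h.n_tau (tau_mem_S₁ hζ) x
  rw [tau_tau h0] at e
  rw [e, smul_smul]
  simp only [Function.comp_apply]
  congr 1
  have hp := conj_qp_mul_qp P
  have hp0 : conj P.qp ≠ 0 := by simpa using P.qp_ne
  simp only [map_div₀, map_neg, map_pow, Complex.conj_ofReal, Complex.conj_conj]
  rw [← hp]
  field_simp
  rw [Complex.I_sq]
  ring

theorem IsJostPair.m_div_tendsto_zero (h : IsJostPair P u f n m) (x : ℝ) :
    Tendsto (fun ζ => (ζ / coefA P n m x ζ) • m ζ x) (𝓝[≠] 0 ⊓ 𝓟 (S₁ P))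
      (𝓝 ((-Complex.I * conj P.qp) • ![0, gauge f x])) := by
  obtain ⟨g, hg0, hg⟩ := h.m_tendsto_infinity x
  have hgg : gauge f x * conj (gauge f x) = 1 := by
    rw [Complex.mul_conj, Complex.normSq_eq_norm_sq, norm_gauge]
    simp
  have hgn := left_ne_zero_of_mul_eq_one hgg
  have ha := h.coefA_tendsto_infinity x hg
  have ht := tendsto_tau_zero (P := P)
  have h1 := (((Complex.continuous_conj.tendsto _).comp (ha.comp ht)).inv₀
    (by simpa using ⟨hg0, hgn⟩)).smul (((continuous_dual.tendsto _).comp (hg.comp ht)).const_smul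
      (Complex.I * conj P.qp))
  have e1 : (conj (g * gauge f x))⁻¹ • ((Complex.I * conj P.qp) • dual ![g, 0]) =
      (-Complex.I * conj P.qp) • ![0, gauge f x] := by
    have hg0' : conj g ≠ 0 := by simpa using hg0
    have hgn' : conj (gauge f x) ≠ 0 := by simpa using hgn
    ext i
    fin_cases i
    · simp
    · simp
      field_simp
      linear_combination (-conj P.qp) * hgg
  rw [e1] at h1
  refine h1.congr' ?_
  filter_upwards [mem_inf_of_right (mem_principal_self _)] with ζ hζ
  have h0 := ne_zero_of_mem_S₁ P hζ
  have e := h.m_tau (tau_mem_S₁ hζ) x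
  have e' := h.coefA_tau (tau_mem_S₁ hζ) x
  rw [tau_tau h0] at e e'
  rw [e, e', smul_smul]
  simp only [Function.comp_apply, smul_smul]
  congr 1
  have hp := conj_qp_mul_qp P
  have hp0 := P.qp_ne
  have hm0 := P.qm_ne
  simp only [map_div₀, map_neg, map_pow, Complex.conj_ofReal, Complex.conj_conj]
  rw [← hp]
  field_simp
  rw [Complex.I_sq]
  ring

end Pair

section Pair

variable {P : Params} {u : ℝ → ℂ} {f : ℝ → ℝ} {n m : ℂ → ℝ → Fin 2 → ℂ}

theorem IsJostPair.rhF_tendsto_origin (h : IsJostPair P u f n m) (x : ℝ) (i : Fin 2) :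
    Tendsto (fun ζ => ζ * rhF P n m x i ζ) (𝓝[≠] 0)
      (𝓝 (-Complex.I * conj P.qp * ![0, gauge f x] i)) := by
  have hI0 : Complex.I * (P.q₀ : ℂ) ≠ 0 := mul_ne_zero Complex.I_ne_zero P.q₀_ne
  refine h.tendsto_rhF ?_ ?_ ?_
  · filter_upwards [self_mem_nhdsWithin,
      mem_nhdsWithin_of_mem_nhds (isOpen_ne.mem_nhds hI0.symm),
      mem_nhdsWithin_of_mem_nhds (isOpen_ne.mem_nhds (neg_ne_zero.2 hI0).symm)] with ζ a b c using
      mem_S₁_or_conj a b c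
  · have h1 := ((continuous_apply i).tendsto _).comp (h.m_div_tendsto_zero x)
    refine h1.congr fun ζ => ?_
    simp only [Function.comp_apply, Pi.smul_apply, smul_eq_mul]
    ring
  · have ht : Tendsto (fun ζ : ℂ => conj ζ) (𝓝[≠] 0 ⊓ 𝓟 {ζ | conj ζ ∈ S₁ P})
        (𝓝[≠] 0 ⊓ 𝓟 (S₁ P)) := by
      refine tendsto_inf.2 ⟨tendsto_nhdsWithin_iff.2 ⟨?_, ?_⟩,
        tendsto_principal.2 (mem_inf_of_right (mem_principal_self _))⟩
      · have := (Complex.continuous_conj.tendsto 0).mono_left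
          (inf_le_left.trans nhdsWithin_le_nhds :
            𝓝[≠] (0 : ℂ) ⊓ 𝓟 {ζ | conj ζ ∈ S₁ P} ≤ 𝓝 0)
        simpa using this
      · filter_upwards [mem_inf_of_left self_mem_nhdsWithin] with ζ hζ
        simpa using hζ
    have h1 := (((continuous_apply i).comp continuous_dual).tendsto _).comp
      ((h.n_tendsto_zero x).comp ht)
    have e : dual ((-Complex.I * P.qp) • dual ![0, gauge f x]) i =
        -Complex.I * conj P.qp * ![0, gauge f x] i := by
      fin_cases i <;> simp
    rw [← e]
    refine h1.congr fun ζ => ?_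
    simp only [Function.comp_apply, dual_smul, Complex.conj_conj, Pi.smul_apply, smul_eq_mul]

/-- The function has a finite limit from each region, for m/a because a₀ ≠ 0. Since p̄ = -p, the
mirrored region uses the limit of n at the other branch point. -/
theorem IsJostPair.rhF_tendsto_branch (h : IsJostPair P u f n m) {p : ℂ}
    (hp : p ^ 2 = -(P.q₀ : ℂ) ^ 2) (x : ℝ) (i : Fin 2) :
    Tendsto (fun ζ => (ζ - p) * rhF P n m x i ζ) (𝓝[≠] p) (𝓝 0) := by
  have hq := P.q₀_ne
  have hp0 : p ≠ 0 := fun e => hq (by simpa [e] using hp.symm)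
  have hpi : p = Complex.I * P.q₀ ∨ p = -(Complex.I * P.q₀) := by
    rw [← sq_eq_sq_iff_eq_or_eq_neg, hp, mul_pow, Complex.I_sq]
    ring
  have hpc : conj p = -p := by rcases hpi with h | h <;> simp [h]
  have hnp : p ≠ -p := fun e => hp0 (self_eq_neg.1 e)
  have hp' : (-p) ^ 2 = -(P.q₀ : ℂ) ^ 2 := by rw [neg_sq, hp]
  obtain ⟨-, M₀, a₀, ha₀, -, hM, hA⟩ := h.limits_branch hp x
  obtain ⟨N₀, -, -, -, hN, -, -⟩ := h.limits_branch hp' x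
  have hz : Tendsto (fun ζ : ℂ => ζ - p) (𝓝 p) (𝓝 0) := by
    have : Continuous fun ζ : ℂ => ζ - p := by fun_prop
    simpa using this.tendsto p
  refine h.tendsto_rhF ?_ ?_ ?_
  · filter_upwards [self_mem_nhdsWithin, mem_nhdsWithin_of_mem_nhds (isOpen_ne.mem_nhds hp0),
      mem_nhdsWithin_of_mem_nhds (isOpen_ne.mem_nhds hnp)] with ζ a b c
    rcases hpi with e | e
    · exact mem_S₁_or_conj b (e ▸ a) (e ▸ c)
    · refine mem_S₁_or_conj b ?_ (e ▸ a)
      rw [e, neg_neg] at c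
      exact c
  · have e : 𝓝[≠] p ⊓ 𝓟 (S₁ P) ≤ 𝓝[S₁ P \ {p}] p := by
      rw [nhdsWithin, nhdsWithin, inf_assoc, inf_principal, Set.inter_comm, Set.sdiff_eq]
    have h1 := (hz.mono_left nhdsWithin_le_nhds).mul
      ((((continuous_apply i).tendsto _).comp hM).div hA ha₀)
    rw [zero_mul] at h1
    exact h1.mono_left e
  · have ht : Tendsto (fun ζ : ℂ => conj ζ) (𝓝[≠] p ⊓ 𝓟 {ζ | conj ζ ∈ S₁ P})
        (𝓝[S₁ P \ {-p}] (-p)) := by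
      refine tendsto_nhdsWithin_iff.2 ⟨?_, ?_⟩
      · rw [← hpc]
        exact (Complex.continuous_conj.tendsto p).mono_left
          (inf_le_left.trans nhdsWithin_le_nhds)
      · filter_upwards [mem_inf_of_left self_mem_nhdsWithin,
          mem_inf_of_right (mem_principal_self _)] with ζ a b
        refine ⟨b, fun e => a ?_⟩
        rw [Set.mem_singleton_iff, ← hpc] at e
        exact (starRingEnd ℂ).injective e
    have h1 := (hz.mono_left (inf_le_left.trans nhdsWithin_le_nhds :
      𝓝[≠] p ⊓ 𝓟 {ζ | conj ζ ∈ S₁ P} ≤ 𝓝 p)).mul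
      ((((continuous_apply i).comp continuous_dual).tendsto _).comp (hN.comp ht))
    rw [zero_mul] at h1
    exact h1

/-- At a simple zero of a the residue of m/a is m/a', and m = C a' n there. -/
theorem IsJostPair.rhF_tendsto_pole (h : IsJostPair P u f n m) {η C : ℂ} {x : ℝ} (hη : η ∈ D₁ P)
    (ha : coefA P n m x η = 0) (hd : deriv (coefA P n m x) η ≠ 0)
    (hC : m η x = (C * deriv (coefA P n m x) η) • n η x) (i : Fin 2) :
    Tendsto (fun ζ => (ζ - η) * rhF P n m x i ζ) (𝓝[≠] η) (𝓝 (C * n η x i)) := by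
  have hS : η ∈ S₁ P := Or.inr hη
  have hn := S₁_mem_nhds hη
  have h1 := ((h.coefA_differentiableWithinAt hS x).differentiableAt hn).hasDerivAt
  rw [hasDerivAt_iff_tendsto_slope] at h1
  have h2 := ((differentiableWithinAt_pi.1 (h.m_differentiableWithinAt hS x)
    i).differentiableAt hn).continuousAt.tendsto.mono_left (nhdsWithin_le_nhds (s := {η}ᶜ))
  have h3 := h2.mul (h1.inv₀ hd)
  have e : m η x i * (deriv (coefA P n m x) η)⁻¹ = C * n η x i := by
    rw [hC, Pi.smul_apply, smul_eq_mul]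
    field_simp
  rw [e] at h3
  refine h3.congr' ?_
  filter_upwards [mem_nhdsWithin_of_mem_nhds hn] with ζ hζ
  rw [rhF_of_mem hζ, slope_def_field, ha, sub_zero, inv_div]
  ring

theorem ofReal_mem_Sig {r : ℝ} (hr : r ≠ 0) : (r : ℂ) ∈ Sig P := by
  refine ⟨Or.inl (Complex.ofReal_im r), by exact_mod_cast hr, fun e => ?_, fun e => ?_⟩ <;>
  · have := congrArg Complex.re e
    simp at this
    exact hr this

/-- The dual of `n` is an explicit rational function of the spectral parameter. -/
theorem IsJostPair.explicit (h : IsJostPair P u f n m) {ι : Type*} [Fintype ι] {η C : ι → ℂ}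
    {x : ℝ} (hinj : Function.Injective η) (hη : ∀ k, η k ∈ D₁ P)
    (hz : ∀ ζ ∈ D₁ P, coefA P n m x ζ = 0 ↔ ∃ k, η k = ζ)
    (hd : ∀ k, deriv (coefA P n m x) (η k) ≠ 0)
    (hC : ∀ k, m (η k) x = (C k * deriv (coefA P n m x) (η k)) • n (η k) x) (i : Fin 2) {ζ : ℂ}
    (hζ : ζ ∈ D₁ P) : dual (n ζ x) i = ![conj (gauge f x), 0] i +
      (-Complex.I * conj P.qp * ![0, gauge f x] i) / conj ζ +
      ∑ k, C k * n (η k) x i / (conj ζ - η k) := by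
  classical
  -- The points ±q₀, where the line and the circle cross, are included because the removal arguments
  -- treat each curve away from the other. Continuity at ±q₀ makes them removable afterwards.
  set s : Finset ℂ := insert 0 (insert (Complex.I * P.q₀) (insert (-(Complex.I * P.q₀))
    (insert (P.q₀ : ℂ) (insert (-P.q₀ : ℂ) (Finset.univ.image η))))) with hs
  have hmem : ∀ z, z ∈ s ↔ z = 0 ∨ z = Complex.I * P.q₀ ∨ z = -(Complex.I * P.q₀) ∨
      z = P.q₀ ∨ z = -P.q₀ ∨ ∃ k, η k = z := by
    intro z
    simp only [hs, Finset.mem_insert, Finset.mem_image, Finset.mem_univ, true_and]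
  have hoff : ∀ z ∉ s, z ∉ Sig P → DifferentiableAt ℂ (rhF P n m x i) z := by
    intro z hzs hzS
    rw [hmem] at hzs
    push Not at hzs
    rcases mem_S₁_or_conj hzs.1 hzs.2.1 hzs.2.2.1 with h1 | h1
    · have h2 := h1.resolve_left hzS
      refine h.rhF_differentiableAt_of_D₁ h2 (fun e => ?_) i
      obtain ⟨k, hk⟩ := (hz z h2).1 e
      exact hzs.2.2.2.2.2 k hk
    · refine h.rhF_differentiableAt_of_conj (h1.resolve_left fun h2 => hzS ?_) x i
      have := conj_mem_Sig h2
      rwa [Complex.conj_conj] at this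
  have hoff' : ∀ z ∉ s, z.im ≠ 0 → ‖z‖ ≠ P.q₀ → DifferentiableAt ℂ (rhF P n m x i) z :=
    fun z h1 h2 h3 => hoff z h1 fun h4 => h4.1.elim h2 h3
  have hcont : ∀ z ∉ s, ContinuousAt (rhF P n m x i) z := fun z hzs => by
    by_cases hzS : z ∈ Sig P
    · exact h.rhF_continuousAt hzS x i
    · exact (hoff z hzs hzS).continuousAt
  have hso : IsOpen ((s : Set ℂ)ᶜ) := s.finite_toSet.isClosed.isOpen_compl
  have hdiff : ∀ z ∉ s, DifferentiableAt ℂ (rhF P n m x i) z := by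
    intro z hzs
    by_cases him : z.im = 0
    · have hzn : ‖z‖ ≠ P.q₀ := by
        intro e
        have e1 : z = (z.re : ℂ) := Complex.ext rfl (by simpa using him)
        rw [e1, Complex.norm_real, Real.norm_eq_abs] at e
        refine hzs ((hmem z).2 ?_)
        rcases (abs_eq P.q₀_pos.le).1 e with e2 | e2
        · exact Or.inr (Or.inr (Or.inr (Or.inl (by rw [e1, e2]))))
        · exact Or.inr (Or.inr (Or.inr (Or.inr (Or.inl (by rw [e1, e2]; simp)))))
      have hU : IsOpen ((s : Set ℂ)ᶜ ∩ {z | ‖z‖ ≠ P.q₀}) :=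
        hso.inter (isOpen_ne_fun continuous_norm continuous_const)
      have := differentiableOn_of_off_real hU
        (fun w hw => (hcont w (by simpa using hw.1)).continuousWithinAt)
        fun w hw hw' => hoff' w (by simpa using hw.1) hw' hw.2
      exact this.differentiableAt (hU.mem_nhds ⟨by simpa using hzs, hzn⟩)
    · have hU : IsOpen ((s : Set ℂ)ᶜ ∩ {z | z.im ≠ 0}) :=
        hso.inter (isOpen_ne_fun Complex.continuous_im continuous_const)
      exact differentiableAt_of_off_circle P.q₀_pos hU
        (fun w hw => (hcont w (by simpa using hw.1)).continuousWithinAt)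
        (fun w hw hw' => hoff' w (by simpa using hw.1) hw.2 hw') ⟨by simpa using hzs, him⟩
        (by rintro rfl; simp at him)
  have hη0 : ∀ k, η k ≠ 0 := fun k => ne_zero_of_mem_S₁ P (Or.inr (hη k))
  -- The value `none` stands for the pole at the origin.
  set π : Option ι → ℂ := fun o => o.elim 0 η with hπ
  set R : Option ι → ℂ := fun o => o.elim (-Complex.I * conj P.qp * ![0, gauge f x] i)
    fun k => C k * n (η k) x i with hR
  have hπi : Function.Injective π := by
    rintro (_ | a) (_ | b) e
    · rfl
    · exact absurd e.symm (hη0 b)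
    · exact absurd e (hη0 a)
    · exact congrArg some (hinj e)
  have hcζ : conj ζ ∉ s := by
    intro hc
    have hD : 0 < (‖ζ‖ ^ 2 - P.q₀ ^ 2) * ζ.im := hζ
    have hneg : (‖conj ζ‖ ^ 2 - P.q₀ ^ 2) * (conj ζ).im < 0 := by
      rw [Complex.norm_conj, Complex.conj_im, mul_neg]
      linarith
    rcases (hmem _).1 hc with e | e | e | e | e | ⟨k, e⟩
    · simp [e] at hneg
    · simp [e] at hneg
    · simp [e] at hneg
    · simp [e] at hneg
    · simp [e] at hneg
    · rw [← e] at hneg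
      have : 0 < (‖η k‖ ^ 2 - P.q₀ ^ 2) * (η k).im := hη k
      linarith
  -- The formula is evaluated at ζ̄, where the function is the dual of n at ζ.
  have key := eq_partial_fractions (R := R) hπi (s := s) (F := rhF P n m x i) ?_ hdiff ?_ ?_
    (h.rhF_tendsto_infinity x i) hcζ
  · rw [h.rhF_of_conj_mem (by rw [Complex.conj_conj]; exact Or.inr hζ), Complex.conj_conj,
      Fintype.sum_option] at key
    simpa [π, R, add_assoc] using key
  · rintro (_ | k)
    · exact (hmem _).2 (Or.inl rfl)
    · exact (hmem _).2 (Or.inr (Or.inr (Or.inr (Or.inr (Or.inr ⟨k, rfl⟩)))))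
  · rintro (_ | k)
    · simpa [π, R] using h.rhF_tendsto_origin x i
    · exact h.rhF_tendsto_pole (hη k) ((hz _ (hη k)).2 ⟨k, rfl⟩) (hd k) (hC k) i
  · intro p hp hpπ
    have hcase : ∀ r : ℝ, r ≠ 0 → p = r →
        Tendsto (fun z => (z - p) * rhF P n m x i z) (𝓝[≠] p) (𝓝 0) := by
      rintro r hr rfl
      have hz : Continuous fun ζ : ℂ => ζ - (r : ℂ) := by fun_prop
      have := ((hz.tendsto r).mul (h.rhF_continuousAt (ofReal_mem_Sig hr) x i).tendsto).mono_left
        (nhdsWithin_le_nhds (s := {(r : ℂ)}ᶜ))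
      simpa using this
    rcases (hmem p).1 hp with e | e | e | e | e | ⟨k, e⟩
    · exact absurd e.symm (hpπ none)
    · exact h.rhF_tendsto_branch (by rw [e, mul_pow, Complex.I_sq]; ring) x i
    · exact h.rhF_tendsto_branch (by rw [e, neg_sq, mul_pow, Complex.I_sq]; ring) x i
    · exact hcase P.q₀ P.q₀_pos.ne' e
    · exact hcase (-P.q₀) (neg_ne_zero.2 P.q₀_pos.ne') (by rw [e]; simp)
    · exact absurd e (hpπ (some k))

end Pair

/-! ### Reconstruction of the potential. -/

theorem tendsto_mul_const_div_sub_cocompact (r c : ℂ) :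
    Tendsto (fun z : ℂ => z * (r / (z - c))) (cocompact ℂ) (𝓝 r) := by
  have h1 := (tendsto_const_div_sub_cocompact (r * c) c).const_add r
  rw [add_zero] at h1
  refine h1.congr' ?_
  have : ∀ᶠ z in cocompact ℂ, z ≠ c := (isCompact_singleton (x := c)).compl_mem_cocompact
  filter_upwards [this] with z hz
  have : z - c ≠ 0 := sub_ne_zero.2 hz
  field_simp
  ring

/-- The positive imaginary axis runs to infinity inside D₁; limits along D₁ are therefore unique. -/
instance neBot_cocompact_D₁ (P : Params) : (cocompact ℂ ⊓ 𝓟 (D₁ P)).NeBot := by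
  have hn : ∀ s : ℝ, ‖Complex.I * (s : ℂ)‖ = |s| := fun s => by simp
  have ht : Tendsto (fun s : ℝ => Complex.I * (s : ℂ)) atTop (cocompact ℂ ⊓ 𝓟 (D₁ P)) := by
    refine tendsto_inf.2 ⟨?_, tendsto_principal.2 ?_⟩
    · rw [← Metric.cobounded_eq_cocompact, ← tendsto_norm_atTop_iff_cobounded]
      simpa only [hn] using tendsto_abs_atTop_atTop
    · filter_upwards [eventually_gt_atTop P.q₀] with s hs
      have h0 := P.q₀_pos
      change 0 < (‖Complex.I * (s : ℂ)‖ ^ 2 - P.q₀ ^ 2) * (Complex.I * (s : ℂ)).im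
      rw [hn, sq_abs]
      simp only [Complex.mul_im, Complex.I_re, Complex.ofReal_im, mul_zero, Complex.I_im,
        Complex.ofReal_re, one_mul, zero_add]
      have : P.q₀ ^ 2 < s ^ 2 := by gcongr
      exact mul_pos (sub_pos.2 this) (h0.trans hs)
  exact ht.neBot

theorem gauge_mul_conj (f : ℝ → ℝ) (x : ℝ) : gauge f x * conj (gauge f x) = 1 := by
  rw [Complex.mul_conj, Complex.normSq_eq_norm_sq, norm_gauge]
  simp

section Pair

variable {P : Params} {u : ℝ → ℂ} {f : ℝ → ℝ} {n m : ℂ → ℝ → Fin 2 → ℂ}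

/-- The potential is the coefficient of `1/ζ` in the expansion of `n` at infinity. -/
theorem IsJostPair.potential_eq (h : IsJostPair P u f n m) {ι : Type*} [Fintype ι] {η : ι → ℂ}
    {C : ι → ℝ → ℂ} (hη : ∀ k, η k ∈ D₁ P) (hC : ∀ k, Differentiable ℝ (C k))
    (he : ∀ x, ∀ ζ ∈ D₁ P, n ζ x 0 = -Complex.I * P.qp * conj (gauge f x) / ζ -
      ∑ k, conj (C k x) * conj (n (η k) x 1) / (ζ - conj (η k))) (x : ℝ) :
    u x * gauge f x = Complex.I * (-Complex.I * P.qp * conj (gauge f x) -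
      ∑ k, conj (C k x) * conj (n (η k) x 1)) := by
  have hgd : ∀ x, HasDerivAt (fun x => conj (gauge f x))
      (conj (-Complex.I * f x * gauge f x)) x := fun x => (h.pot_p.hasDerivAt_gauge x).star
  set d : ι → ℂ := fun k => deriv (fun x => conj (C k x) * conj (n (η k) x 1)) x with hd
  have hdd : ∀ k, HasDerivAt (fun x => conj (C k x) * conj (n (η k) x 1)) (d k) x := fun k =>
    (((hC k x).hasDerivAt.star).mul
      ((h.col_p _ (Or.inr (hη k))).hasDerivAt_one x).star).differentiableAt.hasDerivAt
  -- The closed formula for n is differentiated in x at fixed ζ and compared with the first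
  -- differential equation. This replaces an asymptotic expansion of n and of its x-derivative in
  -- powers of 1/ζ.
  have hode : ∀ ζ ∈ D₁ P, Complex.I * f x * n ζ x 0 - Complex.I * (ζ * n ζ x 0) +
      u x * n ζ x 1 = -Complex.I * P.qp * conj (-Complex.I * f x * gauge f x) / (ζ - 0) -
        ∑ k, d k / (ζ - conj (η k)) := by
    intro ζ hζ
    have h1 := (h.col_p ζ (Or.inr hζ)).hasDerivAt_zero x
    have h2 : HasDerivAt (fun x => n ζ x 0) (-Complex.I * P.qp *
        conj (-Complex.I * f x * gauge f x) / ζ - ∑ k, d k / (ζ - conj (η k))) x := by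
      rw [show (fun x => n ζ x 0) = fun x => -Complex.I * P.qp * conj (gauge f x) / ζ -
        ∑ k, conj (C k x) * conj (n (η k) x 1) / (ζ - conj (η k)) from
        funext fun x => he x ζ hζ]
      exact (((hgd x).const_mul (-Complex.I * P.qp)).div_const ζ).fun_sub
        (HasDerivAt.fun_sum fun k _ => (hdd k).div_const _)
    rw [sub_zero, ← h1.unique h2]
    ring
  have hle : cocompact ℂ ⊓ 𝓟 (D₁ P) ≤ cocompact ℂ := inf_le_left
  have hD : ∀ᶠ ζ in cocompact ℂ ⊓ 𝓟 (D₁ P), ζ ∈ D₁ P :=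
    mem_inf_of_right (mem_principal_self _)
  have l1 : Tendsto (fun ζ => n ζ x 1) (cocompact ℂ ⊓ 𝓟 (D₁ P)) (𝓝 (gauge f x)) := by
    have := ((continuous_apply 1).tendsto _).comp (h.n_tendsto_infinity x)
    exact this.mono_left (inf_le_inf_left _ (principal_mono.2 fun _ => Or.inr))
  have l2 : Tendsto (fun ζ => n ζ x 0) (cocompact ℂ ⊓ 𝓟 (D₁ P)) (𝓝 0) := by
    have := ((continuous_apply 0).tendsto _).comp (h.n_tendsto_infinity x)
    exact this.mono_left (inf_le_inf_left _ (principal_mono.2 fun _ => Or.inr))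
  have l3 : Tendsto (fun ζ => ζ * n ζ x 0) (cocompact ℂ ⊓ 𝓟 (D₁ P))
      (𝓝 (-Complex.I * P.qp * conj (gauge f x) - ∑ k, conj (C k x) * conj (n (η k) x 1))) := by
    have := ((tendsto_mul_const_div_sub_cocompact (-Complex.I * P.qp * conj (gauge f x)) 0).sub
      (tendsto_finsetSum Finset.univ fun k _ => tendsto_mul_const_div_sub_cocompact
        (conj (C k x) * conj (n (η k) x 1)) (conj (η k)))).mono_left hle
    refine this.congr' ?_
    filter_upwards [hD] with ζ hζ
    rw [he x ζ hζ, sub_zero, mul_sub, Finset.mul_sum]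
  have l4 : Tendsto (fun ζ : ℂ => -Complex.I * P.qp * conj (-Complex.I * f x * gauge f x) / (ζ - 0)
      - ∑ k, d k / (ζ - conj (η k))) (cocompact ℂ ⊓ 𝓟 (D₁ P)) (𝓝 0) := by
    have := ((tendsto_const_div_sub_cocompact
      (-Complex.I * P.qp * conj (-Complex.I * f x * gauge f x)) 0).sub
      (tendsto_finsetSum Finset.univ fun k _ => tendsto_const_div_sub_cocompact (d k)
        (conj (η k)))).mono_left hle
    simpa using this
  -- As ζ → ∞ the right hand side of `hode` vanishes, while ζn₀ tends to the sum of the coefficients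
  -- of its simple fractions and n₁ to the gauge factor.
  have l5 := ((l2.const_mul (Complex.I * f x)).sub (l3.const_mul Complex.I)).add
    (l1.const_mul (u x))
  have := tendsto_nhds_unique (l5.congr' (by filter_upwards [hD] with ζ hζ using hode ζ hζ)) l4
  linear_combination this

theorem conj_ne_of_mem_D₁ {ζ ξ : ℂ} (h : ζ ∈ D₁ P) (h' : ξ ∈ D₁ P) : ζ ≠ conj ξ := by
  rintro rfl
  have h1 : 0 < (‖conj ξ‖ ^ 2 - P.q₀ ^ 2) * (conj ξ).im := h
  have h2 : 0 < (‖ξ‖ ^ 2 - P.q₀ ^ 2) * ξ.im := h'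
  rw [Complex.norm_conj, Complex.conj_im, mul_neg] at h1
  linarith

/-- Reconstruction of a reflectionless potential from its discrete scattering data. -/
theorem IsJostPair.reconstruction (h : IsJostPair P u f n m) {K : ℕ} (hK : Even K)
    {η : Fin K → ℂ} {C : Fin K → ℝ → ℂ} (hinj : Function.Injective η) (hη : ∀ k, η k ∈ D₁ P)
    (hz : ∀ ζ ∈ D₁ P, coefA P n m 0 ζ = 0 ↔ ∃ k, η k = ζ)
    (hd : ∀ k, deriv (coefA P n m 0) (η k) ≠ 0) (hCd : ∀ k, Differentiable ℝ (C k))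
    (hC : ∀ k x, m (η k) x = (C k x * deriv (coefA P n m 0) (η k)) • n (η k) x) (x : ℝ)
    {G F : Fin K → ℂ} {M : Matrix (Fin K) (Fin K) ℂ} (hG : ∀ l, G l = -conj (C l x))
    (hF : ∀ j, F j = Complex.I / P.qp + ∑ k, C k x / ((conj (η j) - η k) * η k))
    (hM : M = Matrix.of fun j l => (if j = l then 1 else 0) -
      ∑ k, C k x / (conj (η j) - η k) * (G l / (η k - conj (η l)))) :
    M.det ≠ 0 ∧ u x = conj (gauge f x) ^ 2 * P.qp *
      (1 - (Matrix.of (Fin.cons (Fin.snoc (α := fun _ => ℂ) G 0)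
        (fun j => Fin.snoc (α := fun _ => ℂ) (M j) (F j)))).det / M.det) := by
  have hdet : M.det ≠ 0 := by
    rw [hM]
    exact det_one_sub_cauchy_ne_zero η (fun k => C k x) G
      (fun k l => conj_ne_of_mem_D₁ (hη k) (hη l)) hG
  refine ⟨hdet, ?_⟩
  have hexp : ∀ x i, ∀ ζ ∈ D₁ P, dual (n ζ x) i = ![conj (gauge f x), 0] i +
      (-Complex.I * conj P.qp * ![0, gauge f x] i) / conj ζ +
      ∑ k, C k x * n (η k) x i / (conj ζ - η k) := by
    intro x i ζ hζ
    have hcoef : ∀ k, deriv (coefA P n m x) (η k) = deriv (coefA P n m 0) (η k) := fun k =>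
      Filter.EventuallyEq.deriv_eq (by
        filter_upwards [S₁_mem_nhds (hη k)] with ζ hζ using h.coefA_eq hζ x 0)
    refine h.explicit hinj hη (fun ζ hζ => ?_) (fun k => ?_) (fun k => ?_) i hζ
    · rw [h.coefA_eq (Or.inr hζ) x 0]
      exact hz ζ hζ
    · rw [hcoef]
      exact hd k
    · rw [hcoef]
      exact hC k x
  have hn0 : ∀ x, ∀ ζ ∈ D₁ P, n ζ x 0 = -Complex.I * P.qp * conj (gauge f x) / ζ -
      ∑ k, conj (C k x) * conj (n (η k) x 1) / (ζ - conj (η k)) := by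
    intro x ζ hζ
    have := congrArg conj (hexp x 1 ζ hζ)
    simp at this
    rw [neg_eq_iff_eq_neg.1 this]
    ring
  have hpot := h.potential_eq hη hCd hn0 x
  set g := gauge f x with hg
  have hgg : g * conj g = 1 := gauge_mul_conj f x
  have hqp := P.qp_ne
  -- The unknowns of the linear system. The second component of the explicit formula expresses
  -- n₀(η_k) through r, the first one expresses r through n₀(η_k); eliminating n₀ gives M r = yF.
  set r : Fin K → ℂ := fun j => conj (n (η j) x 1) with hr
  set y : ℂ := -Complex.I * P.qp * conj g with hy
  have hp : ∀ k, n (η k) x 0 = y / η k + ∑ l, G l / (η k - conj (η l)) * r l := by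
    intro k
    rw [hn0 x _ (hη k), sub_eq_add_neg, ← Finset.sum_neg_distrib]
    congr 1
    refine Finset.sum_congr rfl fun l _ => ?_
    rw [hG]
    ring
  have hr' : ∀ j, r j = conj g + ∑ k, C k x / (conj (η j) - η k) * n (η k) x 0 := by
    intro j
    have := hexp x 0 (η j) (hη j)
    simp at this
    rw [hr]
    simp only
    rw [this]
    congr 1
    refine Finset.sum_congr rfl fun l _ => ?_
    ring
  have hMr : M *ᵥ r = y • F := by
    ext j
    have e1 : (M *ᵥ r) j = r j - ∑ k, C k x / (conj (η j) - η k) *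
        ∑ l, G l / (η k - conj (η l)) * r l := by
      rw [hM]
      simp only [Matrix.mulVec, dotProduct, Matrix.of_apply, sub_mul, Finset.sum_sub_distrib,
        ite_mul, one_mul, zero_mul, Finset.sum_ite_eq, Finset.mem_univ, if_true, Finset.sum_mul]
      congr 1
      rw [Finset.sum_comm]
      refine Finset.sum_congr rfl fun k _ => ?_
      rw [Finset.mul_sum]
      refine Finset.sum_congr rfl fun l _ => ?_
      ring
    have e2 : ∀ k, ∑ l, G l / (η k - conj (η l)) * r l = n (η k) x 0 - y / η k := fun k => by
      rw [hp k]
      ring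
    rw [e1]
    simp only [e2, mul_sub, Finset.sum_sub_distrib]
    rw [hr' j, Pi.smul_apply, smul_eq_mul, hF, mul_add, Finset.mul_sum]
    have e3 : y * (Complex.I / P.qp) = conj g := by
      rw [hy]
      field_simp
      rw [Complex.I_sq]
      ring
    have e4 : ∀ k, y * (C k x / ((conj (η j) - η k) * η k)) =
        C k x / (conj (η j) - η k) * (y / η k) := fun k => by
      rw [div_mul_div_comm, mul_div_assoc']
      ring
    simp only [e3, e4]
    ring
  have hb := mul_det_bordered hK M G F r y hMr
  set Δ := (Matrix.of (Fin.cons (Fin.snoc (α := fun _ => ℂ) G 0)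
        (fun j => Fin.snoc (α := fun _ => ℂ) (M j) (F j)))).det
  have hGr : G ⬝ᵥ r = -(y * Δ / M.det) := by
    rw [hb]
    field_simp
  have hsum : ∑ k, conj (C k x) * conj (n (η k) x 1) = -(G ⬝ᵥ r) := by
    rw [dotProduct, ← Finset.sum_neg_distrib]
    refine Finset.sum_congr rfl fun k _ => ?_
    rw [hG]
    ring
  rw [hsum, hGr] at hpot
  have : u x = u x * g * conj g := by rw [mul_assoc, hgg, mul_one]
  rw [this, hpot, hy]
  linear_combination (-P.qp * conj g ^ 2 * (1 - Δ / M.det)) * Complex.I_sq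

end Pair

/-! ### The Lax pair at a fixed time -/

section Potential

variable {P : Params}

/-- Since |w| = q₀, the difference of squares factors as (|u|-|w|)(|u|+|w|); the second factor is
bounded on the half line and the first is at most |u-w|. This yields both the weighted decay of f
and the convergence of the integral in ω₊. -/
theorem integrableOn_weighted_sq {w : ℂ} {u : ℝ → ℂ} (hw : conj w * w = (P.q₀ : ℂ) ^ 2)
    (hu : Continuous u) (ht : Tendsto u atTop (𝓝 w))
    (hi : IntegrableOn (fun y => (1 + |y|) ^ 2 * ‖u y - w‖) (Set.Ioi 0)) :
    IntegrableOn (fun y => (1 + |y|) ^ 2 * |‖u y‖ ^ 2 - P.q₀ ^ 2|) (Set.Ioi 0) := by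
  obtain ⟨B, hB⟩ := bddAbove_norm_of_tendsto hu ht 0
  have hwn : ‖w‖ ^ 2 = P.q₀ ^ 2 := by
    rw [← Complex.normSq_eq_conj_mul_self, Complex.normSq_eq_norm_sq] at hw
    exact_mod_cast hw
  refine Integrable.mono' (hi.const_mul (B + ‖w‖))
    (Continuous.aestronglyMeasurable (by fun_prop))
    ((ae_restrict_iff' measurableSet_Ioi).2 (Eventually.of_forall fun y hy => ?_))
  have h1 := hB y (le_of_lt hy)
  have h2 : |‖u y‖ ^ 2 - P.q₀ ^ 2| ≤ (B + ‖w‖) * ‖u y - w‖ := by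
    rw [← hwn, sq_sub_sq, abs_mul, abs_of_nonneg (by positivity)]
    exact mul_le_mul (by linarith) (abs_norm_sub_norm_le _ _) (abs_nonneg _)
      (by linarith [norm_nonneg (u y), norm_nonneg w])
  rw [Real.norm_of_nonneg (by positivity)]
  calc _ ≤ (1 + |y|) ^ 2 * ((B + ‖w‖) * ‖u y - w‖) := by gcongr
    _ = _ := by ring

theorem isPotential_of_tendsto {w : ℂ} {u : ℝ → ℂ} (hw : conj w * w = (P.q₀ : ℂ) ^ 2)
    (hu : ContDiff ℝ 1 u) (ht : Tendsto u atTop (𝓝 w))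
    (hi : IntegrableOn (fun y => (1 + |y|) ^ 2 * ‖u y - w‖) (Set.Ioi 0)) :
    IsPotential P w u (fun y => P.T * (‖u y‖ ^ 2 - P.q₀ ^ 2)) := by
  have huc := hu.continuous
  refine ⟨hw, hu, by fun_prop, hi, ?_⟩
  refine ((integrableOn_weighted_sq hw huc ht hi).const_mul |P.T|).congr
    (Eventually.of_forall fun y => ?_)
  simp only [abs_mul]
  ring

end Potential

/-- The off-diagonal potential `q e^{-iΥ}` at time `t`. -/
def potU (P : Params) (q : ℝ → ℝ → ℂ) (t x : ℝ) : ℂ :=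
  q x t * Complex.exp (-Complex.I * Ups P x t)

/-- The diagonal potential `T(|q|² - q₀²)` at time `t`. -/
def potF (P : Params) (q : ℝ → ℝ → ℂ) (t x : ℝ) : ℝ := P.T * (‖q x t‖ ^ 2 - P.q₀ ^ 2)

section Solution

variable {P : Params} {q : ℝ → ℝ → ℂ}

theorem norm_exp_Ups (r : ℝ) : ‖Complex.exp (-Complex.I * (r : ℂ))‖ = 1 := by
  rw [show -Complex.I * (r : ℂ) = ((-r : ℝ) : ℂ) * Complex.I by push_cast; ring,
    Complex.norm_exp_ofReal_mul_I]

theorem norm_potU (t x : ℝ) : ‖potU P q t x‖ = ‖q x t‖ := by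
  rw [potU, norm_mul, norm_exp_Ups, mul_one]

theorem conj_potU (t x : ℝ) :
    conj (potU P q t x) = conj (q x t) * Complex.exp (Complex.I * Ups P x t) := by
  rw [potU, map_mul, ← Complex.exp_conj]
  simp

theorem norm_potU_sub (w : ℂ) (t x : ℝ) :
    ‖potU P q t x - w‖ = ‖q x t - w * Complex.exp (Complex.I * Ups P x t)‖ := by
  have e : potU P q t x - w = Complex.exp (-Complex.I * Ups P x t) *
      (q x t - w * Complex.exp (Complex.I * Ups P x t)) := by
    have : Complex.exp (-Complex.I * Ups P x t) * Complex.exp (Complex.I * Ups P x t) = 1 := by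
      rw [← Complex.exp_add]
      simp
    rw [potU]
    linear_combination w * this
  rw [e, norm_mul, norm_exp_Ups, one_mul]

theorem IsSolution.contDiff_potU (hq : IsSolution P q) (t : ℝ) : ContDiff ℝ 1 (potU P q t) := by
  have h1 : ContDiff ℝ 1 fun x => q x t := (hq.contDiff_x t).of_le (by norm_num)
  have h2 : ContDiff ℝ 1 fun x : ℝ => Complex.exp (-Complex.I * Ups P x t) := by
    have h3 : ContDiff ℝ 1 fun x : ℝ => ((Ups P x t : ℝ) : ℂ) := by
      refine Complex.ofRealCLM.contDiff.comp ?_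
      exact (contDiff_const.mul contDiff_id).add contDiff_const
    exact (contDiff_const.mul h3).cexp
  exact h1.mul h2

theorem IsSolution.tendsto_potU_top (hq : IsSolution P q) (t : ℝ) :
    Tendsto (potU P q t) atTop (𝓝 P.qp) :=
  (hq.tendsto_top t).congr fun _ => mul_comm _ _

theorem IsSolution.tendsto_potU_bot (hq : IsSolution P q) (t : ℝ) :
    Tendsto (potU P q t) atBot (𝓝 P.qm) :=
  (hq.tendsto_bot t).congr fun _ => mul_comm _ _

theorem IsSolution.integrableOn_potU (hq : IsSolution P q) (t : ℝ) :
    IntegrableOn (fun y => (1 + |y|) ^ 2 * ‖potU P q t y - P.qp‖) (Set.Ioi 0) := by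
  simp only [norm_potU_sub]
  exact (hq.decay_top t).mono_set Set.Ioi_subset_Ici_self

theorem IsSolution.isPotential_top (hq : IsSolution P q) (t : ℝ) :
    IsPotential P P.qp (potU P q t) (potF P q t) := by
  have := isPotential_of_tendsto (conj_qp_mul_qp P) (hq.contDiff_potU t) (hq.tendsto_potU_top t)
    (hq.integrableOn_potU t)
  simp only [norm_potU] at this
  exact this

theorem IsSolution.isPotential_bot (hq : IsSolution P q) (t : ℝ) :
    IsPotential P (conj P.qm) (fun x => conj (potU P q t (-x))) (fun x => potF P q t (-x)) := by
  have h1 : conj (conj P.qm) * conj P.qm = (P.q₀ : ℂ) ^ 2 := by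
    rw [Complex.conj_conj, mul_comm]
    exact conj_qm_mul_qm P
  have h2 : ContDiff ℝ 1 fun x => conj (potU P q t (-x)) :=
    Complex.conjCLE.contDiff.comp ((hq.contDiff_potU t).comp contDiff_neg)
  have h3 : Tendsto (fun x => conj (potU P q t (-x))) atTop (𝓝 (conj P.qm)) :=
    (Complex.continuous_conj.tendsto _).comp
      ((hq.tendsto_potU_bot t).comp tendsto_neg_atTop_atBot)
  have h4 : IntegrableOn (fun y => (1 + |y|) ^ 2 * ‖conj (potU P q t (-y)) - conj P.qm‖)
      (Set.Ioi 0) := by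
    have h5 : IntegrableOn (fun y => (1 + |y|) ^ 2 * ‖potU P q t y - P.qm‖) (Set.Iio (-0)) := by
      simp only [norm_potU_sub, neg_zero]
      exact (hq.decay_bot t).mono_set Set.Iio_subset_Iic_self
    have h6 := h5.comp_neg_Ioi
    refine h6.congr_fun (fun y _ => ?_) measurableSet_Ioi
    simp only [abs_neg]
    rw [← map_sub, Complex.norm_conj]
  have := isPotential_of_tendsto h1 h2 h3 h4
  simp only [Complex.norm_conj, norm_potU] at this
  exact this

theorem IsSolution.integrableOn_sq (hq : IsSolution P q) (x t : ℝ) :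
    IntegrableOn (fun y => ‖q y t‖ ^ 2 - P.q₀ ^ 2) (Set.Ioi x) := by
  have hc : Continuous fun y => ‖q y t‖ ^ 2 - P.q₀ ^ 2 := by
    have := (hq.contDiff_x t).continuous
    fun_prop
  have h1 := integrableOn_weighted_sq (conj_qp_mul_qp P) (hq.contDiff_potU t).continuous
    (hq.tendsto_potU_top t) (hq.integrableOn_potU t)
  simp only [norm_potU] at h1
  refine integrableOn_Ioi_of_continuous hc (a := 0) ?_ x
  refine Integrable.mono' h1 hc.aestronglyMeasurable (Eventually.of_forall fun y => ?_)
  rw [Real.norm_eq_abs]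
  exact le_mul_of_one_le_left (abs_nonneg _) (one_le_pow₀ (by linarith [abs_nonneg y]))

theorem gauge_potF (x t : ℝ) :
    gauge (potF P q t) x = Complex.exp (Complex.I * (omegaP P q x t : ℝ)) := by
  unfold gauge potF omegaP
  rw [integral_const_mul]

/-! ### From the Lax pair to the normalized columns -/

theorem hasDerivAt_Theta (x t : ℝ) (ζ : ℂ) :
    HasDerivAt (fun x : ℝ => Theta P x t ζ) (lam P ζ) x := by
  have := ((Complex.ofRealCLM.hasDerivAt (x := x)).add_const
    (2 * (specZ P ζ + P.T * (P.q₀ : ℂ) ^ 2 - P.α / 2) * t)).const_mul (lam P ζ)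
  rw [Complex.ofRealCLM_apply, Complex.ofReal_one, mul_one] at this
  exact this

theorem Theta_zero (ζ : ℂ) : Theta P 0 0 ζ = 0 := by simp [Theta]

theorem SolvesLax.hasDerivAt_smul {ζ : ℂ} {v : ℝ → ℝ → Fin 2 → ℂ} (h : SolvesLax P q ζ v)
    (c : ℂ) (x t : ℝ) : HasDerivAt (fun x => Complex.exp (c * Theta P x t ζ) • v x t)
      ((c * lam P ζ) • Complex.exp (c * Theta P x t ζ) • v x t +
        laxX P q x t ζ *ᵥ (Complex.exp (c * Theta P x t ζ) • v x t)) x := by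
  have := ((hasDerivAt_Theta (P := P) x t ζ).const_mul c).cexp.smul (h.1 x t)
  refine this.congr_deriv ?_
  rw [Matrix.mulVec_smul, add_comm, smul_smul, mul_comm (c * lam P ζ)]

/-- As z + α/2 = k + Tq₀² with k = `kap`, the constant Tq₀² moves from the spectral term into the
diagonal potential and turns T|q|² into the decaying f. -/
theorem laxX_mulVec (x t : ℝ) (ζ : ℂ) (v : Fin 2 → ℂ) : laxX P q x t ζ *ᵥ v =
    ![(Complex.I * potF P q t x - Complex.I * kap P ζ) * v 0 + potU P q t x * v 1,
      -conj (potU P q t x) * v 0 +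
        (-Complex.I * potF P q t x + Complex.I * kap P ζ) * v 1] := by
  rw [conj_potU]
  ext i
  fin_cases i
  · simp [-mul_eq_mul_left_iff, -mul_eq_mul_right_iff, laxX, potF, potU, specZ_eq, Matrix.mulVec, dotProduct, Fin.sum_univ_two]
    ring
  · simp [-mul_eq_mul_left_iff, -mul_eq_mul_right_iff, laxX, potF, specZ_eq, Matrix.mulVec, dotProduct, Fin.sum_univ_two]
    ring

theorem SolvesLax.isJostColumn {ζ : ℂ} {v : ℝ → ℝ → Fin 2 → ℂ} (h : SolvesLax P q ζ v) {t : ℝ}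
    {w : ℂ} (hl : Tendsto (fun x => Complex.exp (-Complex.I * Theta P x t ζ) • v x t) atTop
      (𝓝 (fun i => bgE w ζ i 1))) : IsJostColumn P w (potU P q t) (potF P q t) ζ
      (fun x => Complex.exp (-Complex.I * Theta P x t ζ) • v x t) := by
  refine ⟨fun x => ?_, ?_⟩
  · refine (h.hasDerivAt_smul (-Complex.I) x t).congr_deriv ?_
    rw [laxX_mulVec]
    generalize Complex.exp (-Complex.I * Theta P x t ζ) • v x t = y
    have h1 := lam_add_kap P ζ
    have h2 := lam_sub_kap P ζ
    ext i
    fin_cases i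
    · change -Complex.I * lam P ζ * y 0 + ((Complex.I * potF P q t x - Complex.I * kap P ζ) * y 0 +
        potU P q t x * y 1) = (Complex.I * potF P q t x - Complex.I * ζ) * y 0 +
        potU P q t x * y 1
      linear_combination (-Complex.I * y 0) * h1
    · change -Complex.I * lam P ζ * y 1 + (-conj (potU P q t x) * y 0 +
        (-Complex.I * potF P q t x + Complex.I * kap P ζ) * y 1) = -conj (potU P q t x) * y 0 +
        (-Complex.I * potF P q t x - Complex.I * ((P.q₀ : ℂ) ^ 2 / ζ)) * y 1
      linear_combination (-Complex.I * y 1) * h2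
  · have e : (fun i => bgE w ζ i 1) = ![-Complex.I * w / ζ, 1] := by
      ext i
      fin_cases i <;> simp [bgE]
    rw [← e]
    exact hl

theorem SolvesLax.hasDerivAt_first {ζ : ℂ} {v : ℝ → ℝ → Fin 2 → ℂ} (h : SolvesLax P q ζ v)
    (x t : ℝ) : HasDerivAt (fun x => Complex.exp (Complex.I * Theta P x t ζ) • v x t)
      ![(Complex.I * potF P q t x + Complex.I * ((P.q₀ : ℂ) ^ 2 / ζ)) *
          (Complex.exp (Complex.I * Theta P x t ζ) • v x t) 0 +
          potU P q t x * (Complex.exp (Complex.I * Theta P x t ζ) • v x t) 1,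
        -conj (potU P q t x) * (Complex.exp (Complex.I * Theta P x t ζ) • v x t) 0 +
          (-Complex.I * potF P q t x + Complex.I * ζ) *
          (Complex.exp (Complex.I * Theta P x t ζ) • v x t) 1] x := by
  refine (h.hasDerivAt_smul Complex.I x t).congr_deriv ?_
  rw [laxX_mulVec]
  generalize Complex.exp (Complex.I * Theta P x t ζ) • v x t = y
  have h1 := lam_add_kap P ζ
  have h2 := lam_sub_kap P ζ
  ext i
  fin_cases i
  · change Complex.I * lam P ζ * y 0 + ((Complex.I * potF P q t x - Complex.I * kap P ζ) * y 0 +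
      potU P q t x * y 1) = (Complex.I * potF P q t x + Complex.I * ((P.q₀ : ℂ) ^ 2 / ζ)) * y 0 +
      potU P q t x * y 1
    linear_combination (Complex.I * y 0) * h2
  · change Complex.I * lam P ζ * y 1 + (-conj (potU P q t x) * y 0 +
      (-Complex.I * potF P q t x + Complex.I * kap P ζ) * y 1) = -conj (potU P q t x) * y 0 +
      (-Complex.I * potF P q t x + Complex.I * ζ) * y 1
    linear_combination (Complex.I * y 1) * h1

theorem bgE_first (w ζ : ℂ) : (fun i => bgE w ζ i 0) = ![1, -Complex.I * conj w / ζ] := by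
  ext i
  fin_cases i <;> simp [bgE]

theorem SolvesLax.isJostColumn_reflect {ζ : ℂ} {v : ℝ → ℝ → Fin 2 → ℂ} (h : SolvesLax P q ζ v)
    {t : ℝ} {w : ℂ} (hl : Tendsto (fun x => Complex.exp (Complex.I * Theta P x t ζ) • v x t) atBot
      (𝓝 (fun i => bgE w ζ i 0))) :
    IsJostColumn P (conj w) (fun x => conj (potU P q t (-x))) (fun x => potF P q t (-x)) ζ
      (fun x => swap (Complex.exp (Complex.I * Theta P (-x) t ζ) • v (-x) t)) := by
  refine ⟨fun x => ?_, ?_⟩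
  · have h0 := (hasDerivAt_pi.1 (h.hasDerivAt_first (-x) t) 0).scomp x (hasDerivAt_neg x)
    have h1 := (hasDerivAt_pi.1 (h.hasDerivAt_first (-x) t) 1).scomp x (hasDerivAt_neg x)
    refine (hasDerivAt_vec2 h1 h0).congr_deriv ?_
    generalize hy : Complex.exp (Complex.I * Theta P (-x) t ζ) • v (-x) t = y
    ext i
    fin_cases i
    · simp [-mul_eq_mul_left_iff, -mul_eq_mul_right_iff, ← hy]
      ring
    · simp [-mul_eq_mul_left_iff, -mul_eq_mul_right_iff, ← hy]
      ring
  · rw [bgE_first] at hl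
    exact (continuous_swap.tendsto _).comp (hl.comp tendsto_neg_atTop_atBot)

/-! ### Wronskians of solutions of the Lax pair -/

theorem hasDerivAt_det2_of_trace {A : ℝ → Matrix (Fin 2) (Fin 2) ℂ} {v w : ℝ → Fin 2 → ℂ} {x : ℝ}
    (hA : A x 0 0 + A x 1 1 = 0) (hv : HasDerivAt v (A x *ᵥ v x) x)
    (hw : HasDerivAt w (A x *ᵥ w x) x) : HasDerivAt (fun x => det2 (v x) (w x)) 0 x := by
  refine (hasDerivAt_det2 hv hw).congr_deriv ?_
  simp only [det2, Matrix.mulVec, dotProduct, Fin.sum_univ_two]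
  linear_combination (v x 0 * w x 1 - v x 1 * w x 0) * hA

theorem SolvesLax.det2_eq {ζ : ℂ} {v w : ℝ → ℝ → Fin 2 → ℂ} (hv : SolvesLax P q ζ v)
    (hw : SolvesLax P q ζ w) (x t : ℝ) : det2 (v x t) (w x t) = det2 (v 0 0) (w 0 0) := by
  have h1 : det2 (v x t) (w x t) = det2 (v 0 t) (w 0 t) :=
    eq_of_hasDerivAt_zero (g := fun x => det2 (v x t) (w x t)) (fun x =>
      hasDerivAt_det2_of_trace (A := fun x => laxX P q x t ζ) (by simp [laxX]) (hv.1 x t)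
        (hw.1 x t)) x 0
  have h2 : det2 (v 0 t) (w 0 t) = det2 (v 0 0) (w 0 0) :=
    eq_of_hasDerivAt_zero (g := fun t => det2 (v 0 t) (w 0 t)) (fun t =>
      hasDerivAt_det2_of_trace (A := fun t => laxT P q 0 t ζ) (by simp [laxT]) (hv.2 0 t)
        (hw.2 0 t)) t 0
  rw [h1, h2]

/-- Two solutions of a linear system whose determinant vanishes are proportional. -/
theorem eq_smul_of_det2_eq_zero {A : ℝ → Matrix (Fin 2) (Fin 2) ℂ} {v w : ℝ → Fin 2 → ℂ}
    (hv : ∀ x, HasDerivAt v (A x *ᵥ v x) x) (hw : ∀ x, HasDerivAt w (A x *ᵥ w x) x)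
    (hw0 : ∀ x, w x ≠ 0) (hdet : ∀ x, det2 (v x) (w x) = 0) {x₀ : ℝ} {b : ℂ}
    (hb : v x₀ = b • w x₀) (x : ℝ) : v x = b • w x := by
  have hden : ∀ x, conj (w x 0) * w x 0 + conj (w x 1) * w x 1 ≠ 0 := by
    intro x e
    refine hw0 x ?_
    simp only [← Complex.normSq_eq_conj_mul_self] at e
    have e' : Complex.normSq (w x 0) + Complex.normSq (w x 1) = 0 := by exact_mod_cast e
    have h0 := Complex.normSq_nonneg (w x 0)
    have h1 := Complex.normSq_nonneg (w x 1)
    have z0 : w x 0 = 0 := Complex.normSq_eq_zero.1 (by linarith)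
    have z1 : w x 1 = 0 := Complex.normSq_eq_zero.1 (by linarith)
    ext i
    fin_cases i
    · exact z0
    · exact z1
  -- The coefficient of the projection of v on w, differentiable because w never vanishes. Both
  -- functions solve the same system, so differentiating v = βw leaves β'w = 0.
  set β : ℝ → ℂ := fun x => (conj (w x 0) * v x 0 + conj (w x 1) * v x 1) /
    (conj (w x 0) * w x 0 + conj (w x 1) * w x 1) with hβ
  have hvβ : ∀ x, v x = β x • w x := by
    intro x
    have hd : v x 0 * w x 1 - v x 1 * w x 0 = 0 := hdet x
    have h := hden x
    ext i
    rw [Pi.smul_apply, smul_eq_mul, hβ]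
    simp only
    rw [div_mul_eq_mul_div, eq_div_iff h]
    fin_cases i
    · simp only [Fin.zero_eta]
      linear_combination conj (w x 1) * hd
    · simp only [Fin.mk_one]
      linear_combination (-conj (w x 0)) * hd
  have hβd : ∀ x, DifferentiableAt ℝ β x := by
    intro x
    have a := hasDerivAt_pi.1 (hv x)
    have c := hasDerivAt_pi.1 (hw x)
    exact ((((c 0).star.mul (a 0)).add ((c 1).star.mul (a 1))).div
      (((c 0).star.mul (c 0)).add ((c 1).star.mul (c 1))) (hden x)).differentiableAt
  have hβ0 : ∀ x, HasDerivAt β 0 x := by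
    intro x
    have h1 := (hβd x).hasDerivAt.smul (hw x)
    have h2 : HasDerivAt v (β x • A x *ᵥ w x + deriv β x • w x) x := by
      have : v = fun x => β x • w x := funext hvβ
      rw [this]
      exact h1
    have h3 := h2.unique (hv x)
    rw [hvβ x, Matrix.mulVec_smul, add_eq_left] at h3
    have h4 := (smul_eq_zero.1 h3).resolve_right (hw0 x)
    rw [← h4]
    exact (hβd x).hasDerivAt
  have hβb : β x₀ = b := by
    have h1 : (β x₀ - b) • w x₀ = 0 := by rw [sub_smul, ← hvβ, hb, sub_self]
    exact sub_eq_zero.1 ((smul_eq_zero.1 h1).resolve_right (hw0 x₀))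
  rw [hvβ x, eq_of_hasDerivAt_zero hβ0 x x₀, hβb]

/-- The proportionality at (0,0) is carried along t at x = 0 and then along x at each t. Hence b is
the same at all (x,t), and the evolution of the discrete data sits entirely in e^{2iΘ}. -/
theorem SolvesLax.eq_smul {ζ : ℂ} {v w : ℝ → ℝ → Fin 2 → ℂ} (hv : SolvesLax P q ζ v)
    (hw : SolvesLax P q ζ w) (hw0 : ∀ x t, w x t ≠ 0) {b : ℂ} (hb : v 0 0 = b • w 0 0) (x t : ℝ) :
    v x t = b • w x t := by
  have hdet : ∀ x t, det2 (v x t) (w x t) = 0 := fun x t => by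
    rw [hv.det2_eq hw, hb]
    simp only [det2, Pi.smul_apply, smul_eq_mul]
    ring
  have h1 := eq_smul_of_det2_eq_zero (A := fun t => laxT P q 0 t ζ) (fun t => hv.2 0 t)
    (fun t => hw.2 0 t) (hw0 0) (hdet 0) hb t
  exact eq_smul_of_det2_eq_zero (A := fun x => laxX P q x t ζ) (fun x => hv.1 x t)
    (fun x => hw.1 x t) (fun x => hw0 x t) (fun x => hdet x t) h1 x

/-- A Jost column never vanishes. -/
theorem IsJostColumn.ne_zero {w : ℂ} {u : ℝ → ℂ} {f : ℝ → ℝ} (hP : IsPotential P w u f) {ζ : ℂ}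
    {ν : ℝ → Fin 2 → ℂ} (h : IsJostColumn P w u f ζ ν) (x₀ : ℝ) : ν x₀ ≠ 0 := by
  intro h0
  set L : ℝ → (Fin 2 → ℂ) →L[ℂ] (Fin 2 → ℂ) := fun y =>
    (bgOp P w ζ - (Complex.I * lam P ζ) • 1) + potOp w u f y with hL
  have hLc : Continuous L := continuous_const.add hP.continuous_potOp
  -- Uniqueness for the linear equation propagates a zero to the right, against the limit at +∞,
  -- whose second entry is 1.
  have hz : ∀ x, x₀ ≤ x → ν x = 0 := by
    intro x hx
    obtain ⟨B, hB⟩ := (isCompact_Icc (a := x₀) (b := x)).exists_bound_of_continuousOn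
      hLc.continuousOn
    have hB0 : 0 ≤ B := (norm_nonneg _).trans (hB x₀ ⟨le_rfl, hx⟩)
    refine ODE_solution_unique_of_mem_Icc_right (v := fun y p => L y p) (s := fun _ => Set.univ)
      (K := ⟨B, hB0⟩) (f := ν) (g := fun _ => 0) (a := x₀) (b := x) (fun y hy => ?_)
      (fun y _ => (h.ode y).continuousAt.continuousWithinAt) (fun y _ => ?_)
      (fun _ _ => Set.mem_univ _) continuousOn_const (fun y _ => ?_) (fun _ _ => Set.mem_univ _)
      h0 ⟨hx, le_rfl⟩
    · exact ((L y).lipschitz.weaken (hB y ⟨hy.1, hy.2.le⟩)).lipschitzOnWith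
    · exact (h.hasDerivAt y).hasDerivWithinAt
    · simpa using hasDerivWithinAt_const (F := Fin 2 → ℂ) y (Set.Ici y) 0
  have h1 : Tendsto ν atTop (𝓝 0) := tendsto_const_nhds.congr' (by
    filter_upwards [eventually_ge_atTop x₀] with x hx using (hz x hx).symm)
  have := congrFun (tendsto_nhds_unique h.lim h1) 1
  simp at this

end Solution

/-! ### The Jost pair of a reflectionless solution -/

/-- The normalized column `e^{-iΘ}ψ₊₂` at time `t`. -/
def jostN (P : Params) (ψp : ℝ → ℝ → ℂ → Matrix (Fin 2) (Fin 2) ℂ) (t : ℝ) (ζ : ℂ) (x : ℝ) :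
    Fin 2 → ℂ :=
  Complex.exp (-Complex.I * Theta P x t ζ) • colFn ψp 1 ζ x t

/-- The normalized column `e^{iΘ}ψ₋₁` at time `t`. -/
def jostM (P : Params) (ψm : ℝ → ℝ → ℂ → Matrix (Fin 2) (Fin 2) ℂ) (t : ℝ) (ζ : ℂ) (x : ℝ) :
    Fin 2 → ℂ :=
  Complex.exp (Complex.I * Theta P x t ζ) • colFn ψm 0 ζ x t

section Data

variable {P : Params} {q : ℝ → ℝ → ℂ} {ψp ψm : ℝ → ℝ → ℂ → Matrix (Fin 2) (Fin 2) ℂ}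

theorem IsJost.jostN_isJostColumn (hψ : IsJost P q ψp ψm) (t : ℝ) {ζ : ℂ} (hζ : ζ ∈ S₁ P) :
    IsJostColumn P P.qp (potU P q t) (potF P q t) ζ (jostN P ψp t ζ) :=
  (hψ.lax_p₂ ζ hζ).isJostColumn (hψ.asymp_p₂ ζ hζ t)

/-- On Σ the dual of the second column at ζ̄ has the equation and the asymptotics of the first
column ψ₊₁ at ζ, so uniqueness identifies the two. -/
theorem IsJost.dual_jostN (hψ : IsJost P q ψp ψm) (hq : IsSolution P q) (t : ℝ) {ζ : ℂ}
    (hζ : ζ ∈ Sig P) (x : ℝ) : dual (jostN P ψp t (conj ζ) x) =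
      Complex.exp (Complex.I * Theta P x t ζ) • colFn ψp 0 ζ x t := by
  have hl := hψ.asymp_p₁ ζ (Or.inl hζ) t
  rw [bgE_first] at hl
  have h1 := IsJostColumn.of_dual
    (fun x => (hψ.lax_p₁ ζ (Or.inl hζ)).hasDerivAt_first x t) hl
  have hS : conj ζ ∈ S₁ P := Or.inl (conj_mem_Sig hζ)
  rw [(hψ.jostN_isJostColumn t hS).unique (hq.isPotential_top t) hS h1 x]
  ext i
  fin_cases i <;> simp [dual]

theorem det2_exp_smul (c d : ℂ) (v w : Fin 2 → ℂ) : det2 (c • v) (d • w) = c * d * det2 v w := by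
  simp only [det2, Pi.smul_apply, smul_eq_mul]
  ring

/-- s₂₁ is this determinant at (0,0) divided by det ψ₊. The Wronskian gives det ψ₊ = 1 + q₀²/ζ² ≠ 0,
so the matrix inverse in `scatS` is a genuine one. -/
theorem IsJost.det2_first_eq_zero (hψ : IsJost P q ψp ψm) (hq : IsSolution P q)
    (hr : ∀ w ∈ Sig P, scatS ψp ψm w 1 0 = 0) {ζ : ℂ} (hζ : ζ ∈ Sig P) (x t : ℝ) :
    det2 (colFn ψp 0 ζ x t) (colFn ψm 0 ζ x t) = 0 := by
  rw [(hψ.lax_p₁ ζ (Or.inl hζ)).det2_eq (hψ.lax_m₁ ζ (Or.inl hζ))]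
  have hS : ζ ∈ S₁ P := Or.inl hζ
  have hw := (hψ.jostN_isJostColumn 0 hS).wronskian (ne_zero_of_mem_S₁ P hS) (conj_qp_mul_qp P)
    (hψ.jostN_isJostColumn 0 (Or.inl (conj_mem_Sig hζ))) 0
  rw [hψ.dual_jostN hq 0 hζ 0] at hw
  simp only [jostN, Theta_zero, mul_zero, Complex.exp_zero, one_smul] at hw
  have hdet : (ψp 0 0 ζ).det = 1 + (P.q₀ : ℂ) ^ 2 / ζ ^ 2 := by
    rw [← hw, Matrix.det_fin_two]
    simp only [det2, colFn]
    ring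
  have h1 := hr ζ hζ
  rw [scatS, Matrix.inv_def, Matrix.adjugate_fin_two, hdet] at h1
  simp only [Matrix.smul_apply, Matrix.mul_apply, Fin.sum_univ_two,
    smul_eq_mul, Ring.inverse_eq_inv', mul_assoc, ← mul_add] at h1
  have h2 := (mul_eq_zero.1 h1).resolve_left (inv_ne_zero (one_add_ne_zero hS))
  simp at h2
  simp only [det2, colFn]
  linear_combination h2

theorem IsJost.isJostPair (hψ : IsJost P q ψp ψm) (hq : IsSolution P q)
    (hr : ∀ w ∈ Sig P, scatS ψp ψm w 1 0 = 0) (t : ℝ) :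
    IsJostPair P (potU P q t) (potF P q t) (jostN P ψp t) (jostM P ψm t) where
  pot_p := hq.isPotential_top t
  pot_m := hq.isPotential_bot t
  col_p _ hζ := hψ.jostN_isJostColumn t hζ
  col_m ζ hζ := (hψ.lax_m₁ ζ hζ).isJostColumn_reflect (hψ.asymp_m₁ ζ hζ t)
  reflectionless ζ hζ x := by
    rw [hψ.dual_jostN hq t hζ, jostM, det2_exp_smul, hψ.det2_first_eq_zero hq hr hζ, mul_zero]

theorem IsJost.coefA_eq_scatA (hψ : IsJost P q ψp ψm) {ζ : ℂ} (hζ : ζ ∈ S₁ P) (x t : ℝ) :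
    coefA P (jostN P ψp t) (jostM P ψm t) x ζ = scatA P ψp ψm ζ := by
  rw [coefA, jostN, jostM, det2_exp_smul, ← Complex.exp_add,
    (hψ.lax_m₁ ζ hζ).det2_eq (hψ.lax_p₂ ζ hζ), show Complex.I * Theta P x t ζ +
      -Complex.I * Theta P x t ζ = 0 by ring, Complex.exp_zero, one_mul]
  rfl

theorem IsJost.ne_zero (hψ : IsJost P q ψp ψm) (hq : IsSolution P q) {ζ : ℂ} (hζ : ζ ∈ S₁ P)
    (x t : ℝ) : colFn ψp 1 ζ x t ≠ 0 := fun e =>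
  (hψ.jostN_isJostColumn t hζ).ne_zero (hq.isPotential_top t) x (by rw [jostN, e, smul_zero])

theorem IsJost.jostM_eq_smul (hψ : IsJost P q ψp ψm) (hq : IsSolution P q) {ζ b : ℂ}
    (hζ : ζ ∈ S₁ P) (hb : colFn ψm 0 ζ 0 0 = b • colFn ψp 1 ζ 0 0) (x t : ℝ) :
    jostM P ψm t ζ x =
      (b * Complex.exp (2 * Complex.I * Theta P x t ζ)) • jostN P ψp t ζ x := by
  rw [jostM, jostN, (hψ.lax_m₁ ζ hζ).eq_smul (hψ.lax_p₂ ζ hζ) (fun x t => hψ.ne_zero hq hζ x t) hb,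
    smul_smul, smul_smul, mul_assoc, ← Complex.exp_add, mul_comm]
  congr 3
  ring

/-! ### The symmetries of the discrete data -/

theorem Theta_conj (x t : ℝ) (ζ : ℂ) : Theta P x t (conj ζ) = conj (Theta P x t ζ) := by
  simp only [Theta, lam_conj, specZ_eq, kap_conj]
  simp [Complex.conj_ofNat]

theorem Theta_tau (x t : ℝ) {ζ : ℂ} (h0 : ζ ≠ 0) :
    Theta P x t (-(P.q₀ : ℂ) ^ 2 / conj ζ) = -conj (Theta P x t ζ) := by
  have hc : conj ζ ≠ 0 := by simpa using h0
  rw [← Theta_conj]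
  simp only [Theta, specZ_eq, lam_neg_div P hc, kap_neg_div P hc]
  ring

/-- The antiholomorphic symmetry of a is written as the holomorphic function conj ∘ a ∘ conj
composed with ξ ↦ -q₀²/ξ, to which the chain rule applies. -/
theorem IsJostPair.deriv_coefA_tau {u : ℝ → ℂ} {f : ℝ → ℝ} {n m : ℂ → ℝ → Fin 2 → ℂ}
    (h : IsJostPair P u f n m) {ζ : ℂ} (hζ : ζ ∈ D₁ P) (x : ℝ)
    (hτ : -(P.q₀ : ℂ) ^ 2 / conj ζ ∈ D₁ P) :
    deriv (coefA P n m x) (-(P.q₀ : ℂ) ^ 2 / conj ζ) =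
      P.qp / P.qm * conj (deriv (coefA P n m x) ζ) * (conj ζ ^ 2 / (P.q₀ : ℂ) ^ 2) := by
  have hS : ζ ∈ S₁ P := Or.inr hζ
  have h0 := ne_zero_of_mem_S₁ P hS
  have hc0 : conj ζ ≠ 0 := by simpa using h0
  have hq := P.q₀_ne
  set τ := -(P.q₀ : ℂ) ^ 2 / conj ζ with hτdef
  have hτ0 : τ ≠ 0 := div_ne_zero (neg_ne_zero.2 (pow_ne_zero 2 hq)) hc0
  have ha := ((h.coefA_differentiableWithinAt hS x).differentiableAt (S₁_mem_nhds hζ)).hasDerivAt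
  have hστ : -(P.q₀ : ℂ) ^ 2 / τ = conj ζ := by
    rw [hτdef]
    field_simp
  have h1 : HasDerivAt (fun ξ : ℂ => -(P.q₀ : ℂ) ^ 2 / ξ) ((P.q₀ : ℂ) ^ 2 / τ ^ 2) τ := by
    have := (hasDerivAt_inv hτ0).const_mul (-(P.q₀ : ℂ) ^ 2)
    simp only [div_eq_mul_inv]
    refine this.congr_deriv ?_
    ring
  have h2 : HasDerivAt (conj ∘ coefA P n m x ∘ conj) (conj (deriv (coefA P n m x) ζ))
      (-(P.q₀ : ℂ) ^ 2 / τ) := by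
    rw [hστ]
    exact ha.conj_conj
  have h3 := (h2.comp τ h1).const_mul (P.qp / P.qm)
  have h4 : HasDerivAt (coefA P n m x) (P.qp / P.qm *
      (conj (deriv (coefA P n m x) ζ) * ((P.q₀ : ℂ) ^ 2 / τ ^ 2))) τ := by
    refine h3.congr_of_eventuallyEq ?_
    filter_upwards [S₁_mem_nhds hτ] with ξ hξ
    have h5 := h.coefA_tau (tau_mem_S₁ hξ) x
    rw [tau_tau (ne_zero_of_mem_S₁ P hξ)] at h5
    rw [h5]
    simp
  rw [h4.deriv, hτdef]
  field_simp

/-- The symmetry preserves Im λ, whose sign characterizes D₁. -/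
theorem tau_mem_D₁ {ζ : ℂ} (hζ : ζ ∈ D₁ P) : -(P.q₀ : ℂ) ^ 2 / conj ζ ∈ D₁ P := by
  have h0 := ne_zero_of_mem_S₁ P (Or.inr hζ)
  have h1 := lam_im P h0
  have hc : conj ζ ≠ 0 := by simpa using h0
  have hτ0 : -(P.q₀ : ℂ) ^ 2 / conj ζ ≠ 0 :=
    div_ne_zero (neg_ne_zero.2 (pow_ne_zero 2 P.q₀_ne)) hc
  have h2 := lam_im P hτ0
  have hn : 0 < ‖ζ‖ := norm_pos_iff.2 h0
  have hn' : 0 < ‖-(P.q₀ : ℂ) ^ 2 / conj ζ‖ := norm_pos_iff.2 hτ0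
  have h3 : (lam P (-(P.q₀ : ℂ) ^ 2 / conj ζ)).im = (lam P ζ).im := by
    rw [lam_neg_div P hc, lam_conj, Complex.neg_im, Complex.conj_im, neg_neg]
  rw [h1, h2] at h3
  have hD : 0 < (‖ζ‖ ^ 2 - P.q₀ ^ 2) * ζ.im := hζ
  have h4 : 0 < (‖ζ‖ ^ 2 - P.q₀ ^ 2) * ζ.im / (2 * ‖ζ‖ ^ 2) := by positivity
  rw [← h3] at h4
  exact (div_pos_iff_of_pos_right (by positivity)).1 h4

theorem eta_castAdd {N : ℕ} (ζ : Fin N → ℂ) (j : Fin N) : eta P ζ (Fin.castAdd N j) = ζ j :=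
  Fin.append_left _ _ j

theorem eta_natAdd {N : ℕ} (ζ : Fin N → ℂ) (j : Fin N) :
    eta P ζ (Fin.natAdd N j) = -(P.q₀ : ℂ) ^ 2 / conj (ζ j) :=
  Fin.append_right _ _ j

theorem norm_tau (ζ : ℂ) : ‖-(P.q₀ : ℂ) ^ 2 / conj ζ‖ = P.q₀ ^ 2 / ‖ζ‖ := by
  rw [norm_div, norm_neg, norm_pow, Complex.norm_real, Real.norm_of_nonneg P.q₀_pos.le,
    Complex.norm_conj]

/-! ### The zeros of a and the norming constants on all of D₁. -/

section Discrete

variable {N : ℕ} {ζ b : Fin N → ℂ}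

theorem IsReflectionlessSimple.mem_D₁ (h : IsReflectionlessSimple P ψp ψm ζ b) (j : Fin N) :
    ζ j ∈ D₁ P := by
  have h1 := h.outside j
  have h2 := P.q₀_pos
  have : P.q₀ ^ 2 < ‖ζ j‖ ^ 2 := by gcongr
  exact mul_pos (sub_pos.2 this) (h.upper j)

theorem IsReflectionlessSimple.eta_mem_D₁ (h : IsReflectionlessSimple P ψp ψm ζ b)
    (k : Fin (N + N)) : eta P ζ k ∈ D₁ P := by
  refine Fin.addCases (fun j => ?_) (fun j => ?_) k
  · rw [eta_castAdd]
    exact h.mem_D₁ j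
  · rw [eta_natAdd]
    exact tau_mem_D₁ (h.mem_D₁ j)

theorem norm_tau_lt {ζ : ℂ} (h : P.q₀ < ‖ζ‖) : ‖-(P.q₀ : ℂ) ^ 2 / conj ζ‖ < P.q₀ := by
  have h0 := P.q₀_pos
  rw [norm_tau, div_lt_iff₀ (h0.trans h), sq]
  exact mul_lt_mul_of_pos_left h h0

theorem IsReflectionlessSimple.eta_injective (h : IsReflectionlessSimple P ψp ψm ζ b) :
    Function.Injective (eta P ζ) := by
  have hne : ∀ j l, ζ j ≠ -(P.q₀ : ℂ) ^ 2 / conj (ζ l) := fun j l e => by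
    have h1 := norm_tau_lt (h.outside l)
    rw [← e] at h1
    exact lt_asymm h1 (h.outside j)
  intro k k'
  refine Fin.addCases (fun j => ?_) (fun j => ?_) k <;>
    refine Fin.addCases (fun l => ?_) (fun l => ?_) k' <;>
    intro e <;> simp only [eta_castAdd, eta_natAdd] at e
  · rw [h.injective e]
  · exact absurd e (hne j l)
  · exact absurd e.symm (hne l j)
  · have e1 := congrArg (fun ξ => -(P.q₀ : ℂ) ^ 2 / conj ξ) e
    simp only [tau_tau (ne_zero_of_mem_S₁ P (Or.inr (h.mem_D₁ _)))] at e1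
    rw [h.injective e1]

/-- D₁ consists of the exterior of the circle in the upper half plane and of its interior in the
lower one. The symmetry exchanges the two and preserves the zeros of a, so the outer zeros determine
the inner ones. -/
theorem IsReflectionlessSimple.scatA_eq_zero_iff (h : IsReflectionlessSimple P ψp ψm ζ b)
    (hψ : IsJost P q ψp ψm) (hq : IsSolution P q) {w : ℂ} (hw : w ∈ D₁ P) :
    scatA P ψp ψm w = 0 ↔ ∃ k, eta P ζ k = w := by
  have hsplit : (∃ k, eta P ζ k = w) ↔
      (∃ j, ζ j = w) ∨ ∃ j, -(P.q₀ : ℂ) ^ 2 / conj (ζ j) = w := by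
    constructor
    · rintro ⟨k, rfl⟩
      refine Fin.addCases (fun j => ?_) (fun j => ?_) k
      · exact Or.inl ⟨j, (eta_castAdd ζ j).symm⟩
      · exact Or.inr ⟨j, (eta_natAdd ζ j).symm⟩
    · rintro (⟨j, rfl⟩ | ⟨j, rfl⟩)
      · exact ⟨_, eta_castAdd ζ j⟩
      · exact ⟨_, eta_natAdd ζ j⟩
  rw [hsplit]
  have h0 := ne_zero_of_mem_S₁ P (Or.inr hw)
  have hD : 0 < (‖w‖ ^ 2 - P.q₀ ^ 2) * w.im := hw
  have hq0 := P.q₀_pos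
  rcases pos_and_pos_or_neg_and_neg_of_mul_pos hD with ⟨h1, h2⟩ | ⟨h1, h2⟩
  · have h3 : P.q₀ < ‖w‖ := lt_of_pow_lt_pow_left₀ 2 (norm_nonneg _) (sub_pos.1 h1)
    rw [h.zeros w h3 h2]
    refine ⟨Or.inl, fun h4 => h4.resolve_right ?_⟩
    rintro ⟨j, rfl⟩
    exact lt_asymm h3 (norm_tau_lt (h.outside j))
  · have h3 : ‖w‖ < P.q₀ := lt_of_pow_lt_pow_left₀ 2 hq0.le (sub_neg.1 h1)
    have hτ := tau_mem_D₁ hw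
    have hn : P.q₀ < ‖-(P.q₀ : ℂ) ^ 2 / conj w‖ := by
      rw [norm_tau, lt_div_iff₀ (norm_pos_iff.2 h0), sq]
      exact mul_lt_mul_of_pos_left h3 hq0
    have him : 0 < (-(P.q₀ : ℂ) ^ 2 / conj w).im := by
      have h4 : 0 < (‖-(P.q₀ : ℂ) ^ 2 / conj w‖ ^ 2 - P.q₀ ^ 2) *
        (-(P.q₀ : ℂ) ^ 2 / conj w).im := hτ
      have h5 : P.q₀ ^ 2 < ‖-(P.q₀ : ℂ) ^ 2 / conj w‖ ^ 2 := by gcongr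
      exact (pos_iff_pos_of_mul_pos h4).1 (sub_pos.2 h5)
    have e := (hψ.isJostPair hq h.reflectionless 0).coefA_tau (Or.inr hw) 0
    rw [hψ.coefA_eq_scatA (Or.inr hw), hψ.coefA_eq_scatA (Or.inr hτ)] at e
    have h5 : scatA P ψp ψm w = 0 ↔ scatA P ψp ψm (-(P.q₀ : ℂ) ^ 2 / conj w) = 0 := by
      rw [e, mul_eq_zero, map_eq_zero, or_iff_right (div_ne_zero P.qp_ne P.qm_ne)]
    rw [h5, h.zeros _ hn him]
    constructor
    · rintro ⟨j, hj⟩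
      exact Or.inr ⟨j, by rw [hj, tau_tau h0]⟩
    · rintro (⟨j, rfl⟩ | ⟨j, rfl⟩)
      · exact absurd (h.outside j) (lt_asymm h3)
      · exact ⟨j, (tau_tau (ne_zero_of_mem_S₁ P (Or.inr (h.mem_D₁ j)))).symm⟩

theorem IsJost.deriv_coefA (hψ : IsJost P q ψp ψm) {w : ℂ} (hw : w ∈ D₁ P) (x t : ℝ) :
    deriv (coefA P (jostN P ψp t) (jostM P ψm t) x) w = deriv (scatA P ψp ψm) w :=
  Filter.EventuallyEq.deriv_eq (by
    filter_upwards [S₁_mem_nhds hw] with ξ hξ using hψ.coefA_eq_scatA hξ x t)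

theorem IsReflectionlessSimple.deriv_tau (h : IsReflectionlessSimple P ψp ψm ζ b)
    (hψ : IsJost P q ψp ψm) (hq : IsSolution P q) (j : Fin N) :
    deriv (scatA P ψp ψm) (-(P.q₀ : ℂ) ^ 2 / conj (ζ j)) =
      P.qp / P.qm * conj (deriv (scatA P ψp ψm) (ζ j)) * (conj (ζ j) ^ 2 / (P.q₀ : ℂ) ^ 2) := by
  have hD := h.mem_D₁ j
  have e := (hψ.isJostPair hq h.reflectionless 0).deriv_coefA_tau hD 0 (tau_mem_D₁ hD)
  rwa [hψ.deriv_coefA hD, hψ.deriv_coefA (tau_mem_D₁ hD)] at e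

theorem IsReflectionlessSimple.deriv_eta_ne_zero (h : IsReflectionlessSimple P ψp ψm ζ b)
    (hψ : IsJost P q ψp ψm) (hq : IsSolution P q) (k : Fin (N + N)) :
    deriv (scatA P ψp ψm) (eta P ζ k) ≠ 0 := by
  refine Fin.addCases (fun j => ?_) (fun j => ?_) k
  · rw [eta_castAdd]
    exact h.simple j
  · rw [eta_natAdd, h.deriv_tau hψ hq]
    have h0 := ne_zero_of_mem_S₁ P (Or.inr (h.mem_D₁ j))
    exact mul_ne_zero (mul_ne_zero (div_ne_zero P.qp_ne P.qm_ne)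
      ((map_ne_zero _).2 (h.simple j))) (div_ne_zero (pow_ne_zero 2 ((map_ne_zero _).2 h0))
        (pow_ne_zero 2 P.q₀_ne))

/-- For the second half of the indices, the symmetries of m, n and a' are applied to m = b_j e^{2iΘ}
n at ζ_j. The resulting factor is c_{N+j} e^{2iΘ} a' at the reflected point, which explains the
definition of c_{N+j}. -/
theorem IsReflectionlessSimple.jostM_eta (h : IsReflectionlessSimple P ψp ψm ζ b)
    (hψ : IsJost P q ψp ψm) (hq : IsSolution P q) (x t : ℝ) (k : Fin (N + N)) :
    jostM P ψm t (eta P ζ k) x = (expC P ζ (norming P ψp ψm ζ b) x t k *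
      deriv (scatA P ψp ψm) (eta P ζ k)) • jostN P ψp t (eta P ζ k) x := by
  refine Fin.addCases (fun j => ?_) (fun j => ?_) k
  · have hS : ζ j ∈ S₁ P := Or.inr (h.mem_D₁ j)
    have e : cAll P ζ (norming P ψp ψm ζ b) (Fin.castAdd N j) = norming P ψp ψm ζ b j :=
      Fin.append_left _ _ j
    have hs := h.simple j
    rw [expC, e, eta_castAdd, hψ.jostM_eq_smul hq hS (h.proportional j), norming]
    congr 1
    field_simp
  · have hS : ζ j ∈ S₁ P := Or.inr (h.mem_D₁ j)
    have h0 := ne_zero_of_mem_S₁ P hS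
    have hc0 : conj (ζ j) ≠ 0 := by simpa using h0
    have e : cAll P ζ (norming P ψp ψm ζ b) (Fin.natAdd N j) =
        (P.q₀ : ℂ) ^ 2 / conj (ζ j) ^ 2 * (conj P.qp / P.qp) *
          (-conj (norming P ψp ψm ζ b j)) := Fin.append_right _ _ j
    have hs : conj (deriv (scatA P ψp ψm) (ζ j)) ≠ 0 := (map_ne_zero _).2 (h.simple j)
    have hp0 := P.qp_ne
    have hcp0 : conj P.qp ≠ 0 := (map_ne_zero _).2 hp0
    have hm0 := P.qm_ne
    have hq0 := P.q₀_ne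
    have hJ := hψ.isJostPair hq h.reflectionless t
    rw [expC, e, eta_natAdd, h.deriv_tau hψ hq, hJ.m_tau hS, hJ.n_tau hS,
      hψ.jostM_eq_smul hq hS (h.proportional j), dual_smul, smul_smul, smul_smul, map_mul,
      ← Complex.exp_conj, Theta_tau x t h0, norming, map_div₀]
    have e2 : conj (2 * Complex.I * Theta P x t (ζ j)) =
        2 * Complex.I * -conj (Theta P x t (ζ j)) := by
      simp [Complex.conj_ofNat]
    rw [e2]
    congr 1
    field_simp

/-- The definitions amount to c̃_k = -c̄_k for all 2N indices. This is the sign condition under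
which M is invertible. -/
theorem vecG_eq (c : Fin N → ℂ) (x t : ℝ) (k : Fin (N + N)) :
    vecG P ζ c x t k = -conj (expC P ζ c x t k) := by
  have e1 : conj (2 * Complex.I * Theta P x t (eta P ζ k)) =
      -2 * Complex.I * Theta P x t (conj (eta P ζ k)) := by
    rw [Theta_conj]
    simp [Complex.conj_ofNat]
  have e2 : ctAll P ζ c k = -conj (cAll P ζ c k) := by
    refine Fin.addCases (fun j => ?_) (fun j => ?_) k
    · rw [ctAll, cAll, Fin.append_left, Fin.append_left]
    · rw [ctAll, cAll, Fin.append_right, Fin.append_right]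
      simp
  rw [vecG, expC, map_mul, ← Complex.exp_conj, e1, e2, neg_mul]

theorem differentiable_expC (c : Fin N → ℂ) (t : ℝ) (k : Fin (N + N)) :
    Differentiable ℝ fun x => expC P ζ c x t k := fun x =>
  (((hasDerivAt_Theta x t (eta P ζ k)).const_mul (2 * Complex.I)).cexp.const_mul
    (cAll P ζ c k)).differentiableAt

end Discrete

end Data

end KunduEckhaus

end

/-! ### Return from u and the gauge factor to q. -/

theorem mainTheorem7 (P : KunduEckhaus.Params) (q : ℝ → ℝ → ℂ)
    (hq : KunduEckhaus.IsSolution P q)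
    (ψp ψm : ℝ → ℝ → ℂ → Matrix (Fin 2) (Fin 2) ℂ)
    (hψ : KunduEckhaus.IsJost P q ψp ψm)
    (N : ℕ) (ζ b : Fin N → ℂ)
    (hdata : KunduEckhaus.IsReflectionlessSimple P ψp ψm ζ b)
    (c : Fin N → ℂ) (hc : c = KunduEckhaus.norming P ψp ψm ζ b) (x t : ℝ) :
    IntegrableOn (fun y => ‖q y t‖ ^ 2 - P.q₀ ^ 2) (Set.Ioi x) ∧
    (KunduEckhaus.matM P ζ c x t).det ≠ 0 ∧
    q x t = Complex.exp (Complex.I *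
          ((KunduEckhaus.Ups P x t - 2 * KunduEckhaus.omegaP P q x t : ℝ) : ℂ))
        * P.qp
        * (1 - (KunduEckhaus.matMΔ P ζ c x t).det / (KunduEckhaus.matM P ζ c x t).det) := by
  open KunduEckhaus in
  subst hc
  have hJ := hψ.isJostPair hq hdata.reflectionless t
  have hD := hdata.eta_mem_D₁
  obtain ⟨h1, h2⟩ := hJ.reconstruction (Even.add_self N) hdata.eta_injective hD
    (C := fun k x => expC P ζ (norming P ψp ψm ζ b) x t k)
    (fun w hw => by
      rw [hψ.coefA_eq_scatA (Or.inr hw)]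
      exact hdata.scatA_eq_zero_iff hψ hq hw)
    (fun k => by
      rw [hψ.deriv_coefA (hD k)]
      exact hdata.deriv_eta_ne_zero hψ hq k)
    (differentiable_expC _ t)
    (fun k x => by
      rw [hψ.deriv_coefA (hD k)]
      exact hdata.jostM_eta hψ hq x t k) x
    (G := vecG P ζ (norming P ψp ψm ζ b) x t) (F := vecF P ζ (norming P ψp ψm ζ b) x t)
    (M := matM P ζ (norming P ψp ψm ζ b) x t) (vecG_eq _ x t) (fun _ => rfl) rfl
  refine ⟨hq.integrableOn_sq x t, h1, ?_⟩
  have h3 : q x t = potU P q t x * Complex.exp (Complex.I * Ups P x t) := by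
    rw [potU, mul_assoc, ← Complex.exp_add]
    simp
  -- The gauge factor is e^{iω₊}; its conjugate squared contributes -2ω₊ to the phase.
  have h4 : conj (gauge (potF P q t) x) ^ 2 * Complex.exp (Complex.I * Ups P x t) =
      Complex.exp (Complex.I * ((Ups P x t - 2 * omegaP P q x t : ℝ) : ℂ)) := by
    rw [gauge_potF, ← Complex.exp_conj, ← Complex.exp_nat_mul, ← Complex.exp_add]
    congr 1
    simp
    ring
  rw [h3, h2, ← h4]
  change _ = _ * _ * (1 - (Matrix.of (Fin.cons (Fin.snoc (α := fun _ => ℂ) _ 0) _)).det / _)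
  ring
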